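/- Let $k$ be a field of characteristic $0$ and let $X$ be an fs log scheme over $k$ (for instance a log smooth variety). Let $\mathsf{Log}$ be the stack over $k$ of fs log structures, and let $X\to\mathcal A_X$ be the Artin fan of $X$, i.e. the initial factorization $X\to\mathcal A_X\to\mathsf{Log}$ of the classifying map of $X$ through an étale morphism to $\mathsf{Log}$ that is representable by algebraic spaces. For $n\ge 0$ let $\widehat{X^n}=X\times_{\mathcal A_X}\cdots\times_{\mathcal A_X}X$ ($n$ factors, as a fibre product of stacks; $\widehat{X^0}=\mathcal A_X$), with the action of $S_n$ over $\mathcal A_X$ permuting the factors. For $\sigma\in S_n$, the log fixed locus $(\widehat{X^n})^\sigma_{\log}$ is the fibre product of the diagonal $x\mapsto(x,x)$ and the twisted diagonal $x\mapsto(x,\sigma x)$, both regarded as morphisms $\widehat{X^n}\to\widehat{X^n}\times_{\mathcal A_X}\widehat{X^n}$. Let $O(\sigma)$ be the set of orbits of $\sigma$ on $\{1,\dots,n\}$. **Lemma.** (1) For all $n\ge 0$ and $\sigma\in S_n$ there is an equivalence $(\widehat{X^n})^\sigma_{\log}\simeq\widehat{X^{\#O(\sigma)}}$. More precisely, for every enumeration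 $O(\sigma)\cong\{1,\dots,\#O(\sigma)\}$ there is an equivalence that identifies the projection $(\widehat{X^n})^\sigma_{\log}\to\widehat{X^n}$ with the diagonal morphism $\widehat{X^{\#O(\sigma)}}\to\widehat{X^n}$ whose $i$-th component is the component indexed by the orbit of $i$; in particular it is an equivalence over $\mathcal A_X$ and over $\mathsf{Log}$. (2) The log fixed locus can differ from the ordinary fixed locus $(\widehat{X^n})^\sigma$, which is the fibre product of the diagonal and the twisted diagonal $\widehat{X^n}\to\widehat{X^n}\times_k\widehat{X^n}$: if the log structure of $X$ is not trivial and $\sigma\in S_2$ is the transposition, then the natural morphism $(\widehat{X^2})^\sigma_{\log}\to(\widehat{X^2})^\sigma$ is not an isomorphism. -/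

import Mathlib

open CategoryTheory CategoryTheory.Limits AlgebraicGeometry Opposite

universe u

namespace LogGeom

noncomputable section

/-! ### Logarithmic structures on the small étale site -/

/-- A logarithmic structure on a scheme `X`: a sheaf of commutative monoids `M` on the small étale
site of `X`, with a homomorphism `α` to the multiplicative monoid of the structure sheaf that
restricts to an isomorphism `α⁻¹(𝒪ˣ) ≅ 𝒪ˣ`. -/
structure LogStructure (X : Scheme.{u}) where
  M : X.Etaleᵒᵖ ⥤ CommMonCat.{u}
  isSheaf : Presheaf.IsSheaf X.smallEtaleTopology M
  α : ∀ U : X.Etale, M.obj (op U) →* Γ(U.left, ⊤)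
  α_res : ∀ {U V : X.Etale} (r : V ⟶ U) (m : M.obj (op U)),
    α V ((M.map r.op).hom m) = r.left.appTop.hom (α U m)
  existsUnique_unit : ∀ (U : X.Etale) (f : Γ(U.left, ⊤)), IsUnit f → ∃! m, α U m = f

/-! #### Étale schemes over a base -/

/-- The étale morphisms, as a property of morphisms of schemes. -/
abbrev etProp : MorphismProperty Scheme.{u} := @Etale

lemma et_ext {X : Scheme.{u}} {U V : X.Etale} {r s : U ⟶ V} (h : r.left = s.left) : r = s :=
  MorphismProperty.Over.Hom.ext (P := etProp) h

lemma et_w {X : Scheme.{u}} {U V : X.Etale} (r : U ⟶ V) : r.left ≫ V.hom = U.hom :=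
  MorphismProperty.Over.w (P := etProp) r

/-- A morphism of étale `X`-schemes from a morphism of schemes over `X`. -/
def etHom {X : Scheme.{u}} {U V : X.Etale} (h : U.left ⟶ V.left) (w : h ≫ V.hom = U.hom) :
    U ⟶ V :=
  MorphismProperty.Over.homMk (P := etProp) h w

/-- An étale morphism to an étale `X`-scheme, as an étale `X`-scheme. -/
def etOf {X : Scheme.{u}} (U : X.Etale) {W : Scheme.{u}} (f : W ⟶ U.left) (hf : Etale f) :
    X.Etale :=
  MorphismProperty.Over.mk (P := etProp) ⊤ (f ≫ U.hom) (etProp.comp_mem _ _ hf U.prop)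

/-- The étale scheme `V ×_Y X` over `X`, for `V` étale over `Y`. -/
def etPull {X Y : Scheme.{u}} (f : X ⟶ Y) (V : Y.Etale) : X.Etale :=
  MorphismProperty.Over.mk (P := etProp) ⊤ (pullback.snd V.hom f)
    (MorphismProperty.pullback_snd (P := etProp) _ _ V.prop)

/-- The projection `V ×_Y X → V`. -/
def etPullFst {X Y : Scheme.{u}} (f : X ⟶ Y) (V : Y.Etale) : (etPull f V).left ⟶ V.left :=
  pullback.fst V.hom f

lemma etPullFst_w {X Y : Scheme.{u}} (f : X ⟶ Y) (V : Y.Etale) :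
    etPullFst f V ≫ V.hom = (etPull f V).hom ≫ f :=
  pullback.condition

/-- The map to `V ×_Y X` induced by a map to `V` and a map to `X`. -/
def etPullLift {X Y W : Scheme.{u}} (f : X ⟶ Y) (V : Y.Etale) (h : W ⟶ V.left) (b : W ⟶ X)
    (w : h ≫ V.hom = b ≫ f) : W ⟶ (etPull f V).left :=
  pullback.lift h b w

lemma etPullLift_fst {X Y W : Scheme.{u}} (f : X ⟶ Y) (V : Y.Etale) (h : W ⟶ V.left) (b : W ⟶ X)
    (w : h ≫ V.hom = b ≫ f) : etPullLift f V h b w ≫ etPullFst f V = h :=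
  pullback.lift_fst _ _ _

lemma etPullLift_hom {X Y W : Scheme.{u}} (f : X ⟶ Y) (V : Y.Etale) (h : W ⟶ V.left) (b : W ⟶ X)
    (w : h ≫ V.hom = b ≫ f) : etPullLift f V h b w ≫ (etPull f V).hom = b :=
  pullback.lift_snd _ _ _

/-- Étale neighbourhoods pull back: given `h : U → V` over `f : X → Y`, an étale neighbourhood
`V' → V` of the image of `x ∈ U` is dominated by an étale neighbourhood of `x`. -/
lemma exists_etale_nbhd {X Y : Scheme.{u}} {U : X.Etale} {V V' : Y.Etale}
    (h : U.left ⟶ V.left) (t : V' ⟶ V) (x : U.left) (v : V'.left) (hv : t.left v = h x) :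
    ∃ (W : X.Etale) (s : W ⟶ U) (w : W.left) (h' : W.left ⟶ V'.left),
      s.left w = x ∧ h' w = v ∧ h' ≫ t.left = s.left ≫ h := by
  have ht : etProp t.left := by
    have h1 : etProp (t.left ≫ V.hom) := by rw [et_w]; exact V'.prop
    exact etProp.of_postcomp _ _ V.prop h1
  obtain ⟨z, hz1, hz2⟩ := Scheme.Pullback.exists_preimage_pullback x v hv.symm
  have hf : etProp (pullback.fst h t.left) := MorphismProperty.pullback_fst (P := etProp) _ _ ht
  exact ⟨etOf U (pullback.fst h t.left) hf, etHom (pullback.fst h t.left) rfl, z,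
    pullback.snd h t.left, hz1, hz2, pullback.condition.symm⟩

namespace LogStructure

variable {X : Scheme.{u}} (L : LogStructure X)

/-- Sections of the log structure over an étale `U → X`. -/
abbrev Sec (U : X.Etale) : Type u := L.M.obj (op U)

/-- Restriction of sections. -/
def res {U V : X.Etale} (r : V ⟶ U) : L.Sec U →* L.Sec V := (L.M.map r.op).hom

lemma res_res {U V W : X.Etale} (r : V ⟶ U) (s : W ⟶ V) (m : L.Sec U) :
    L.res s (L.res r m) = L.res (s ≫ r) m := by
  simp [res]

lemma res_id {U : X.Etale} (m : L.Sec U) : L.res (𝟙 U) m = m := by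
  simp [res]

/-- The log structure is trivial if `M = 𝒪ˣ`. -/
def IsTrivial : Prop := ∀ (U : X.Etale) (m : L.Sec U), IsUnit m

/-- `β : P → M(U)` is a chart: the induced map from the log structure associated with
`P → M|_U → 𝒪|_U` to `M|_U` is an isomorphism. The two fields are surjectivity and injectivity of
this map of étale sheaves; the associated log structure is the quotient of `P ⊕ 𝒪ˣ` that
identifies `(p, u)` and `(q, v)` when, locally, there are `a, b ∈ P` mapping to units with
`a p = b q` and `b u = a v`. -/
structure IsChart (U : X.Etale) {P : Type u} [CommMonoid P] (β : P →* L.Sec U) : Prop where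
  surj : ∀ (V : X.Etale) (r : V ⟶ U) (m : L.Sec V) (x : V.left),
    ∃ (W : X.Etale) (s : W ⟶ V) (w : W.left) (p : P) (c : (L.Sec W)ˣ),
      s.left w = x ∧ L.res s m = c * L.res (s ≫ r) (β p)
  inj : ∀ (V : X.Etale) (r : V ⟶ U) (p q : P) (c d : (L.Sec V)ˣ),
    c * L.res r (β p) = d * L.res r (β q) → ∀ x : V.left,
    ∃ (W : X.Etale) (s : W ⟶ V) (w : W.left) (a b : P),
      s.left w = x ∧ IsUnit (L.res (s ≫ r) (β a)) ∧ IsUnit (L.res (s ≫ r) (β b)) ∧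
      a * p = b * q ∧
      L.res (s ≫ r) (β b) * L.res s c = L.res (s ≫ r) (β a) * L.res s d

end LogStructure

/-- A fine and saturated (fs) monoid: finitely generated, cancellative, and containing every
element of its group completion that has a positive power in it. -/
structure IsFsMonoid (P : Type u) [CommMonoid P] : Prop where
  fg : Monoid.FG P
  cancel : IsCancelMul P
  saturated : ∀ (a b : P) (n : ℕ), 0 < n → (∃ c, a ^ n = b ^ n * c) → ∃ c, a = b * c

/-- An fs log structure: étale locally it has a chart by an fs monoid. -/
def LogStructure.IsFs {X : Scheme.{u}} (L : LogStructure X) : Prop :=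
  ∀ x : X, ∃ (U : X.Etale) (y : U.left) (P : Type u) (_ : CommMonoid P) (β : P →* L.Sec U),
    U.hom y = x ∧ IsFsMonoid P ∧ L.IsChart U β

/-! ### Morphisms of log schemes -/

/-- A morphism of log schemes `(X, L) → (Y, K)`: a morphism `f` of schemes and a homomorphism
`f⁻¹ K → L` compatible with the maps to the structure sheaves. The homomorphism is given by its
components `K(V) → L(U)`, one for each `U → V` over `f` with `U` étale over `X` and `V` étale
over `Y`. -/
structure LogHom {X Y : Scheme.{u}} (L : LogStructure X) (K : LogStructure Y) where
  base : X ⟶ Y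
  comap : ∀ {U : X.Etale} {V : Y.Etale} (h : U.left ⟶ V.left),
    h ≫ V.hom = U.hom ≫ base → K.Sec V →* L.Sec U
  res_comap : ∀ {U U' : X.Etale} {V : Y.Etale} (r : U' ⟶ U) (h : U.left ⟶ V.left)
    (w : h ≫ V.hom = U.hom ≫ base) (w' : (r.left ≫ h) ≫ V.hom = U'.hom ≫ base) (n : K.Sec V),
    L.res r (comap h w n) = comap (r.left ≫ h) w' n
  comap_res : ∀ {U : X.Etale} {V V' : Y.Etale} (h : U.left ⟶ V.left) (s : V ⟶ V')
    (w : h ≫ V.hom = U.hom ≫ base) (w' : (h ≫ s.left) ≫ V'.hom = U.hom ≫ base) (n : K.Sec V'),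
    comap h w (K.res s n) = comap (h ≫ s.left) w' n
  α_comap : ∀ {U : X.Etale} {V : Y.Etale} (h : U.left ⟶ V.left)
    (w : h ≫ V.hom = U.hom ≫ base) (n : K.Sec V),
    L.α U (comap h w n) = h.appTop.hom (K.α V n)

namespace LogHom

variable {X Y Z T : Scheme.{u}} {L : LogStructure X} {K : LogStructure Y} {J : LogStructure Z}
  {I : LogStructure T}

lemma ext {φ ψ : LogHom L K} (hb : φ.base = ψ.base)
    (hc : ∀ {U : X.Etale} {V : Y.Etale} (h : U.left ⟶ V.left) (w : h ≫ V.hom = U.hom ≫ φ.base)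
      (w' : h ≫ V.hom = U.hom ≫ ψ.base) (n : K.Sec V), φ.comap h w n = ψ.comap h w' n) :
    φ = ψ := by
  obtain ⟨b, c, _, _, _⟩ := φ
  obtain ⟨b', c', _, _, _⟩ := ψ
  obtain rfl : b = b' := hb
  have : @c = @c' := by
    funext U V h w
    exact MonoidHom.ext fun n => hc h w w n
  subst this
  rfl

lemma comap_congr (φ : LogHom L K) {U : X.Etale} {V : Y.Etale} {h h' : U.left ⟶ V.left}
    (e : h = h') (w : h ≫ V.hom = U.hom ≫ φ.base) (w' : h' ≫ V.hom = U.hom ≫ φ.base)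
    (n : K.Sec V) : φ.comap h w n = φ.comap h' w' n := by
  subst e; rfl

/-- The identity morphism. -/
protected def id (L : LogStructure X) : LogHom L L where
  base := 𝟙 X
  comap h w := L.res (etHom h (w.trans (Category.comp_id _)))
  res_comap r h w w' n := by
    rw [LogStructure.res_res]
    exact congrArg (fun s => L.res s n) (et_ext rfl)
  comap_res h s w w' n := by
    rw [LogStructure.res_res]
    exact congrArg (fun s => L.res s n) (et_ext rfl)
  α_comap h w n := L.α_res _ _

lemma comp_aux (φ : LogHom L K) (ψ : LogHom K J) {U : X.Etale} {V V' : Y.Etale} {W : Z.Etale}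
    (s : V ⟶ V') (h : U.left ⟶ V.left) (w : h ≫ V.hom = U.hom ≫ φ.base)
    (h' : U.left ⟶ V'.left) (w' : h' ≫ V'.hom = U.hom ≫ φ.base)
    (k : V.left ⟶ W.left) (wk : k ≫ W.hom = V.hom ≫ ψ.base)
    (k' : V'.left ⟶ W.left) (wk' : k' ≫ W.hom = V'.hom ≫ ψ.base)
    (e : h ≫ s.left = h') (e' : s.left ≫ k' = k) (n : J.Sec W) :
    φ.comap h w (ψ.comap k wk n) = φ.comap h' w' (ψ.comap k' wk' n) := by
  subst e e'
  rw [← ψ.res_comap s k' wk' wk, φ.comap_res h s w w']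

/-- The component of a composite, computed through `W ×_Z Y`. -/
def compComap (φ : LogHom L K) (ψ : LogHom K J) {U : X.Etale} {W : Z.Etale}
    (h : U.left ⟶ W.left) (w : h ≫ W.hom = U.hom ≫ φ.base ≫ ψ.base) : J.Sec W →* L.Sec U :=
  (φ.comap (V := etPull ψ.base W)
    (etPullLift ψ.base W h (U.hom ≫ φ.base) (by rw [w, Category.assoc]))
    (etPullLift_hom _ _ _ _ _)).comp
  (ψ.comap (etPullFst ψ.base W) (etPullFst_w ψ.base W))

/-- The component of a composite can be computed through any intermediate étale scheme. -/
lemma compComap_eq (φ : LogHom L K) (ψ : LogHom K J) {U : X.Etale} {V : Y.Etale} {W : Z.Etale}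
    (h : U.left ⟶ W.left) (w : h ≫ W.hom = U.hom ≫ φ.base ≫ ψ.base)
    (a : U.left ⟶ V.left) (wa : a ≫ V.hom = U.hom ≫ φ.base)
    (b : V.left ⟶ W.left) (wb : b ≫ W.hom = V.hom ≫ ψ.base) (e : a ≫ b = h) (n : J.Sec W) :
    compComap φ ψ h w n = φ.comap a wa (ψ.comap b wb n) := by
  symm
  refine comp_aux φ ψ (etHom (etPullLift ψ.base W b V.hom wb) (etPullLift_hom _ _ _ _ _))
    _ _ _ _ _ _ _ _ ?_ (etPullLift_fst _ _ _ _ _) n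
  refine pullback.hom_ext ?_ ?_
  · change (a ≫ etPullLift ψ.base W b V.hom wb) ≫ etPullFst ψ.base W = _ ≫ etPullFst ψ.base W
    rw [Category.assoc, etPullLift_fst, etPullLift_fst, e]
  · change (a ≫ etPullLift ψ.base W b V.hom wb) ≫ (etPull ψ.base W).hom =
      _ ≫ (etPull ψ.base W).hom
    rw [Category.assoc, etPullLift_hom, etPullLift_hom, wa]

/-- Composition of morphisms of log schemes. -/
protected def comp (φ : LogHom L K) (ψ : LogHom K J) : LogHom L J where
  base := φ.base ≫ ψ.base
  comap h w := compComap φ ψ h w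
  res_comap {U U' W} r h w w' n := by
    have w1 : (r.left ≫ etPullLift ψ.base W h (U.hom ≫ φ.base) (by rw [w, Category.assoc])) ≫
        (etPull ψ.base W).hom = U'.hom ≫ φ.base := by
      rw [Category.assoc, etPullLift_hom, ← Category.assoc, et_w]
    rw [compComap_eq φ ψ (r.left ≫ h) w' _ w1 _ (etPullFst_w ψ.base W)
      (by rw [Category.assoc, etPullLift_fst])]
    exact φ.res_comap r _ _ w1 _
  comap_res {U W W'} h s w w' n := by
    have w1 : (etPullFst ψ.base W ≫ s.left) ≫ W'.hom = (etPull ψ.base W).hom ≫ ψ.base := by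
      rw [Category.assoc, et_w, etPullFst_w]
    rw [compComap_eq φ ψ (h ≫ s.left) w' _ (etPullLift_hom ψ.base W h (U.hom ≫ φ.base)
      (by rw [w, Category.assoc])) _ w1 (by rw [← Category.assoc, etPullLift_fst])]
    exact congrArg _ (ψ.comap_res _ s _ w1 n)
  α_comap {U W} h w n := by
    refine (φ.α_comap _ _ _).trans ?_
    rw [ψ.α_comap, ← CommRingCat.comp_apply, ← Scheme.Hom.comp_appTop, etPullLift_fst]

protected lemma id_comp (φ : LogHom L K) : (LogHom.id L).comp φ = φ := by
  refine ext (Category.id_comp _) fun {U V} h w w' n => ?_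
  refine (compComap_eq (LogHom.id L) φ h w (𝟙 U.left) (by
    change _ = _ ≫ 𝟙 _
    rw [Category.id_comp, Category.comp_id]) h w' (Category.id_comp _) n).trans ?_
  have w1 : (𝟙 U.left ≫ h) ≫ V.hom = U.hom ≫ φ.base := by rw [Category.id_comp, w']
  exact (φ.res_comap (etHom (𝟙 U.left) (Category.id_comp _)) h w' w1 n).trans
    (φ.comap_congr (Category.id_comp h) _ _ n)

protected lemma comp_id (φ : LogHom L K) : φ.comp (LogHom.id K) = φ := by
  refine ext (Category.comp_id _) fun {U V} h w w' n => ?_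
  refine (compComap_eq φ (LogHom.id K) h w h w' (𝟙 V.left) (by
    change _ = _ ≫ 𝟙 _
    rw [Category.id_comp, Category.comp_id]) (Category.comp_id _) n).trans ?_
  exact congrArg _ (K.res_id n)

protected lemma assoc (φ : LogHom L K) (ψ : LogHom K J) (χ : LogHom J I) :
    (φ.comp ψ).comp χ = φ.comp (ψ.comp χ) := by
  refine ext (Category.assoc _ _ _) fun {U W} h w w' n => ?_
  have wa : etPullLift χ.base W h (U.hom ≫ φ.base ≫ ψ.base)
      (by rw [Category.assoc, Category.assoc]; exact w') ≫ (etPull χ.base W).hom =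
        U.hom ≫ φ.base ≫ ψ.base := etPullLift_hom _ _ _ _ _
  have wb : (etPullFst ψ.base (etPull χ.base W) ≫ etPullFst χ.base W) ≫ W.hom =
      (etPull ψ.base (etPull χ.base W)).hom ≫ ψ.base ≫ χ.base := by
    rw [Category.assoc, etPullFst_w, ← Category.assoc, etPullFst_w, Category.assoc]
  refine Eq.trans ?_ (compComap_eq φ (ψ.comp χ) h w' _
    (etPullLift_hom ψ.base (etPull χ.base W) _ (U.hom ≫ φ.base)
      (wa.trans (Category.assoc _ _ _).symm)) _ wb (by
        rw [← Category.assoc, etPullLift_fst, etPullLift_fst]) n).symm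
  exact congrArg _ (compComap_eq ψ χ _ wb _ (etPullFst_w _ _) _ (etPullFst_w _ _) rfl n).symm

lemma comp_comap_eq (φ : LogHom L K) (ψ : LogHom K J) {U : X.Etale} {V : Y.Etale} {W : Z.Etale}
    (h : U.left ⟶ W.left) (w : h ≫ W.hom = U.hom ≫ (φ.comp ψ).base)
    (a : U.left ⟶ V.left) (wa : a ≫ V.hom = U.hom ≫ φ.base)
    (b : V.left ⟶ W.left) (wb : b ≫ W.hom = V.hom ≫ ψ.base) (e : a ≫ b = h) (n : J.Sec W) :
    (φ.comp ψ).comap h w n = φ.comap a wa (ψ.comap b wb n) :=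
  compComap_eq φ ψ h w a wa b wb e n

/-- A morphism `φ : (X, L) → (Y, K)` over `f` is strict if the induced map `f^* K → L` from the
pulled-back log structure is an isomorphism. The two fields are surjectivity and injectivity of
this map of étale sheaves; `f^* K` is the quotient of `f⁻¹ K ⊕ 𝒪ˣ` that identifies `(n, c)` and
`(n', d)` when, locally, there are units `a, b` of `f⁻¹ K` with `a n = b n'` and `b c = a d`. -/
structure IsStrict (φ : LogHom L K) : Prop where
  surj : ∀ (U : X.Etale) (m : L.Sec U) (x : U.left),
    ∃ (W : X.Etale) (s : W ⟶ U) (w : W.left) (V : Y.Etale) (h : W.left ⟶ V.left)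
      (hw : h ≫ V.hom = W.hom ≫ φ.base) (n : K.Sec V) (c : (L.Sec W)ˣ),
      s.left w = x ∧ L.res s m = c * φ.comap h hw n
  inj : ∀ (U : X.Etale) (V : Y.Etale) (h : U.left ⟶ V.left)
    (hw : h ≫ V.hom = U.hom ≫ φ.base) (n n' : K.Sec V) (c d : (L.Sec U)ˣ),
    c * φ.comap h hw n = d * φ.comap h hw n' → ∀ x : U.left,
    ∃ (W : X.Etale) (s : W ⟶ U) (w : W.left) (V' : Y.Etale) (t : V' ⟶ V)
      (h' : W.left ⟶ V'.left) (hw' : h' ≫ V'.hom = W.hom ≫ φ.base) (a b : (K.Sec V')ˣ),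
      s.left w = x ∧ h' ≫ t.left = s.left ≫ h ∧ a * K.res t n = b * K.res t n' ∧
      φ.comap h' hw' b * L.res s c = φ.comap h' hw' a * L.res s d

lemma IsStrict.id (L : LogStructure X) : (LogHom.id L).IsStrict where
  surj U m x := ⟨U, 𝟙 U, x, U, 𝟙 U.left, by
    change _ = _ ≫ 𝟙 _
    rw [Category.id_comp, Category.comp_id], m, 1, rfl, by
      rw [Units.val_one, one_mul]
      exact congrArg (fun r => L.res r m) (et_ext rfl)⟩
  inj U V h hw n n' c d e x := by
    have hw1 : h ≫ V.hom = U.hom := hw.trans (Category.comp_id _)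
    have hw2 : 𝟙 U.left ≫ U.hom = U.hom ≫ 𝟙 X :=
      (Category.id_comp _).trans (Category.comp_id U.hom).symm
    have e1 : etHom (𝟙 U.left) (hw2.trans (Category.comp_id _)) = 𝟙 U := et_ext rfl
    refine ⟨U, 𝟙 U, x, U, etHom h hw1, 𝟙 U.left, hw2, c, d, rfl, rfl, e, ?_⟩
    change L.res (etHom (𝟙 U.left) _) (d : L.Sec U) * _ =
      L.res (etHom (𝟙 U.left) _) (c : L.Sec U) * _
    rw [e1]
    simp only [LogStructure.res_id]
    exact mul_comm _ _

lemma IsStrict.comp {φ : LogHom L K} {ψ : LogHom K J} (hφ : φ.IsStrict) (hψ : ψ.IsStrict) :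
    (φ.comp ψ).IsStrict where
  surj U m x := by
    obtain ⟨W, s, w, V, h, hw, n, c, hs, hm⟩ := hφ.surj U m x
    obtain ⟨V', t, v, T', g, hg, l, d, ht, hn⟩ := hψ.surj V n (h w)
    obtain ⟨W', s', w', h', hs', -, hc⟩ := exists_etale_nbhd h t w v ht
    have wh' : h' ≫ V'.hom = W'.hom ≫ φ.base := by
      rw [← et_w t, ← Category.assoc, hc, Category.assoc, hw, ← Category.assoc, et_w]
    have wt : (s'.left ≫ h) ≫ V.hom = W'.hom ≫ φ.base := by
      rw [Category.assoc, hw, ← Category.assoc, et_w]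
    have wg : (h' ≫ g) ≫ T'.hom = W'.hom ≫ φ.base ≫ ψ.base := by
      rw [Category.assoc, hg, ← Category.assoc, wh', Category.assoc]
    refine ⟨W', s' ≫ s, w', T', h' ≫ g, wg, l,
      Units.map (L.res s') c * Units.map (φ.comap h' wh') d, ?_, ?_⟩
    · rw [← hs, ← hs']; rfl
    · rw [comp_comap_eq φ ψ (h' ≫ g) wg h' wh' g hg rfl, ← LogStructure.res_res, hm, map_mul,
        φ.res_comap s' h hw wt, φ.comap_congr hc.symm wt (hc ▸ wt),
        ← φ.comap_res h' t wh' (hc ▸ wt), hn, map_mul, Units.val_mul, Units.coe_map, Units.coe_map]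
      exact (mul_assoc _ _ _).symm
  inj U T₀ h hw n n' c d e x := by
    have wl : etPullLift ψ.base T₀ h (U.hom ≫ φ.base) (by rw [Category.assoc]; exact hw) ≫
      (etPull ψ.base T₀).hom = U.hom ≫ φ.base := etPullLift_hom _ _ _ _ _
    obtain ⟨W, s, w, V, t, g, hg, a, b, hs, hgt, hab, hcd⟩ := hφ.inj U (etPull ψ.base T₀) _ wl
      (ψ.comap (etPullFst _ _) (etPullFst_w _ _) n) (ψ.comap (etPullFst _ _) (etPullFst_w _ _) n')
      c d e x
    have wt : (t.left ≫ etPullFst ψ.base T₀) ≫ T₀.hom = V.hom ≫ ψ.base := by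
      rw [Category.assoc, etPullFst_w, ← Category.assoc, et_w]
    rw [ψ.res_comap t _ _ wt, ψ.res_comap t _ _ wt] at hab
    obtain ⟨V', t', v, T', r, g', hg', a', b', ht', hgr, hab', hcd'⟩ :=
      hψ.inj V T₀ _ wt n n' a b hab (g w)
    obtain ⟨W', s', w', h', hs', -, hc⟩ := exists_etale_nbhd g t' w v ht'
    have wh' : h' ≫ V'.hom = W'.hom ≫ φ.base := by
      rw [← et_w t', ← Category.assoc, hc, Category.assoc, hg, ← Category.assoc, et_w]
    have wg : (s'.left ≫ g) ≫ V.hom = W'.hom ≫ φ.base := by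
      rw [Category.assoc, hg, ← Category.assoc, et_w]
    have wfin : (h' ≫ g') ≫ T'.hom = W'.hom ≫ φ.base ≫ ψ.base := by
      rw [Category.assoc, hg', ← Category.assoc, wh', Category.assoc]
    refine ⟨W', s' ≫ s, w', T', r, h' ≫ g', wfin, a', b', ?_, ?_, hab', ?_⟩
    · rw [← hs, ← hs']; rfl
    · rw [Category.assoc, hgr, ← Category.assoc, hc]
      change (s'.left ≫ g) ≫ t.left ≫ etPullFst ψ.base T₀ = (s'.left ≫ s.left) ≫ h
      rw [Category.assoc, ← Category.assoc g, hgt, Category.assoc, etPullLift_fst, Category.assoc]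
    · rw [comp_comap_eq φ ψ (h' ≫ g') wfin h' wh' g' hg' rfl,
        comp_comap_eq φ ψ (h' ≫ g') wfin h' wh' g' hg' rfl, ← LogStructure.res_res,
        ← LogStructure.res_res]
      have key (y : K.Sec V) : L.res s' (φ.comap g hg y) = φ.comap h' wh' (K.res t' y) := by
        rw [φ.res_comap s' g hg wg, φ.comap_res h' t' wh' (hc ▸ wg)]
        exact φ.comap_congr hc.symm _ _ _
      have e1 := congrArg (L.res s') hcd
      rw [map_mul, map_mul, key, key] at e1
      have e2 := congrArg (φ.comap h' wh') hcd'
      rw [map_mul, map_mul] at e2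
      have hu : IsUnit (φ.comap h' wh' (K.res t' (a : K.Sec V))) := (a.isUnit.map _).map _
      apply hu.mul_left_cancel
      calc _ = (φ.comap h' wh' (ψ.comap g' hg' b') * φ.comap h' wh' (K.res t' (a : K.Sec V))) *
            L.res s' (L.res s c) := by ac_rfl
        _ = φ.comap h' wh' (ψ.comap g' hg' a') *
            (φ.comap h' wh' (K.res t' (b : K.Sec V)) * L.res s' (L.res s c)) := by
              rw [e2]; ac_rfl
        _ = _ := by rw [e1]; ac_rfl

end LogHom

/-! ### The stack of log structures -/

/-- An fs log scheme over the field `k` (with trivial log structure). -/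
structure LogSch (k : Type u) [Field k] where
  toOver : Over (Spec (CommRingCat.of k))
  log : LogStructure toOver.left
  isFs : log.IsFs

namespace LogSch

variable {k : Type u} [Field k]

/-- A strict morphism of log schemes over `k`. -/
structure Hom (X Y : LogSch k) where
  hom : LogHom X.log Y.log
  strict : hom.IsStrict
  w : hom.base ≫ Y.toOver.hom = X.toOver.hom

lemma Hom.ext {X Y : LogSch k} {f g : Hom X Y} (h : f.hom = g.hom) : f = g := by
  cases f; cases g; cases h; rfl

/-- The stack `Log` over `k`, as a category with a functor to `k`-schemes: its objects are the fs
log schemes over `k` and its morphisms are the strict ones. The objects over a `k`-scheme `T` are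
the fs log structures on `T`, and a strict morphism is a morphism of schemes `f : T → T'` with an
isomorphism `f^* M_{T'} ≅ M_T`. -/
instance : Category.{u + 1} (LogSch k) where
  Hom := Hom
  id X := ⟨LogHom.id X.log, LogHom.IsStrict.id X.log, Category.id_comp _⟩
  comp f g := ⟨f.hom.comp g.hom, f.strict.comp g.strict, by
    change (f.hom.base ≫ g.hom.base) ≫ _ = _
    rw [Category.assoc, g.w, f.w]⟩
  id_comp f := Hom.ext f.hom.id_comp
  comp_id f := Hom.ext f.hom.comp_id
  assoc f g h := Hom.ext (f.hom.assoc g.hom h.hom)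

/-- The underlying `k`-scheme. -/
def forget (k : Type u) [Field k] : LogSch k ⥤ Over (Spec (CommRingCat.of k)) where
  obj X := X.toOver
  map f := Over.homMk f.hom.base f.w

end LogSch

/-! ### Artin fans -/

section ArtinFan

variable {k : Type u} [Field k]

/-- A stack with a morphism to `Log` that is representable by algebraic spaces and étale,
given as a sheaf of sets `F` on `Log`; here `F(T)` is the set of lifts of `T → Log`.
The field `atlas` says that for all `T → Log` the fibre product `F ×_Log T` is an algebraic space
étale over `T`: it has a representable, étale and surjective map from a scheme `U` that is étale
over `T`. -/
structure IsEtaleOverLog (F : (LogSch k)ᵒᵖ ⥤ Type (u + 1)) : Prop where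
  isSheaf : ∀ (T : LogSch k) (S : Sieve T),
    (∀ t : T.toOver.left, ∃ (U : LogSch k) (f : U ⟶ T) (y : U.toOver.left),
      S f ∧ Etale f.hom.base ∧ f.hom.base y = t) → Presieve.IsSheafFor F S.arrows
  atlas : ∀ T : LogSch k, ∃ (U : LogSch k) (p : U ⟶ T) (a : F.obj (op U)), Etale p.hom.base ∧
    ∀ (T' : LogSch k) (t : T' ⟶ T) (b : F.obj (op T')),
      ∃ (V : LogSch k) (v : V ⟶ T') (w : V ⟶ U),
        Etale v.hom.base ∧ Surjective v.hom.base ∧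
        w ≫ p = v ≫ t ∧ F.map w.op a = F.map v.op b ∧
        ∀ (V' : LogSch k) (v' : V' ⟶ T') (w' : V' ⟶ U),
          w' ≫ p = v' ≫ t → F.map w'.op a = F.map v'.op b →
          ∃! r : V' ⟶ V, r ≫ v = v' ∧ r ≫ w = w'

/-- `F`, with the morphism `X → F` over `Log` that corresponds to `s ∈ F(X)`, is the Artin fan of
the log scheme `X`: the initial factorization of `X → Log` through a representable étale
morphism to `Log`. -/
structure IsArtinFan (X : LogSch k) (F : (LogSch k)ᵒᵖ ⥤ Type (u + 1)) (s : F.obj (op X)) :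
    Prop where
  etale : IsEtaleOverLog F
  initial : ∀ (G : (LogSch k)ᵒᵖ ⥤ Type (u + 1)), IsEtaleOverLog G → ∀ t : G.obj (op X),
    ∃! η : F ⟶ G, η.app (op X) s = t

/-- The stack (category fibred in groupoids over `k`-schemes) presented by a sheaf `F` on `Log`:
an object over `T` is an fs log structure on `T` with a section of `F`. -/
structure Stack (F : (LogSch k)ᵒᵖ ⥤ Type (u + 1)) where
  pt : LogSch k
  sec : F.obj (op pt)

namespace Stack

variable {F : (LogSch k)ᵒᵖ ⥤ Type (u + 1)}

instance : Category.{u + 1} (Stack F) where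
  Hom A B := { f : A.pt ⟶ B.pt // F.map f.op B.sec = A.sec }
  id A := ⟨𝟙 _, by simp⟩
  comp f g := ⟨f.1 ≫ g.1, by simp [g.2, f.2]⟩

variable (F) in
/-- The structure morphism to `Log`. -/
def toLog : Stack F ⥤ LogSch k where
  obj A := A.pt
  map f := f.1

variable (F) in
/-- The structure functor to `k`-schemes. -/
def toBase : Stack F ⥤ Over (Spec (CommRingCat.of k)) := toLog F ⋙ LogSch.forget k

end Stack

/-- The morphism of stacks `X → F` that corresponds to `s ∈ F(X)`. The stack of the scheme
underlying `X` is presented as the category of log schemes with a strict morphism to `X`: a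
morphism of schemes `g : T → X` corresponds to the log scheme `(T, g^* M_X)` over `X`. -/
def toFan (X : LogSch k) (F : (LogSch k)ᵒᵖ ⥤ Type (u + 1)) (s : F.obj (op X)) :
    Over X ⥤ Stack F where
  obj T := ⟨T.left, F.map T.hom.op s⟩
  map {T T'} f := ⟨f.left, by
    rw [← Over.w f, op_comp, F.map_comp]; rfl⟩

end ArtinFan

/-! ### Fibre powers, twisted diagonals and fixed loci -/

universe v₁ v₂ v₃ u₁ u₂ u₃ w

section Power

variable {𝒳 : Type u₁} [Category.{v₁} 𝒳] {𝒜 : Type u₂} [Category.{v₂} 𝒜]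

/-- The 2-fibre product over `𝒜` of copies of `f : 𝒳 → 𝒜` indexed by `I`. -/
structure Power (f : 𝒳 ⥤ 𝒜) (I : Type w) where
  pt : 𝒜
  comp : I → 𝒳
  iso : ∀ i, f.obj (comp i) ≅ pt

namespace Power

variable {f : 𝒳 ⥤ 𝒜} {I J : Type w}

/-- Morphisms are families of morphisms compatible with the given isomorphisms. -/
@[ext]
structure Hom (x y : Power f I) where
  pt : x.pt ⟶ y.pt
  comp : ∀ i, x.comp i ⟶ y.comp i
  w : ∀ i, f.map (comp i) ≫ (y.iso i).hom = (x.iso i).hom ≫ pt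

instance : Category (Power f I) where
  Hom := Hom
  id x := ⟨𝟙 _, fun _ => 𝟙 _, by simp⟩
  comp a b := ⟨a.pt ≫ b.pt, fun i => a.comp i ≫ b.comp i, fun i => by
    rw [f.map_comp, Category.assoc, b.w, ← Category.assoc, a.w, Category.assoc]⟩
  id_comp a := Hom.ext (Category.id_comp _) (funext fun _ => Category.id_comp _)
  comp_id a := Hom.ext (Category.comp_id _) (funext fun _ => Category.comp_id _)
  assoc a b c := Hom.ext (Category.assoc _ _ _) (funext fun _ => Category.assoc _ _ _)

variable (f I) in
/-- The structure morphism to `𝒜`. -/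
def proj : Power f I ⥤ 𝒜 where
  obj x := x.pt
  map a := a.pt

variable (f) in
/-- Pulling back families along a map of index sets. -/
def reindex (g : I → J) : Power f J ⥤ Power f I where
  obj x := ⟨x.pt, fun i => x.comp (g i), fun i => x.iso (g i)⟩
  map a := ⟨a.pt, fun i => a.comp (g i), fun i => a.w (g i)⟩

variable (f) in
/-- The action of a permutation: `(σ x)_i = x_{σ⁻¹ i}`. -/
def perm (σ : Equiv.Perm I) : Power f I ⥤ Power f I := reindex f fun i => σ⁻¹ i

variable (f) in
/-- The structure morphism to `𝒜` is invariant under permutations. -/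
def permProj (σ : Equiv.Perm I) : perm f σ ⋙ proj f I ≅ proj f I := Iso.refl _

end Power

end Power

section FixedLocus

open scoped CategoricalPullback

variable {𝒴 : Type u₁} [Category.{v₁} 𝒴] {ℬ : Type u₂} [Category.{v₂} ℬ]
  {𝒞 : Type u₃} [Category.{v₃} 𝒞]

/-- The diagonal `i : 𝒴 → 𝒴 ×_ℬ 𝒴`. -/
def diagonal (π : 𝒴 ⥤ ℬ) : 𝒴 ⥤ π ⊡ π where
  obj y := ⟨y, y, Iso.refl _⟩
  map a := ⟨a, a, by simp⟩

/-- The twisted diagonal `i_g : 𝒴 → 𝒴 ×_ℬ 𝒴`, `y ↦ (y, g y)`, of an automorphism `g` over `ℬ`. -/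
def twistedDiagonal (π : 𝒴 ⥤ ℬ) (g : 𝒴 ⥤ 𝒴) (e : g ⋙ π ≅ π) : 𝒴 ⥤ π ⊡ π where
  obj y := ⟨y, g.obj y, (e.app y).symm⟩
  map a := ⟨a, g.map a, e.inv.naturality a⟩

/-- The fixed locus of `g` over `ℬ`: the intersection (2-fibre product) of `i` and `i_g`. -/
abbrev FixedLocus (π : 𝒴 ⥤ ℬ) (g : 𝒴 ⥤ 𝒴) (e : g ⋙ π ≅ π) :=
  (diagonal π) ⊡ (twistedDiagonal π g e)

/-- The natural morphism between fixed loci over `ℬ` and over `𝒞`, for `q : ℬ → 𝒞`. -/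
def FixedLocus.changeBase (π : 𝒴 ⥤ ℬ) (g : 𝒴 ⥤ 𝒴) (e : g ⋙ π ≅ π) (q : ℬ ⥤ 𝒞) :
    FixedLocus π g e ⥤ FixedLocus (π ⋙ q) g (Functor.isoWhiskerRight e q) where
  obj z := ⟨z.fst, z.snd, CategoricalPullback.mkIso
    ((CategoricalPullback.π₁ π π).mapIso z.iso) ((CategoricalPullback.π₂ π π).mapIso z.iso) (by
      have h : π.map z.iso.hom.fst ≫ e.inv.app z.snd = π.map z.iso.hom.snd :=
        z.iso.hom.w.trans (Category.id_comp _)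
      refine Eq.trans ?_ (Category.id_comp _).symm
      exact (q.map_comp _ _).symm.trans (congrArg q.map h))⟩
  map a := ⟨a.fst, a.snd, by
    have h := a.w
    apply CategoricalPullback.hom_ext
    · exact congrArg (fun t => t.fst) h
    · exact congrArg (fun t => t.snd) h⟩

end FixedLocus

section Symmetric

variable {k : Type u} [Field k]
  (X : LogSch k) (F : (LogSch k)ᵒᵖ ⥤ Type (u + 1)) (s : F.obj (op X))

/-- The `I`-th power of `X` over its Artin fan; `I = Fin n` gives the `n`-th power. -/
abbrev HatPower (I : Type) := Power (toFan X F s) I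

/-- The log fixed locus of a permutation: the intersection of the diagonal and the twisted
diagonal in the square of the power over the Artin fan. -/
abbrev LogFixedLocus {n : ℕ} (σ : Equiv.Perm (Fin n)) :=
  FixedLocus (Power.proj (toFan X F s) (Fin n)) (Power.perm _ σ) (Power.permProj _ σ)

/-- The ordinary fixed locus of a permutation: the intersection of the diagonal and the twisted
diagonal in the square of the power over `Spec k`. -/
abbrev OrdinaryFixedLocus {n : ℕ} (σ : Equiv.Perm (Fin n)) :=
  FixedLocus (Power.proj (toFan X F s) (Fin n) ⋙ Stack.toBase F) (Power.perm _ σ)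
    (Functor.isoWhiskerRight (Power.permProj _ σ) (Stack.toBase F))

/-- The natural morphism from the log fixed locus to the ordinary one. -/
def logFixedToOrdinary {n : ℕ} (σ : Equiv.Perm (Fin n)) :
    LogFixedLocus X F s σ ⥤ OrdinaryFixedLocus X F s σ :=
  FixedLocus.changeBase _ _ _ _

/-- The first projection of the log fixed locus, to the power of `X` over its Artin fan. -/
def logFixedProj {n : ℕ} (σ : Equiv.Perm (Fin n)) :
    LogFixedLocus X F s σ ⥤ HatPower X F s (Fin n) :=
  CategoricalPullback.π₁ _ _

end Symmetric

/-- The set `O(σ)` of orbits of a permutation `σ` of `{1, …, n}`. -/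
abbrev Orbits {n : ℕ} (σ : Equiv.Perm (Fin n)) : Type :=
  MulAction.orbitRel.Quotient (Subgroup.zpowers σ) (Fin n)

/-- The orbit of an element. -/
def orbitOf {n : ℕ} (σ : Equiv.Perm (Fin n)) (i : Fin n) : Orbits σ := Quotient.mk'' i

end

end LogGeom

/-!
Objects of the fibre power `Power f I` are families in `𝒳` with isomorphisms of their images to one
common object of the base.

*Equivalence with the power indexed by the orbits.* The functor `toFan` is faithful, so a morphism
of a power over the fan is determined by its image in the fan (`Power.hom_ext_of_pt`). A point of
the log fixed locus consists of two isomorphisms, one onto a family and one onto its permutation,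
and both have the same image in the fan (`FixedLocus.pt_eq`). Dividing one by the other yields, for
every `i`, an isomorphism between the components at `i` and at `σ⁻¹ i` that is compatible with the
structural isomorphisms; so up to isomorphism the family is repeated along the orbits of `σ`. This
makes `Power.toFixedLocus` an equivalence (`exists_equivalence_logFixedLocus`).

*The ordinary fixed locus is larger.* A point of the ordinary fixed locus carries two isomorphisms
that have the same image only over `k`; those in the image of the log fixed locus have the same
image in the fan (`pt_eq_of_iso_logFixedToOrdinary`). It is therefore enough to find a log scheme
`T` over `X` with an involution `q ≠ 1` over the identity of the underlying scheme that fixes the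
section of `F` induced by `T → X` (`not_isEquivalence_of_involution`).

Such a `T` is constructed in `exists_rotate_fixing`. For a monoid `S` in which only `1` is
invertible, every scheme carries the constant log structure `constLog`, whose nontrivial
characteristic elements map to `0`, and a homomorphism `χ : S → ℤ` together with an invertible
function `u` defines its automorphism `rotate`, which multiplies `s` by `u ^ χ(s)`. If the log
structure of `X` is not trivial, there are an algebraically closed field `κ`, a nontrivial sharp fs
monoid `S` and a strict morphism to `X` from the constant log scheme `Spec κ` with monoid `S`
(`exists_chartPoint`, `ChartPoint.pointVal_isStrict`); moreover `S` has a homomorphism `χ` to `ℤ`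
with an odd value (`IsFsMonoid.exists_odd`). Pull the section of `F` back to the constant log scheme
on the punctured line over `κ`, with coordinate `t`. Sections of a sheaf that is étale over `Log`
agree near every geometric point at which they agree (`exists_nbhd_of_eq`): étale locally they are
induced by morphisms to an atlas that is étale over the base, and morphisms of log schemes lift
along strict étale morphisms as morphisms of schemes do (`LogHom.etaleLift`, `LogHom.ext_of_etale`).
Rotation by `t` is trivial at `t = 1` and rotation by `-t` is trivial at `t = -1`, so each fixes the
section on a nonempty étale scheme over the line. The line is irreducible, so both fix it on a
common nonempty étale scheme `E`. There rotation by `-1` fixes the section too. It is an involution,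
and it is not the identity because `χ` has an odd value and `-1 ≠ 1` in characteristic `0`.
-/

namespace LogGeom

/-! ### Log fixed loci of permutations -/

section PowerFixed

open scoped CategoricalPullback

universe v₁ v₂ u₁ u₂ w

variable {𝒳 : Type u₁} [Category.{v₁} 𝒳] {𝒜 : Type u₂} [Category.{v₂} 𝒜]
  {f : 𝒳 ⥤ 𝒜} {I J : Type w}

namespace Power

/-- For a faithful `f : 𝒳 ⥤ 𝒜`, a morphism of a fibre power over `𝒜` is determined by its image
in `𝒜`: each component is recovered from it through the structural isomorphisms. -/
lemma hom_ext_of_pt [f.Faithful] {x y : Power f I} {a b : x ⟶ y}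
    (h : Hom.pt a = Hom.pt b) : a = b := by
  refine Hom.ext h (funext fun i => f.map_injective ?_)
  rw [← cancel_mono (y.iso i).hom, Hom.w a i, Hom.w b i, h]

/-- An isomorphism of objects of a fibre power, from an isomorphism of the images in the base and
componentwise isomorphisms. -/
def isoMk {x y : Power f I} (p : x.pt ≅ y.pt) (c : ∀ i, x.comp i ≅ y.comp i)
    (w : ∀ i, f.map (c i).hom ≫ (y.iso i).hom = (x.iso i).hom ≫ p.hom) : x ≅ y where
  hom := ⟨p.hom, fun i => (c i).hom, w⟩
  inv := ⟨p.inv, fun i => (c i).inv, fun i => by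
    rw [← cancel_mono p.hom, Category.assoc, ← w i, ← f.mapIso_hom, ← f.mapIso_inv,
      Iso.inv_hom_id_assoc, Category.assoc, Iso.inv_hom_id, Category.comp_id]⟩
  hom_inv_id := Hom.ext p.hom_inv_id (funext fun i => (c i).hom_inv_id)
  inv_hom_id := Hom.ext p.inv_hom_id (funext fun i => (c i).inv_hom_id)

lemma map_eqToHom_iso (y : Power f J) {j j' : J} (e : j = j') :
    f.map (eqToHom (congrArg y.comp e)) ≫ (y.iso j').hom = (y.iso j).hom := by
  subst e; simp

/-- A family indexed by the orbits of `σ`, repeated along the orbits, is invariant under `σ`. -/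
def permReindexIso (σ : Equiv.Perm I) (q : I → J) (h : ∀ i, q (σ⁻¹ i) = q i) (y : Power f J) :
    (reindex f q).obj y ≅ (perm f σ).obj ((reindex f q).obj y) :=
  isoMk (Iso.refl _) (fun i => eqToIso (congrArg y.comp (h i).symm)) fun i =>
    (map_eqToHom_iso y (h i).symm).trans (Category.comp_id _).symm

variable (f) in
/-- The morphism from the power indexed by `J` to the fixed locus of `σ` on the power indexed
by `I`, given by the diagonal morphism along a `σ`-invariant map `q : I → J`. -/
def toFixedLocus (σ : Equiv.Perm I) (q : I → J) (h : ∀ i, q (σ⁻¹ i) = q i) [f.Faithful] :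
    Power f J ⥤ FixedLocus (proj f I) (perm f σ) (permProj f σ) where
  obj y := ⟨(reindex f q).obj y, (reindex f q).obj y,
    CategoricalPullback.mkIso (Iso.refl _) (permReindexIso σ q h y) rfl⟩
  map a := ⟨(reindex f q).map a, (reindex f q).map a, CategoricalPullback.hom_ext
    (hom_ext_of_pt ((Category.comp_id _).trans (Category.id_comp _).symm))
    (hom_ext_of_pt ((Category.comp_id _).trans (Category.id_comp _).symm))⟩

end Power

/-- A point of the fixed locus carries two isomorphisms between its projections; both lie over the
same isomorphism of the base. -/
lemma FixedLocus.pt_eq {σ : Equiv.Perm I}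
    (z : FixedLocus (Power.proj f I) (Power.perm f σ) (Power.permProj f σ)) :
    Power.Hom.pt z.iso.hom.fst = Power.Hom.pt z.iso.hom.snd :=
  (Category.comp_id _).symm.trans (z.iso.hom.w.trans (Category.id_comp _))

namespace Power

variable (σ : Equiv.Perm I) (q : I → J) (h : ∀ i, q (σ⁻¹ i) = q i) [f.Faithful]

lemma toFixedLocus_faithful : (toFixedLocus f σ q h).Faithful where
  map_injective e := hom_ext_of_pt
    (congrArg (fun t => Hom.pt (CategoricalPullback.Hom.fst t)) e)

/-- A preimage of a morphism is read off at a choice `r` of representatives of the orbits; that it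
has the given components at the other indices is forced by faithfulness of `f`. -/
lemma toFixedLocus_full (hq : Function.Surjective q) : (toFixedLocus f σ q h).Full where
  map_surjective {y y'} c := by
    have hc : Hom.pt c.fst = Hom.pt c.snd := by
      have := congrArg (fun t => Hom.pt (CategoricalPullback.Hom.fst t)) c.w
      exact (Category.comp_id _).symm.trans (this.trans (Category.id_comp _))
    choose r hr using hq
    let a : (reindex f q).obj y ⟶ (reindex f q).obj y' := c.fst
    let p : y.pt ⟶ y'.pt := (proj f I).map a
    let g (i : I) : y.comp (q i) ⟶ y'.comp (q i) := Hom.comp a i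
    have hg (i : I) : f.map (g i) ≫ (y'.iso (q i)).hom = (y.iso (q i)).hom ≫ p := Hom.w a i
    refine ⟨⟨p, fun j => eqToHom (congrArg y.comp (hr j).symm) ≫ g (r j) ≫
      eqToHom (congrArg y'.comp (hr j)), fun j => ?_⟩, CategoricalPullback.hom_ext
      (hom_ext_of_pt rfl) (hom_ext_of_pt hc)⟩
    rw [f.map_comp, f.map_comp, Category.assoc, Category.assoc, map_eqToHom_iso y' (hr j),
      ← map_eqToHom_iso y (hr j).symm, Category.assoc, hg]

/-- The components of a point of the fixed locus are isomorphic along the orbits of `σ`. -/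
lemma toFixedLocus_essSurj (hq : Function.Surjective q)
    (hσ : ∀ i i', q i = q i' → ∃ n : ℤ, (σ ^ n) i = i') : (toFixedLocus f σ q h).EssSurj where
  mem_essImage z := by
    -- `R i i'`: the components at `i` and `i'` are isomorphic over the fixed point in the base
    let R (i i' : I) : Prop := ∃ c : z.fst.comp i ≅ z.fst.comp i',
      f.map c.hom ≫ (z.fst.iso i').hom = (z.fst.iso i).hom
    have hsymm {i i' : I} : R i i' → R i' i := fun ⟨c, hc⟩ => ⟨c.symm, by
      rw [← hc, ← Category.assoc, ← f.map_comp, Iso.symm_hom, Iso.inv_hom_id, f.map_id,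
        Category.id_comp]⟩
    have htrans {i i' i'' : I} : R i i' → R i' i'' → R i i'' := fun ⟨c, hc⟩ ⟨d, hd⟩ =>
      ⟨c ≪≫ d, by rw [Iso.trans_hom, f.map_comp, Category.assoc, hd, hc]⟩
    let a : z.fst ≅ z.snd := (CategoricalPullback.π₁ _ _).mapIso z.iso
    let b : z.fst ≅ (perm f σ).obj z.snd := (CategoricalPullback.π₂ _ _).mapIso z.iso
    have ab : Hom.pt a.hom = Hom.pt b.hom := FixedLocus.pt_eq z
    let compIso {x y : Power f I} (e : x ≅ y) (i : I) : x.comp i ≅ y.comp i :=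
      ⟨Hom.comp e.hom i, Hom.comp e.inv i, congrFun (congrArg Hom.comp e.hom_inv_id) i,
        congrFun (congrArg Hom.comp e.inv_hom_id) i⟩
    have hstep (i : I) : R i (σ⁻¹ i) := by
      let bi : z.fst.comp i ≅ z.snd.comp (σ⁻¹ i) := compIso b i
      let p : z.fst.pt ⟶ z.snd.pt := Hom.pt a.hom
      have e1 : f.map bi.hom ≫ (z.snd.iso (σ⁻¹ i)).hom = (z.fst.iso i).hom ≫ p :=
        (Hom.w b.hom i).trans (congrArg _ ab.symm)
      have e2 : f.map (Hom.comp a.inv (σ⁻¹ i)) ≫ (z.fst.iso (σ⁻¹ i)).hom =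
        (z.snd.iso (σ⁻¹ i)).hom ≫ Hom.pt a.inv := Hom.w a.inv (σ⁻¹ i)
      have e3 : p ≫ Hom.pt a.inv = 𝟙 _ := congrArg Hom.pt a.hom_inv_id
      refine ⟨bi ≪≫ (compIso a (σ⁻¹ i)).symm, ?_⟩
      rw [Iso.trans_hom, f.map_comp, Category.assoc]
      refine (congrArg _ e2).trans ?_
      rw [← Category.assoc, e1, Category.assoc, e3, Category.comp_id]
    have hrefl (i : I) : R i i := ⟨Iso.refl _, by simp⟩
    have hpow (n : ℤ) (i : I) : R i ((σ ^ n) i) := by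
      induction n with
      | zero => exact hrefl i
      | succ n ih =>
        have := hstep ((σ ^ ((n : ℤ) + 1)) i)
        rw [← Equiv.Perm.mul_apply, ← zpow_neg_one, ← zpow_add] at this
        exact htrans ih (hsymm (by simpa using this))
      | pred n ih =>
        have := hstep ((σ ^ (-(n : ℤ))) i)
        rw [← Equiv.Perm.mul_apply, ← zpow_neg_one, ← zpow_add] at this
        have e : (-1 : ℤ) + -(n : ℤ) = -n - 1 := by ring
        exact htrans ih (by rwa [e] at this)
    choose r hr using hq
    have hR (i : I) : R (r (q i)) i := by
      obtain ⟨n, hn⟩ := hσ _ _ (hr (q i))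
      have := hpow n (r (q i))
      rwa [hn] at this
    choose c hc using hR
    let y : Power f J := ⟨z.fst.pt, fun j => z.fst.comp (r j), fun j => z.fst.iso (r j)⟩
    let e : (reindex f q).obj y ≅ z.fst := isoMk (Iso.refl _) c fun i =>
      (hc i).trans (Category.comp_id _).symm
    refine ⟨y, ⟨CategoricalPullback.mkIso e (e ≪≫ a) (CategoricalPullback.hom_ext ?_ ?_)⟩⟩
    · exact (Category.id_comp _).symm
    · refine hom_ext_of_pt ?_
      exact (congrArg (fun t => 𝟙 _ ≫ t) ab.symm).trans (Category.id_comp _).symm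

end Power

end PowerFixed

section ToFan

variable {k : Type u} [Field k] {X : LogSch k} {F : (LogSch k)ᵒᵖ ⥤ Type (u + 1)} {s : F.obj (op X)}

/-- Morphisms over `X` are determined by their underlying morphisms of log schemes: the morphism
from `X` to its Artin fan is representable. -/
instance toFan_faithful : (toFan X F s).Faithful where
  map_injective e := Over.OverMorphism.ext (congrArg Subtype.val e)

end ToFan

lemma orbitOf_surjective {n : ℕ} (σ : Equiv.Perm (Fin n)) : Function.Surjective (orbitOf σ) :=
  Quotient.mk''_surjective

lemma orbitOf_eq_iff {n : ℕ} (σ : Equiv.Perm (Fin n)) (i j : Fin n) :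
    orbitOf σ i = orbitOf σ j ↔ ∃ m : ℤ, (σ ^ m) j = i := by
  refine Quotient.eq''.trans ?_
  rw [MulAction.orbitRel_apply, MulAction.mem_orbit_iff]
  constructor
  · rintro ⟨⟨_, m, rfl⟩, h⟩
    exact ⟨m, h⟩
  · rintro ⟨m, h⟩
    exact ⟨⟨σ ^ m, m, rfl⟩, h⟩

lemma orbitOf_inv_apply {n : ℕ} (σ : Equiv.Perm (Fin n)) (i : Fin n) :
    orbitOf σ (σ⁻¹ i) = orbitOf σ i :=
  (orbitOf_eq_iff σ _ _).2 ⟨-1, by rw [zpow_neg_one]⟩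

/-- The log fixed locus of `σ` is the power indexed by the orbits of `σ`, embedded by the diagonal
along the map from indices to orbits. -/
theorem exists_equivalence_logFixedLocus {k : Type u} [Field k] (X : LogSch k)
    (F : (LogSch k)ᵒᵖ ⥤ Type (u + 1)) (s : F.obj (op X)) {n : ℕ} (σ : Equiv.Perm (Fin n))
    {J : Type} (e : Orbits σ ≃ J) :
    ∃ E : HatPower X F s J ≌ LogFixedLocus X F s σ,
      Nonempty (E.functor ⋙ logFixedProj X F s σ ≅
        Power.reindex (toFan X F s) fun i => e (orbitOf σ i)) := by
  have h (i : Fin n) : e (orbitOf σ (σ⁻¹ i)) = e (orbitOf σ i) := by rw [orbitOf_inv_apply]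
  have hq : Function.Surjective fun i => e (orbitOf σ i) :=
    e.surjective.comp (orbitOf_surjective σ)
  have hσ (i i' : Fin n) (h : e (orbitOf σ i) = e (orbitOf σ i')) : ∃ m : ℤ, (σ ^ m) i = i' :=
    (orbitOf_eq_iff σ i' i).1 (e.injective h).symm
  let G := Power.toFixedLocus (toFan X F s) σ (fun i => e (orbitOf σ i)) h
  have : G.IsEquivalence :=
    { faithful := Power.toFixedLocus_faithful σ _ h
      full := Power.toFixedLocus_full σ _ h hq
      essSurj := Power.toFixedLocus_essSurj σ _ h hq hσ }
  exact ⟨G.asEquivalence, ⟨Iso.refl _⟩⟩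

/-! ### Sheaves on the small étale site -/

/-- The underlying scheme of an étale `X`-scheme. -/
abbrev etBase (X : Scheme.{u}) : X.Etale ⥤ Scheme.{u} := Scheme.Etale.forget X ⋙ Over.forget X

/-- Passing to a general `P` lets instances on the category of `P`-schemes be found, which fails
for the unfolded definition of the étale site. -/
lemma coverPreserving_overForget (P : MorphismProperty Scheme.{u}) [P.IsMultiplicative]
    [P.IsStableUnderBaseChange] (X : Scheme.{u}) :
    CoverPreserving (X.smallGrothendieckTopology P (Q := P)) (X.overGrothendieckTopology P)
      (MorphismProperty.Over.forget P ⊤ X) :=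
  Functor.coverPreserving_restrictedTopology _ _

instance (X : Scheme.{u}) :
    (Scheme.Etale.forget X).IsContinuous X.smallEtaleTopology (Scheme.etaleTopology.over X) := by
  have : RepresentablyFlat (Scheme.Etale.forget X) := flat_of_preservesFiniteLimits _
  exact Functor.isContinuous_iff_coverPreserving.2 (coverPreserving_overForget @Etale X)

instance (X : Scheme.{u}) :
    (etBase X).IsContinuous X.smallEtaleTopology Scheme.etaleTopology :=
  Functor.isContinuous_comp _ _ _ (Scheme.etaleTopology.over X) _

lemma etaleTopology_le_fpqcTopology :
    Scheme.etaleTopology.{u} ≤ Scheme.fpqcTopology :=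
  Scheme.etaleTopology_le_proetaleTopology.trans Scheme.proetaleTopology_le_fpqcTopology

instance : Scheme.etaleTopology.{u}.Subcanonical := .of_le etaleTopology_le_fpqcTopology

lemma isSheaf_etBase_hom (X Z : Scheme.{u}) :
    Presieve.IsSheaf X.smallEtaleTopology ((etBase X).op ⋙ yoneda.obj Z) :=
  (etBase X).op_comp_isSheaf_of_isSheaf_type _
    (GrothendieckTopology.Subcanonical.isSheaf_of_isRepresentable (J := Scheme.etaleTopology) _)

lemma isSheaf_etBase_continuousMap (X : Scheme.{u}) (T : Type u) [TopologicalSpace T] :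
    Presieve.IsSheaf X.smallEtaleTopology ((etBase X).op ⋙ continuousMapPresheaf T) :=
  (etBase X).op_comp_isSheaf_of_isSheaf_type _
    (Presieve.isSheaf_of_le _ etaleTopology_le_fpqcTopology
      ((isSheaf_iff_isSheaf_of_type _ _).1 (isSheaf_fpqcTopology_continuousMapPresheaf T)))

/-- The structure sheaf of the small étale site, as a presheaf of sets. -/
abbrev etSections (X : Scheme.{u}) : X.Etaleᵒᵖ ⥤ Type u :=
  (etBase X).op ⋙ Scheme.Γ ⋙ forget CommRingCat

/-- Functions are morphisms to the affine line. -/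
lemma isSheaf_etSections (X : Scheme.{u}) :
    Presieve.IsSheaf X.smallEtaleTopology (etSections X) := by
  refine Presieve.isSheaf_iso _
    (P := (etBase X).op ⋙ yoneda.obj 𝔸(PUnit.{u + 1}; ⊤_ Scheme.{u})) ?_ (isSheaf_etBase_hom X _)
  refine Functor.isoWhiskerLeft _ (NatIso.ofComponents (fun V => Equiv.toIso
    { toFun := fun h => h.appTop.hom (AffineSpace.coord _ PUnit.unit)
      invFun := fun f => AffineSpace.homOfVector (terminal.from _) fun _ => f
      left_inv := fun h => AffineSpace.hom_ext (Subsingleton.elim _ _) fun i => by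
        rw [AffineSpace.homOfVector_appTop_coord]
      right_inv := fun f => AffineSpace.homOfVector_appTop_coord (terminal.from _) _ _ }) ?_)
  intro V W r
  ext h
  rfl

/-- The presheaf of monoids `M` is a sheaf if the underlying presheaf of sets is. -/
lemma isSheaf_commMonCat {C : Type*} [Category* C] (J : GrothendieckTopology C)
    (M : Cᵒᵖ ⥤ CommMonCat.{u}) (h : Presieve.IsSheaf J (M ⋙ forget CommMonCat)) :
    Presheaf.IsSheaf J M := by
  intro E U S hS x hx
  have hc (e : E) : Presieve.FamilyOfElements.Compatible (P := M ⋙ forget CommMonCat)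
      (fun V f hf => (x f hf).hom e) := fun V₁ V₂ W g₁ g₂ f₁ f₂ h₁ h₂ w =>
    congrArg (fun t : E ⟶ M.obj (op W) => t.hom e) (hx g₁ g₂ h₁ h₂ w)
  choose t ht htu using fun e => h S hS _ (hc e)
  let φ : E →* M.obj (op U) :=
    { toFun := t
      map_one' := (htu 1 1 fun V f hf =>
        ((M.map f.op).hom.map_one).trans ((x f hf).hom.map_one).symm).symm
      map_mul' := fun a b => (htu (a * b) (t a * t b : M.obj (op U)) fun V f hf =>
        ((M.map f.op).hom.map_mul _ _).trans ((congrArg₂ _ (ht a f hf) (ht b f hf)).trans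
          ((x f hf).hom.map_mul a b).symm)).symm }
  refine ⟨CommMonCat.ofHom φ, fun V f hf => ?_, fun ψ hψ => ?_⟩
  · exact CommMonCat.hom_ext (MonoidHom.ext fun e => ht e f hf)
  · refine CommMonCat.hom_ext (MonoidHom.ext fun e => ?_)
    exact htu e _ fun V f hf => congrArg (fun t : E ⟶ M.obj (op V) => t.hom e) (hψ f hf)

namespace LogStructure

variable {X : Scheme.{u}} (L : LogStructure X)

lemma isSheaf_forget :
    Presieve.IsSheaf X.smallEtaleTopology (L.M ⋙ forget CommMonCat) := by
  -- a section is a homomorphism from the free monoid on one generator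
  let E : CommMonCat.{u} := CommMonCat.of (ULift.{u} (Multiplicative ℕ))
  refine Presieve.isSheaf_iso _ (P := L.M ⋙ coyoneda.obj (op E)) ?_ (L.isSheaf E)
  refine NatIso.ofComponents (fun U => Equiv.toIso
    { toFun := fun φ => φ.hom (ULift.up (Multiplicative.ofAdd 1))
      invFun := fun m => CommMonCat.ofHom
        ((powersHom (L.M.obj U) m).comp MulEquiv.ulift.toMonoidHom)
      left_inv := fun φ => by
        refine CommMonCat.hom_ext (MonoidHom.ext fun e => ?_)
        obtain ⟨e⟩ := e
        change φ.hom _ ^ Multiplicative.toAdd e = φ.hom _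
        rw [← map_pow]
        refine congrArg _ (ULift.ext _ _ ?_)
        change Multiplicative.ofAdd 1 ^ Multiplicative.toAdd e = e
        rw [← ofAdd_nsmul]
        simp
      right_inv := fun m => pow_one _ }) fun r => rfl

variable {L}

lemma isSheafFor_of_jointlySurjective {U : X.Etale} {ι : Type*} {V : ι → X.Etale}
    (r : ∀ i, V i ⟶ U) (hr : ∀ x : U.left, ∃ i, ∃ v : (V i).left, (r i).left v = x) :
    Presieve.IsSheafFor (L.M ⋙ forget CommMonCat) (Presieve.ofArrows V r) := by
  rw [Presieve.isSheafFor_iff_generate]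
  refine L.isSheaf_forget _ ((Scheme.ofArrows_mem_smallEtaleTopology_iff r).2 ?_)
  refine Set.eq_univ_of_forall fun x => Set.mem_iUnion.2 ?_
  obtain ⟨i, v, hv⟩ := hr x
  exact ⟨i, v, hv⟩

/-- Sections of a log structure that agree étale locally are equal. -/
lemma sec_ext {U : X.Etale} {m m' : L.Sec U}
    (h : ∀ x : U.left, ∃ (W : X.Etale) (s : W ⟶ U) (w : W.left),
      s.left w = x ∧ L.res s m = L.res s m') : m = m' := by
  choose W s w hw e using h
  have hs := isSheafFor_of_jointlySurjective (L := L) s fun x => ⟨x, w x, hw x⟩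
  refine hs.isSeparatedFor.ext ?_
  rintro _ _ ⟨i⟩
  exact e i

/-- Compatible sections of a log structure on an étale covering glue. -/
lemma exists_glue {U : X.Etale} {ι : Type*} {V : ι → X.Etale} (r : ∀ i, V i ⟶ U)
    (hr : ∀ x : U.left, ∃ i, ∃ v : (V i).left, (r i).left v = x) (m : ∀ i, L.Sec (V i))
    (hm : ∀ i j (Z : X.Etale) (a : Z ⟶ V i) (b : Z ⟶ V j), a ≫ r i = b ≫ r j →
      L.res a (m i) = L.res b (m j)) : ∃ t : L.Sec U, ∀ i, L.res (r i) t = m i :=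
  ((Presieve.isSheafFor_arrows_iff _ _).1 (isSheafFor_of_jointlySurjective (L := L) r hr) m
    fun i j Z a b => hm i j Z a b).exists

end LogStructure

/-! ### Functions that are given by a locally constant choice of sections -/

section Glue

variable {V W : Scheme.{u}}

lemma germ_ext {f g : Γ(V, ⊤)}
    (h : ∀ x : V, V.presheaf.germ ⊤ x trivial f = V.presheaf.germ ⊤ x trivial g) : f = g :=
  TopCat.Presheaf.section_ext V.sheaf ⊤ f g fun x _ => h x

variable {S : Type u} [TopologicalSpace S] [DiscreteTopology S]

/-- The restrictions of the sections `a s` to the disjoint open sets where `g = s` glue. -/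
lemma exists_glueFn (g : C(V, S)) (a : S → Γ(V, ⊤)) : ∃ f : Γ(V, ⊤), ∀ x,
    V.presheaf.germ ⊤ x trivial f = V.presheaf.germ ⊤ x trivial (a (g x)) := by
  let U (s : S) : V.Opens := ⟨g ⁻¹' {s}, (isOpen_discrete _).preimage g.continuous⟩
  obtain ⟨f, hf, -⟩ := TopCat.Sheaf.existsUnique_gluing' V.sheaf U ⊤ (fun _ => homOfLE le_top)
    (fun x _ => TopologicalSpace.Opens.mem_iSup.2 ⟨g x, rfl⟩)
    (fun s => V.presheaf.map (homOfLE le_top).op (a s)) (by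
      intro s s'
      by_cases h : s = s'
      · subst h; rfl
      · have h0 : U s ⊓ U s' = ⊥ := by
          ext x
          simp only [TopologicalSpace.Opens.coe_inf, Set.mem_inter_iff,
            TopologicalSpace.Opens.coe_bot, Set.mem_empty_iff_false, iff_false]
          rintro ⟨h1, h2⟩
          exact h (h1.symm.trans h2)
        have : Subsingleton Γ(V, U s ⊓ U s') := by rw [h0]; infer_instance
        exact this.elim _ _)
  refine ⟨f, fun x => ?_⟩
  have h1 := congrArg (V.presheaf.germ (U (g x)) x rfl) (hf (g x))
  exact (TopCat.Presheaf.germ_res_apply _ _ _ _ _).symm.trans (h1.trans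
    (TopCat.Presheaf.germ_res_apply _ _ _ _ _))

/-- The section equal to `a s` on the locus where the locally constant function `g` equals `s`. -/
noncomputable def glueFn (g : C(V, S)) (a : S → Γ(V, ⊤)) : Γ(V, ⊤) := (exists_glueFn g a).choose

lemma germ_glueFn (g : C(V, S)) (a : S → Γ(V, ⊤)) (x : V) :
    V.presheaf.germ ⊤ x trivial (glueFn g a) = V.presheaf.germ ⊤ x trivial (a (g x)) :=
  (exists_glueFn g a).choose_spec x

lemma eq_glueFn {g : C(V, S)} {a : S → Γ(V, ⊤)} {f : Γ(V, ⊤)} (h : ∀ x,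
    V.presheaf.germ ⊤ x trivial f = V.presheaf.germ ⊤ x trivial (a (g x))) : f = glueFn g a :=
  germ_ext fun x => (h x).trans (germ_glueFn g a x).symm

lemma glueFn_mul (g : C(V, S)) (a b : S → Γ(V, ⊤)) :
    glueFn g a * glueFn g b = glueFn g fun s => a s * b s :=
  eq_glueFn fun x => by rw [map_mul, germ_glueFn, germ_glueFn, map_mul]

lemma glueFn_one (g : C(V, S)) : glueFn g (fun _ => 1) = 1 :=
  (eq_glueFn fun _ => rfl).symm

lemma germ_appTop (h : W ⟶ V) (f : Γ(V, ⊤)) (x : W) :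
    W.presheaf.germ ⊤ x trivial (h.appTop f) =
      h.stalkMap x (V.presheaf.germ ⊤ (h x) trivial f) :=
  (Scheme.Hom.germ_stalkMap_apply h ⊤ x trivial f).symm

lemma appTop_glueFn (h : W ⟶ V) (g : C(V, S)) (a : S → Γ(V, ⊤)) :
    h.appTop (glueFn g a) = glueFn (g.comp ⟨h, h.continuous⟩) fun s => h.appTop (a s) :=
  eq_glueFn fun x => by
    rw [germ_appTop, germ_glueFn, germ_appTop]; rfl

lemma glueFn_const (s : S) (a : S → Γ(V, ⊤)) : glueFn (ContinuousMap.const V s) a = a s :=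
  (eq_glueFn fun _ => rfl).symm

end Glue

/-! ### Constant log structures -/

section ConstLog

variable {S : Type u} [CommMonoid S]

namespace ConstSec

variable {V W : Scheme.{u}}

open Classical in
/-- The values of the structure map of a constant log structure: a section of `S` that is not
trivial maps to `0`. -/
noncomputable def ind (V : Scheme.{u}) (s : S) : Γ(V, ⊤) := if s = 1 then 1 else 0

lemma appTop_ind (h : W ⟶ V) (s : S) : h.appTop (ind V s) = ind W s := by
  unfold ind
  split_ifs
  · exact map_one _
  · exact map_zero _

lemma ind_one : ind V (1 : S) = 1 := if_pos rfl

lemma ind_of_ne {s : S} (h : s ≠ 1) : ind V s = 0 := if_neg h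

lemma ind_mul (hS : ∀ a b : S, a * b = 1 → a = 1) (s t : S) :
    ind V s * ind V t = ind V (s * t) := by
  by_cases hs : s = 1
  · subst hs; rw [ind_one, one_mul, one_mul]
  · rw [ind_of_ne hs, zero_mul, ind_of_ne fun h => hs (hS _ _ h)]

end ConstSec

variable (S) [TopologicalSpace S] [DiscreteTopology S]

/-- The sections over `V` of the constant log structure with characteristic monoid `S`: pairs of a
locally constant function to `S` and an invertible function. -/
abbrev ConstSec (V : Scheme.{u}) : Type u := C(V, S) × Γ(V, ⊤)ˣ

namespace ConstSec

variable {S} {U V W : Scheme.{u}}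

/-- Pullback of sections of constant log structures. -/
noncomputable def pull (h : W ⟶ V) : ConstSec S V →* ConstSec S W :=
  (ContinuousMap.compMonoidHom' ⟨h, h.continuous⟩).prodMap (Units.map h.appTop.hom)

lemma pull_snd (h : W ⟶ V) (m : ConstSec S V) :
    ((pull h m).2 : Γ(W, ⊤)) = h.appTop (m.2 : Γ(V, ⊤)) := rfl

lemma ext {S : Type u} [TopologicalSpace S] {V : Scheme.{u}} {m n : ConstSec S V}
    (h₁ : ∀ v, m.1 v = n.1 v) (h₂ : (m.2 : Γ(V, ⊤)) = n.2) : m = n :=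
  Prod.ext (ContinuousMap.ext h₁) (Units.ext h₂)

lemma pull_id (m : ConstSec S V) : pull (𝟙 V) m = m :=
  ext (fun _ => rfl) (by rw [pull_snd, Scheme.Hom.id_appTop]; rfl)

lemma pull_comp (h : U ⟶ V) (h' : V ⟶ W) (m : ConstSec S W) :
    pull (h ≫ h') m = pull h (pull h' m) :=
  ext (fun _ => rfl) (by rw [pull_snd, Scheme.Hom.comp_appTop]; rfl)

/-- The structure map of a constant log structure, for a sharp monoid `S`. -/
noncomputable def α (hS : ∀ a b : S, a * b = 1 → a = 1) (V : Scheme.{u}) :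
    ConstSec S V →* Γ(V, ⊤) where
  toFun m := glueFn m.1 (ind V) * m.2
  map_one' := (mul_one _).trans (((glueFn_const (1 : S) _).trans ind_one))
  map_mul' m n := by
    have : glueFn (m.1 * n.1) (ind V) = glueFn m.1 (ind V) * glueFn n.1 (ind V) :=
      (eq_glueFn fun x => by
        rw [map_mul, germ_glueFn, germ_glueFn, ← map_mul, ind_mul hS]; rfl).symm
    change glueFn (m.1 * n.1) (ind V) * (m.2 * n.2 : Γ(V, ⊤)) = _
    rw [this]
    ring

variable {hS : ∀ a b : S, a * b = 1 → a = 1}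

lemma α_apply (m : ConstSec S V) : α hS V m = glueFn m.1 (ind V) * m.2 := rfl

lemma α_pull (h : W ⟶ V) (m : ConstSec S V) : α hS W (pull h m) = h.appTop (α hS V m) := by
  rw [α_apply, α_apply, map_mul, appTop_glueFn, pull_snd]
  simp_rw [appTop_ind]
  rfl

lemma eq_one_of_isUnit_α {m : ConstSec S V} (h : IsUnit (α hS V m)) : m.1 = 1 := by
  refine ContinuousMap.ext fun x => ?_
  by_contra hx
  have := h.map (V.presheaf.germ ⊤ x trivial).hom
  erw [α_apply, map_mul, germ_glueFn, ind_of_ne hx, map_zero, zero_mul] at this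
  exact not_isUnit_zero this

lemma α_one_mk (u : Γ(V, ⊤)ˣ) : α hS V (1, u) = u := by
  have : glueFn (1 : C(V, S)) (ind V) = 1 := (glueFn_const (1 : S) _).trans ind_one
  rw [α_apply, this, one_mul]

lemma existsUnique_unit (f : Γ(V, ⊤)) (hf : IsUnit f) : ∃! m, α hS V m = f := by
  refine ⟨(1, hf.unit), α_one_mk _, fun m hm => ?_⟩
  have h1 : m.1 = 1 := eq_one_of_isUnit_α (hS := hS) (by rw [hm]; exact hf)
  obtain ⟨m1, m2⟩ := m
  subst h1
  rw [α_one_mk] at hm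
  exact Prod.ext rfl (Units.ext hm)

end ConstSec

/-- The presheaf of monoids underlying a constant log structure. -/
noncomputable def constPresheaf (Y : Scheme.{u}) : Y.Etaleᵒᵖ ⥤ CommMonCat.{u} where
  obj U := CommMonCat.of (ConstSec S U.unop.left)
  map r := CommMonCat.ofHom (ConstSec.pull r.unop.left)
  map_id _ := CommMonCat.hom_ext (MonoidHom.ext fun m => ConstSec.pull_id m)
  map_comp _ _ := CommMonCat.hom_ext (MonoidHom.ext fun m => ConstSec.pull_comp _ _ m)

lemma isSheaf_constPresheaf (Y : Scheme.{u}) :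
    Presheaf.IsSheaf Y.smallEtaleTopology (constPresheaf S Y) := by
  refine isSheaf_commMonCat _ _ fun U R hR x hx => ?_
  let x' : ∀ ⦃V : Y.Etale⦄ (r : V ⟶ U), R r → ConstSec S V.left := fun V r hr => x r hr
  have hx' ⦃V₁ V₂ W : Y.Etale⦄ (g₁ : W ⟶ V₁) (g₂ : W ⟶ V₂) ⦃f₁ : V₁ ⟶ U⦄ ⦃f₂ : V₂ ⟶ U⦄
      (h₁ : R f₁) (h₂ : R f₂) (w : g₁ ≫ f₁ = g₂ ≫ f₂) :
      ConstSec.pull g₁.left (x' f₁ h₁) = ConstSec.pull g₂.left (x' f₂ h₂) := hx g₁ g₂ h₁ h₂ w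
  have hΓ := isSheaf_etSections Y R hR
  obtain ⟨g, hg, hgu⟩ := isSheaf_etBase_continuousMap Y S R hR (fun V r hr => (x' r hr).1)
    fun V₁ V₂ W g₁ g₂ f₁ f₂ h₁ h₂ w => congrArg Prod.fst (hx' g₁ g₂ h₁ h₂ w)
  obtain ⟨a, ha, hau⟩ := hΓ (fun V r hr => ((x' r hr).2 : Γ(V.left, ⊤)))
    fun V₁ V₂ W g₁ g₂ f₁ f₂ h₁ h₂ w =>
      congrArg (fun t : ConstSec S W.left => (t.2 : Γ(W.left, ⊤))) (hx' g₁ g₂ h₁ h₂ w)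
  -- the inverses of the invertible functions are glued as well
  obtain ⟨b, hb, -⟩ := hΓ (fun V r hr => (((x' r hr).2⁻¹ : Γ(V.left, ⊤)ˣ) : Γ(V.left, ⊤)))
    fun V₁ V₂ W g₁ g₂ f₁ f₂ h₁ h₂ w =>
      congrArg (fun t : ConstSec S W.left => ((t.2⁻¹ : Γ(W.left, ⊤)ˣ) : Γ(W.left, ⊤)))
        (hx' g₁ g₂ h₁ h₂ w)
  let a' : Γ(U.left, ⊤) := a
  let b' : Γ(U.left, ⊤) := b
  have hab : a' * b' = 1 := by
    refine hΓ.isSeparatedFor.ext fun V r hr => ?_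
    have e1 : r.left.appTop a' = ((x' r hr).2 : Γ(V.left, ⊤)) := ha r hr
    have e2 : r.left.appTop b' = (((x' r hr).2⁻¹ : Γ(V.left, ⊤)ˣ) : Γ(V.left, ⊤)) := hb r hr
    change r.left.appTop (a' * b') = r.left.appTop 1
    rw [map_mul, e1, e2, map_one, Units.mul_inv]
  refine ⟨((g, ⟨a', b', hab, by rw [mul_comm]; exact hab⟩) : ConstSec S U.left), fun V r hr => ?_,
    fun (m : ConstSec S U.left) hm => ?_⟩
  · exact Prod.ext (hg r hr) (Units.ext (ha r hr))
  · have hm' ⦃V : Y.Etale⦄ (r : V ⟶ U) (hr : R r) : ConstSec.pull r.left m = x' r hr := hm r hr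
    exact Prod.ext (hgu m.1 fun V r hr => congrArg Prod.fst (hm' r hr))
      (Units.ext (hau (m.2 : Γ(U.left, ⊤)) fun V r hr =>
        congrArg (fun t : ConstSec S V.left => (t.2 : Γ(V.left, ⊤))) (hm' r hr)))

variable {S} (hS : ∀ a b : S, a * b = 1 → a = 1)

/-- The constant log structure on `Y` with characteristic monoid a sharp monoid `S`, associated
with the homomorphism `S → 𝒪` that maps every nontrivial element to `0`. -/
noncomputable def constLog (Y : Scheme.{u}) : LogStructure Y where
  M := constPresheaf S Y
  isSheaf := isSheaf_constPresheaf S Y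
  α U := ConstSec.α hS U.left
  α_res r m := ConstSec.α_pull r.left m
  existsUnique_unit _ f hf := ConstSec.existsUnique_unit f hf

end ConstLog

/-! ### Morphisms of constant log schemes -/

section ConstLog

/-- Locally constant functions are étale locally constant. -/
lemma ConstSec.exists_etale_const {S : Type u} [TopologicalSpace S] [DiscreteTopology S]
    {Y : Scheme.{u}} (U : Y.Etale) (g : C(U.left, S)) (x : U.left) :
    ∃ (W : Y.Etale) (r : W ⟶ U) (w : W.left), r.left w = x ∧ ∀ v, g (r.left v) = g x := by
  let A : U.left.Opens := ⟨g ⁻¹' {g x}, (isOpen_discrete _).preimage g.continuous⟩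
  exact ⟨etOf U A.ι inferInstance, etHom A.ι rfl, ⟨x, rfl⟩, rfl, fun v => v.2⟩

variable {S : Type u} [CommMonoid S]

namespace ConstSec

variable {U V W : Scheme.{u}}

/-- Pullback of a homomorphism from `S` to the invertible functions. -/
noncomputable def pullHom (h : W ⟶ V) (τ : S →* Γ(V, ⊤)ˣ) : S →* Γ(W, ⊤)ˣ :=
  (Units.map h.appTop.hom).comp τ

lemma pullHom_comp (h : U ⟶ V) (h' : V ⟶ W) (τ : S →* Γ(W, ⊤)ˣ) :
    pullHom (h ≫ h') τ = pullHom h (pullHom h' τ) :=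
  MonoidHom.ext fun s => Units.ext (by
    change (h ≫ h').appTop _ = h.appTop (h'.appTop _)
    rw [Scheme.Hom.comp_appTop]; rfl)

lemma pullHom_mul (h : W ⟶ V) (τ τ' : S →* Γ(V, ⊤)ˣ) :
    pullHom h (τ * τ') = pullHom h τ * pullHom h τ' :=
  MonoidHom.comp_mul _ _ _

variable [TopologicalSpace S] [DiscreteTopology S]

/-- The invertible function equal to `τ s` on the locus where `g = s`. -/
noncomputable def twUnit (τ : S →* Γ(V, ⊤)ˣ) (g : C(V, S)) : Γ(V, ⊤)ˣ where
  val := glueFn g fun s => τ s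
  inv := glueFn g fun s => ((τ s)⁻¹ : Γ(V, ⊤)ˣ)
  val_inv := by
    rw [glueFn_mul]
    simp_rw [Units.mul_inv]
    exact glueFn_one g
  inv_val := by
    rw [glueFn_mul]
    simp_rw [Units.inv_mul]
    exact glueFn_one g

lemma twUnit_val (τ : S →* Γ(V, ⊤)ˣ) (g : C(V, S)) :
    (twUnit τ g : Γ(V, ⊤)) = glueFn g fun s => τ s := rfl

lemma twUnit_const (τ : S →* Γ(V, ⊤)ˣ) (s : S) : twUnit τ (ContinuousMap.const V s) = τ s :=
  Units.ext (by rw [twUnit_val, glueFn_const])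

lemma twUnit_one (τ : S →* Γ(V, ⊤)ˣ) : twUnit τ 1 = 1 :=
  (twUnit_const τ 1).trans (map_one τ)

lemma twUnit_mul (τ : S →* Γ(V, ⊤)ˣ) (g g' : C(V, S)) :
    twUnit τ (g * g') = twUnit τ g * twUnit τ g' := by
  refine Units.ext ?_
  rw [Units.val_mul, twUnit_val]
  refine (eq_glueFn fun x => ?_).symm
  rw [map_mul, twUnit_val, twUnit_val, germ_glueFn, germ_glueFn, ContinuousMap.mul_apply,
    map_mul τ, Units.val_mul, map_mul]

/-- The automorphism of the sections of a constant log structure that multiplies a section of `S`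
by its image under `τ`. -/
noncomputable def tw (τ : S →* Γ(V, ⊤)ˣ) : ConstSec S V →* ConstSec S V where
  toFun m := (m.1, m.2 * twUnit τ m.1)
  map_one' := Prod.ext rfl ((one_mul _).trans (twUnit_one τ))
  map_mul' m n := by
    refine Prod.ext rfl ?_
    change m.2 * n.2 * twUnit τ (m.1 * n.1) = (m.2 * twUnit τ m.1) * (n.2 * twUnit τ n.1)
    rw [twUnit_mul, mul_mul_mul_comm]

lemma tw_fst (τ : S →* Γ(V, ⊤)ˣ) (m : ConstSec S V) : (tw τ m).1 = m.1 := rfl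

lemma tw_snd (τ : S →* Γ(V, ⊤)ˣ) (m : ConstSec S V) : (tw τ m).2 = m.2 * twUnit τ m.1 := rfl

lemma tw_const (τ : S →* Γ(V, ⊤)ˣ) (s : S) (u : Γ(V, ⊤)ˣ) :
    tw τ (ContinuousMap.const V s, u) = (ContinuousMap.const V s, u * τ s) :=
  Prod.ext rfl (congrArg (u * ·) (twUnit_const τ s))

lemma pull_tw (h : W ⟶ V) (τ : S →* Γ(V, ⊤)ˣ) (m : ConstSec S V) :
    pull h (tw τ m) = tw (pullHom h τ) (pull h m) := by
  refine ext (fun _ => rfl) ?_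
  rw [pull_snd, tw_snd, tw_snd, Units.val_mul, Units.val_mul, map_mul, pull_snd, twUnit_val,
    appTop_glueFn]
  rfl

lemma tw_tw (τ τ' : S →* Γ(V, ⊤)ˣ) (m : ConstSec S V) : tw τ (tw τ' m) = tw (τ' * τ) m := by
  refine Prod.ext rfl ?_
  rw [tw_snd, tw_snd, tw_snd, tw_fst, mul_assoc]
  refine congrArg _ (Units.ext ?_)
  rw [Units.val_mul, twUnit_val, twUnit_val, glueFn_mul]
  rfl

lemma tw_one (m : ConstSec S V) : tw 1 m = m :=
  Prod.ext rfl ((congrArg _ (Units.ext (by rw [twUnit_val]; exact glueFn_one m.1))).trans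
    (mul_one _))

lemma tw_unit (τ : S →* Γ(V, ⊤)ˣ) (u : Γ(V, ⊤)ˣ) : tw τ (1, u) = (1, u) :=
  Prod.ext rfl ((congrArg _ (twUnit_one τ)).trans (mul_one _))

lemma tw_pull_tw_pull (τ : S →* Γ(U, ⊤)ˣ) (a : U ⟶ V) (τ' : S →* Γ(V, ⊤)ˣ) (b : V ⟶ W)
    (m : ConstSec S W) :
    tw τ (pull a (tw τ' (pull b m))) = tw (pullHom a τ' * τ) (pull (a ≫ b) m) := by
  rw [pull_tw, tw_tw, ← pull_comp]

/-- The structure map of a constant log structure does not see multiplication by `τ`, since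
`τ 1 = 1` and the other elements of `S` map to `0`. -/
lemma α_tw {hS : ∀ a b : S, a * b = 1 → a = 1} (τ : S →* Γ(V, ⊤)ˣ) (m : ConstSec S V) :
    α hS V (tw τ m) = α hS V m := by
  rw [α_apply, α_apply, tw_fst, tw_snd, Units.val_mul, mul_left_comm, mul_comm (m.2 : Γ(V, ⊤))]
  congr 1
  refine germ_ext fun x => ?_
  rw [map_mul, germ_glueFn]
  rw [twUnit_val, germ_glueFn]
  by_cases h : m.1 x = 1
  · rw [h, map_one, Units.val_one, map_one]
    exact mul_one _
  · rw [ind_of_ne h, map_zero]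
    exact zero_mul _

lemma isUnit_fst (hS : ∀ a b : S, a * b = 1 → a = 1) (c : (ConstSec S V)ˣ) :
    (c : ConstSec S V).1 = 1 :=
  ContinuousMap.ext fun x => hS _ ((↑c⁻¹ : ConstSec S V).1 x)
    (congrArg (fun m : ConstSec S V => m.1 x) c.mul_inv)

/-- A unit of the sections of a constant log structure, from an invertible function. -/
def unitMk (u : Γ(V, ⊤)ˣ) : (ConstSec S V)ˣ where
  val := (1, u)
  inv := (1, u⁻¹)
  val_inv := Prod.ext (mul_one _) (mul_inv_cancel u)
  inv_val := Prod.ext (mul_one _) (inv_mul_cancel u)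

end ConstSec

variable [TopologicalSpace S] [DiscreteTopology S] (hS : ∀ a b : S, a * b = 1 → a = 1)

lemma constLog_res {Y : Scheme.{u}} {U V : Y.Etale} (r : V ⟶ U) (m : ConstSec S U.left) :
    (constLog hS Y).res r m = ConstSec.pull r.left m := rfl

lemma constLog_isChart {Y : Scheme.{u}} (U : Y.Etale) (β : S →* (constLog hS Y).Sec U)
    (hβ : ∀ s, β s = ((ContinuousMap.const U.left s, 1) : ConstSec S U.left)) :
    (constLog hS Y).IsChart U β where
  surj V r (m : ConstSec S V.left) x := by
    obtain ⟨W, t, w, hw, ht⟩ := ConstSec.exists_etale_const V m.1 x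
    refine ⟨W, t, w, m.1 x, ConstSec.unitMk (ConstSec.pull t.left m).2, hw, ?_⟩
    rw [hβ, constLog_res, constLog_res]
    refine Prod.ext (ContinuousMap.ext fun v => (ht v).trans (one_mul _).symm) ?_
    exact (mul_one _).symm.trans (congrArg _ (map_one (Units.map _)).symm)
  inj V r p q c d h x := by
    let c' : (ConstSec S V.left)ˣ := c
    let d' : (ConstSec S V.left)ˣ := d
    rw [hβ, hβ, constLog_res, constLog_res] at h
    have h' : (c' : ConstSec S V.left) * ConstSec.pull r.left (ContinuousMap.const U.left p, 1) =
      d' * ConstSec.pull r.left (ContinuousMap.const U.left q, 1) := h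
    have hc := ConstSec.isUnit_fst hS c'
    have hd := ConstSec.isUnit_fst hS d'
    have h1 : (c' : ConstSec S V.left).1 x * p = (d' : ConstSec S V.left).1 x * q :=
      congrArg (fun m : ConstSec S V.left => m.1 x) h'
    rw [hc, hd, ContinuousMap.one_apply, one_mul, one_mul] at h1
    subst h1
    have hcd : c = d := Units.ext (Prod.ext (hc.trans hd.symm)
      (mul_right_cancel (congrArg (fun m : ConstSec S V.left => m.2) h')))
    refine ⟨V, 𝟙 V, x, 1, 1, rfl, ?_, ?_, rfl, ?_⟩
    · rw [map_one, map_one]; exact isUnit_one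
    · rw [map_one, map_one]; exact isUnit_one
    · rw [hcd]

lemma constLog_isFs (hfs : IsFsMonoid S) (Y : Scheme.{u}) : (constLog hS Y).IsFs := fun x => by
  let U : Y.Etale := MorphismProperty.Over.mk (P := etProp) ⊤ (𝟙 Y) (etProp.id_mem _)
  let β : S →* ConstSec S U.left :=
    { toFun := fun s => (ContinuousMap.const U.left s, 1)
      map_one' := rfl
      map_mul' := fun _ _ => Prod.ext rfl (mul_one _).symm }
  exact ⟨U, x, S, inferInstance, β, rfl, hfs, constLog_isChart hS U β fun _ => rfl⟩

/-- The morphism of constant log schemes given by a morphism `f` of schemes and a homomorphism `τ`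
from the characteristic monoid to the invertible functions of the source. -/
noncomputable def constHom {Y' Y : Scheme.{u}} (f : Y' ⟶ Y) (τ : S →* Γ(Y', ⊤)ˣ) :
    LogHom (constLog hS Y') (constLog hS Y) where
  base := f
  comap {U V} h _ := (ConstSec.tw (ConstSec.pullHom (W := U.left) U.hom τ)).comp (ConstSec.pull h)
  res_comap {U U' V} r h w w' n := by
    refine (ConstSec.pull_tw r.left _ _).trans ?_
    rw [← ConstSec.pullHom_comp, et_w]
    exact congrArg _ (ConstSec.pull_comp _ _ _).symm
  comap_res {U V V'} h s w w' n :=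
    congrArg (ConstSec.tw (ConstSec.pullHom (W := U.left) U.hom τ))
      (ConstSec.pull_comp h s.left n).symm
  α_comap h w n := (ConstSec.α_tw (hS := hS) _ _).trans (ConstSec.α_pull _ _)

variable {hS}

lemma constHom_comap {Y' Y : Scheme.{u}} (f : Y' ⟶ Y) (τ : S →* Γ(Y', ⊤)ˣ) {U : Y'.Etale}
    {V : Y.Etale} (h : U.left ⟶ V.left) (w : h ≫ V.hom = U.hom ≫ (constHom hS f τ).base)
    (n : ConstSec S V.left) :
    (constHom hS f τ).comap h w n =
      ConstSec.tw (ConstSec.pullHom (W := U.left) U.hom τ) (ConstSec.pull h n) := rfl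

lemma constHom_id (Y : Scheme.{u}) : constHom hS (𝟙 Y) 1 = LogHom.id (constLog hS Y) :=
  LogHom.ext rfl fun {U V} h w w' n => by
    have : ConstSec.pullHom (S := S) (W := U.left) U.hom 1 = 1 := MonoidHom.comp_one (Units.map _)
    refine (constHom_comap _ _ _ _ _).trans ?_
    rw [this]
    exact ConstSec.tw_one _

lemma constHom_comp {Y'' Y' Y : Scheme.{u}} (f' : Y'' ⟶ Y') (τ' : S →* Γ(Y'', ⊤)ˣ) (f : Y' ⟶ Y)
    (τ : S →* Γ(Y', ⊤)ˣ) : (constHom hS f' τ').comp (constHom hS f τ) =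
      constHom hS (f' ≫ f) (ConstSec.pullHom f' τ * τ') := by
  refine LogHom.ext rfl fun {U W} h w w' n => ?_
  have w₁ : h ≫ W.hom = (U.hom ≫ f') ≫ f := w'.trans (Category.assoc _ _ _).symm
  refine (LogHom.comp_comap_eq _ _ h w _ (etPullLift_hom f W h (U.hom ≫ f') w₁) (etPullFst f W)
    (etPullFst_w f W) (etPullLift_fst _ _ _ _ _) n).trans
    ((ConstSec.tw_pull_tw_pull _ _ _ _ _).trans ?_)
  rw [etPullLift_fst, ← ConstSec.pullHom_comp, etPullLift_hom, ConstSec.pullHom_comp,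
    ← ConstSec.pullHom_mul]
  rfl

lemma constHom_isStrict {Y' Y : Scheme.{u}} (f : Y' ⟶ Y) (τ : S →* Γ(Y', ⊤)ˣ) :
    (constHom hS f τ).IsStrict where
  surj U (m : ConstSec S U.left) x := by
    obtain ⟨W, t, w, hw, ht⟩ := ConstSec.exists_etale_const U m.1 x
    let V : Y.Etale := MorphismProperty.Over.mk (P := etProp) ⊤ (𝟙 Y) (etProp.id_mem _)
    refine ⟨W, t, w, V, W.hom ≫ f, Category.comp_id _, (ContinuousMap.const V.left (m.1 x), 1),
      ConstSec.unitMk ((ConstSec.pull t.left m).2 *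
        (ConstSec.pullHom (W := W.left) W.hom τ (m.1 x))⁻¹), hw, ?_⟩
    rw [constLog_res]
    have e : ConstSec.pull (W.hom ≫ f) ((ContinuousMap.const V.left (m.1 x), 1) :
        ConstSec S V.left) = (ContinuousMap.const W.left (m.1 x), 1) :=
      Prod.ext rfl (map_one (Units.map _))
    refine Eq.trans ?_ (congrArg _ ((constHom_comap f τ _ _ _).trans
      ((congrArg _ e).trans (ConstSec.tw_const _ _ _))).symm)
    refine Prod.ext (ContinuousMap.ext fun v => (ht v).trans (one_mul _).symm) ?_
    change _ = _ * _ * (_ * _)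
    rw [one_mul, inv_mul_cancel_right]
  inj U V h hw n n' c d e x := by
    let c' : (ConstSec S U.left)ˣ := c
    let d' : (ConstSec S U.left)ˣ := d
    let m : ConstSec S V.left := n
    let m' : ConstSec S V.left := n'
    let φ := ConstSec.pullHom (W := U.left) U.hom τ
    have e' : (c' : ConstSec S U.left) * ConstSec.tw φ (ConstSec.pull h m) =
      d' * ConstSec.tw φ (ConstSec.pull h m') := e
    have hc := ConstSec.isUnit_fst hS c'
    have hd := ConstSec.isUnit_fst hS d'
    have h1 (y : U.left) : m.1 (h y) = m'.1 (h y) := by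
      have : (c' : ConstSec S U.left).1 y * m.1 (h y) =
        (d' : ConstSec S U.left).1 y * m'.1 (h y) :=
        congrArg (fun m : ConstSec S U.left => m.1 y) e'
      rwa [hc, hd, ContinuousMap.one_apply, one_mul, one_mul] at this
    have h2 : (c' : ConstSec S U.left).2 * (ConstSec.pull h m).2 =
        (d' : ConstSec S U.left).2 * (ConstSec.pull h m').2 := by
      have := congrArg (fun m : ConstSec S U.left => m.2) e'
      have h3 : (ConstSec.pull h m).1 = (ConstSec.pull h m').1 := ContinuousMap.ext h1
      change _ * (_ * _) = _ * (_ * _) at this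
      rw [← mul_assoc, ← mul_assoc, h3] at this
      exact mul_right_cancel this
    obtain ⟨V₁, t, v, hv, ht⟩ := ConstSec.exists_etale_const V m.1 (h x)
    obtain ⟨V₂, t', v', hv', ht'⟩ := ConstSec.exists_etale_const V₁ (ConstSec.pull t.left m').1 v
    obtain ⟨W, s, w, h', hs, -, hh⟩ := exists_etale_nbhd h (t' ≫ t) x v' (by
      rw [← hv, ← hv']; rfl)
    have hh1 : h' ≫ V₂.hom = W.hom ≫ f := by
      rw [← et_w (t' ≫ t), ← Category.assoc, hh, Category.assoc, hw, ← Category.assoc, et_w]; rfl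
    refine ⟨W, s, w, V₂, t' ≫ t, h', hh1, ConstSec.unitMk (ConstSec.pull (t' ≫ t).left m').2,
      ConstSec.unitMk (ConstSec.pull (t' ≫ t).left m).2, hs, hh, ?_, ?_⟩
    · refine Prod.ext (ContinuousMap.ext fun y => ?_) (mul_comm _ _)
      refine congrArg (1 * ·) ((ht _).trans ((h1 x).trans ?_))
      rw [← hv]
      exact (ht' y).symm
    · have key (m : ConstSec S V.left) : ConstSec.pull h'
          ((1, (ConstSec.pull (t' ≫ t).left m).2) : ConstSec S V₂.left) =
          (1, (ConstSec.pull s.left (ConstSec.pull h m)).2) := Prod.ext rfl (by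
        change (ConstSec.pull h' (ConstSec.pull (t' ≫ t).left m)).2 = _
        rw [← ConstSec.pull_comp, hh, ConstSec.pull_comp])
      have key' (m : ConstSec S V.left) : (constHom hS f τ).comap h' hh1
          ((1, (ConstSec.pull (t' ≫ t).left m).2) : ConstSec S V₂.left) =
          ((1, (ConstSec.pull s.left (ConstSec.pull h m)).2) : ConstSec S W.left) :=
        (congrArg _ (key m)).trans (ConstSec.tw_unit _ _)
      refine (congrArg (· * _) (key' m)).trans (Eq.trans ?_ (congrArg (· * _) (key' m')).symm)
      refine Prod.ext (congrArg (fun g => 1 * (g : C(W.left, S))) ?_) ?_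
      · change (c' : ConstSec S U.left).1.comp _ = (d' : ConstSec S U.left).1.comp _
        rw [hc, hd]
      · have := congrArg (Units.map (s.left.appTop.hom : Γ(U.left, ⊤) →* Γ(W.left, ⊤))) h2
        rw [map_mul, map_mul, mul_comm, mul_comm (Units.map _ (d' : ConstSec S U.left).2)] at this
        exact this

end ConstLog

/-! ### Lifting along strict étale morphisms -/

namespace LogStructure

variable {X : Scheme.{u}} (L : LogStructure X)

/-- Sections of a log structure with the same invertible image in the structure sheaf agree. -/
lemma eq_of_α_eq {U : X.Etale} {m n : L.Sec U} (h : L.α U m = L.α U n) (hu : IsUnit (L.α U n)) :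
    m = n :=
  (L.existsUnique_unit U _ hu).unique h rfl

lemma isUnit_of_isUnit_α {U : X.Etale} {m : L.Sec U} (h : IsUnit (L.α U m)) : IsUnit m := by
  obtain ⟨n, hn, -⟩ := L.existsUnique_unit U _ h.unit⁻¹.isUnit
  have hmn : L.α U (m * n) = L.α U 1 := by
    rw [map_mul, hn, map_one]
    exact h.mul_val_inv
  exact IsUnit.of_mul_eq_one n (L.eq_of_α_eq hmn (by rw [map_one]; exact isUnit_one))

end LogStructure

/-- An étale scheme over `U`, as an étale scheme over `T`, for `f : U → T` étale. -/
def etComp {U T : Scheme.{u}} (f : U ⟶ T) (hf : Etale f) (W : U.Etale) : T.Etale :=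
  MorphismProperty.Over.mk (P := etProp) ⊤ (W.hom ≫ f) (etProp.comp_mem _ _ W.prop hf)

namespace LogHom

variable {U T A : Scheme.{u}} {L : LogStructure U} {K : LogStructure T} {J : LogStructure A}

lemma comap_eq_of_eq {φ ψ : LogHom L K} (e : φ = ψ) {W : U.Etale} {V : T.Etale}
    (h : W.left ⟶ V.left) (w : h ≫ V.hom = W.hom ≫ φ.base) (w' : h ≫ V.hom = W.hom ≫ ψ.base)
    (n : K.Sec V) : φ.comap h w n = ψ.comap h w' n := by
  subst e; rfl

/-- The components of a morphism of log schemes commute with restriction. -/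
lemma res_comap_res (p : LogHom L K) {W W' : U.Etale} {V V' : T.Etale} (s : W' ⟶ W) (r : V' ⟶ V)
    (h : W.left ⟶ V.left) (h' : W'.left ⟶ V'.left) (w : h ≫ V.hom = W.hom ≫ p.base)
    (w' : h' ≫ V'.hom = W'.hom ≫ p.base) (e : s.left ≫ h = h' ≫ r.left) (n : K.Sec V) :
    L.res s (p.comap h w n) = p.comap h' w' (K.res r n) := by
  have w₁ : (s.left ≫ h) ≫ V.hom = W'.hom ≫ p.base := by
    rw [Category.assoc, w, ← Category.assoc, et_w]
  have w₂ : (h' ≫ r.left) ≫ V.hom = W'.hom ≫ p.base := by rw [← e, w₁]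
  exact (p.res_comap s h w w₁ n).trans ((p.comap_congr e w₁ w₂ n).trans
    (p.comap_res h' r w' w₂ n).symm)

/-- The identity of the scheme underlying `W`, from `W` to `W` viewed as étale over `T`. -/
def etId {f : U ⟶ T} (hf : Etale f) (W : U.Etale) : W.left ⟶ (etComp f hf W).left := 𝟙 W.left

lemma etId_w {f : U ⟶ T} (hf : Etale f) (W : U.Etale) :
    etId hf W ≫ (etComp f hf W).hom = W.hom ≫ f := Category.id_comp _

instance {f : U ⟶ T} (hf : Etale f) (W : U.Etale) : IsIso (etId hf W) :=
  inferInstanceAs (IsIso (𝟙 W.left))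

lemma appTop_etId {f : U ⟶ T} (hf : Etale f) (W : U.Etale) (x : Γ(W.left, ⊤)) :
    (etId hf W).appTop.hom x = x := by
  change (𝟙 W.left : W.left ⟶ W.left).appTop.hom x = x
  rw [Scheme.Hom.id_appTop]; rfl

/-- A morphism of étale `U`-schemes, as a morphism of étale `T`-schemes. -/
def etCompMap {f : U ⟶ T} (hf : Etale f) {W' W : U.Etale} (s : W' ⟶ W) :
    etComp f hf W' ⟶ etComp f hf W :=
  etHom s.left ((Category.assoc _ _ _).symm.trans (congrArg (· ≫ f) (et_w s)))

lemma etCompMap_w {f : U ⟶ T} (hf : Etale f) {W' W : U.Etale} (s : W' ⟶ W) :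
    s.left ≫ etId hf W = etId hf W' ≫ (etCompMap hf s).left :=
  (Category.comp_id _).trans (Category.id_comp _).symm

/-- A morphism from a `U`-étale scheme to a `T`-étale scheme over `f`, as a morphism of étale
`T`-schemes. -/
def etAdj {f : U ⟶ T} (hf : Etale f) {W : U.Etale} {V : T.Etale} (h : W.left ⟶ V.left)
    (w : h ≫ V.hom = W.hom ≫ f) : etComp f hf W ⟶ V := etHom h w

lemma etId_etAdj {f : U ⟶ T} (hf : Etale f) {W : U.Etale} {V : T.Etale} (h : W.left ⟶ V.left)
    (w : h ≫ V.hom = W.hom ≫ f) : etId hf W ≫ (etAdj hf h w).left = h := Category.id_comp _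

/-- An étale `T`-scheme with a morphism to an étale `U`-scheme, as an étale `U`-scheme. -/
def etDesc {f : U ⟶ T} (hf : Etale f) (W : U.Etale) {Z : T.Etale} (a : Z ⟶ etComp f hf W) :
    U.Etale := etOf W a.left (inferInstanceAs (Etale a.left))

/-- The identity of the scheme underlying `Z`. -/
def etDescId {f : U ⟶ T} (hf : Etale f) (W : U.Etale) {Z : T.Etale} (a : Z ⟶ etComp f hf W) :
    (etDesc hf W a).left ⟶ Z.left := 𝟙 Z.left

instance {f : U ⟶ T} (hf : Etale f) (W : U.Etale) {Z : T.Etale} (a : Z ⟶ etComp f hf W) :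
    IsIso (etDescId hf W a) := inferInstanceAs (IsIso (𝟙 Z.left))

lemma etDescId_w {f : U ⟶ T} (hf : Etale f) (W : U.Etale) {Z : T.Etale}
    (a : Z ⟶ etComp f hf W) : etDescId hf W a ≫ Z.hom = (etDesc hf W a).hom ≫ f :=
  (Category.id_comp _).trans ((et_w a).symm.trans (Category.assoc _ _ _).symm)

/-- The structure morphism of `etDesc`. -/
def etDescHom {f : U ⟶ T} (hf : Etale f) (W : U.Etale) {Z : T.Etale} (a : Z ⟶ etComp f hf W) :
    etDesc hf W a ⟶ W := etHom a.left rfl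

lemma etDescHom_etId {f : U ⟶ T} (hf : Etale f) (W : U.Etale) {Z : T.Etale}
    (a : Z ⟶ etComp f hf W) :
    (etDescHom hf W a).left ≫ etId hf W = etDescId hf W a ≫ a.left :=
  (Category.comp_id _).trans (Category.id_comp _).symm

variable {p : LogHom L K} (hp : p.IsStrict) (het : Etale p.base)

include hp het in
/-- For a strict étale morphism, the comparison of the sections over an étale scheme of the source
and over the same scheme viewed as an étale scheme over the target is injective. -/
lemma comap_injective_of_isIso {W : U.Etale} {V : T.Etale} (h : W.left ⟶ V.left) [IsIso h]
    (w : h ≫ V.hom = W.hom ≫ p.base) : Function.Injective (p.comap h w) := by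
  intro n n' e
  refine LogStructure.sec_ext fun x => ?_
  obtain ⟨W', s, w', V', t, h', hw', a, b, hs, hc, hab, hφ⟩ :=
    hp.inj W V h w n n' 1 1 (by rw [e]) ((inv h) x)
  have hx : (s.left ≫ h) w' = x := by
    rw [Scheme.Hom.comp_apply, hs, ← Scheme.Hom.comp_apply, IsIso.inv_hom_id]; rfl
  have w₁ : (s.left ≫ h) ≫ V.hom = W'.hom ≫ p.base := by
    rw [Category.assoc, w, ← Category.assoc, et_w]
  let r := etAdj het (s.left ≫ h) w₁
  let r' := etAdj het h' hw'
  have hr : r = r' ≫ t := et_ext hc.symm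
  refine ⟨etComp p.base het W', r, w', hx, ?_⟩
  have key (y : K.Sec V') : L.α W' (p.comap h' hw' y) = K.α _ (K.res r' y) := by
    rw [p.α_comap]; exact (K.α_res r' y).symm
  rw [Units.val_one, map_one, mul_one, mul_one] at hφ
  have hab' : K.res r' (a : K.Sec V') = K.res r' b :=
    K.eq_of_α_eq ((key _).symm.trans ((congrArg _ hφ.symm).trans (key _)))
      ((b.isUnit.map _).map _)
  have := congrArg (K.res r') hab
  rw [map_mul, map_mul, hab', LogStructure.res_res, LogStructure.res_res, ← hr] at this
  exact (b.isUnit.map (K.res r')).mul_left_cancel this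

include hp in
lemma comap_surjective_of_etale (W : U.Etale) :
    Function.Surjective (p.comap (etId het W) (etId_w het W)) := by
  intro m
  have hloc (x : W.left) : ∃ (W' : U.Etale) (s : W' ⟶ W) (w : W'.left)
      (n : K.Sec (etComp p.base het W')), s.left w = x ∧
      L.res s m = p.comap (etId het W') (etId_w het W') n := by
    obtain ⟨W', s, w, V, h, hw, n, c, hs, e⟩ := hp.surj W m x
    obtain ⟨c', hc', -⟩ := K.existsUnique_unit (etComp p.base het W') (L.α W' c)
      (c.isUnit.map _)
    have hcc : p.comap (etId het W') (etId_w het W') c' = c := by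
      refine L.eq_of_α_eq ?_ (c.isUnit.map _)
      rw [p.α_comap, hc']
      exact appTop_etId _ _ _
    refine ⟨W', s, w, c' * K.res (etAdj het h hw) n, hs, ?_⟩
    rw [e, map_mul, hcc]
    refine congrArg _ ?_
    have := res_comap_res p (𝟙 W') (etAdj het h hw) h (etId het W') hw (etId_w het W')
      ((Category.id_comp _).trans (etId_etAdj het h hw).symm) n
    rwa [LogStructure.res_id] at this
  choose W' s w n hs e using hloc
  obtain ⟨t, ht⟩ := LogStructure.exists_glue (L := K) (fun x => etCompMap het (s x))
    (fun x => ⟨x, w x, hs x⟩) n (by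
    intro x y Z a b hab
    have hab' : a.left ≫ (s x).left = b.left ≫ (s y).left := congrArg (fun t => t.left) hab
    let b' : etDesc het (W' x) a ⟶ W' y := etHom b.left (by
      change b.left ≫ (W' y).hom = a.left ≫ (W' x).hom
      rw [← et_w (s x), ← et_w (s y)]
      exact (Category.assoc _ _ _).symm.trans
        ((congrArg (· ≫ W.hom) hab'.symm).trans (Category.assoc _ _ _)))
    have hss : etDescHom het (W' x) a ≫ s x = b' ≫ s y := et_ext hab'
    refine comap_injective_of_isIso hp het (etDescId het (W' x) a) (etDescId_w het _ a) ?_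
    have h₁ := res_comap_res p (etDescHom het (W' x) a) a _ _ (etId_w het _)
      (etDescId_w het _ a) (etDescHom_etId het _ a) (n x)
    have h₂ := res_comap_res p b' b _ _ (etId_w het _) (etDescId_w het _ a)
      ((Category.comp_id _).trans (Category.id_comp _).symm) (n y)
    rw [← e, LogStructure.res_res] at h₁ h₂
    rw [← h₁, ← h₂, hss])
  refine ⟨t, LogStructure.sec_ext fun x => ⟨W' x, s x, w x, hs x, ?_⟩⟩
  rw [e, ← ht]
  exact res_comap_res p _ _ _ _ _ _ (etCompMap_w het _) _

/-- A strict étale morphism identifies the log structure of the source with the restriction of the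
log structure of the target. -/
noncomputable def etaleEquiv (W : U.Etale) : K.Sec (etComp p.base het W) ≃* L.Sec W :=
  MulEquiv.ofBijective (p.comap (etId het W) (etId_w het W))
    ⟨comap_injective_of_isIso hp het _ _, comap_surjective_of_etale hp het W⟩

lemma etaleEquiv_symm_eq {W : U.Etale} {m : L.Sec W} {n : K.Sec (etComp p.base het W)}
    (h : p.comap (etId het W) (etId_w het W) n = m) : (etaleEquiv hp het W).symm m = n :=
  (MulEquiv.symm_apply_eq _).2 h.symm

lemma comap_etaleEquiv_symm {W : U.Etale} (m : L.Sec W) :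
    p.comap (etId het W) (etId_w het W) ((etaleEquiv hp het W).symm m) = m :=
  (etaleEquiv hp het W).apply_symm_apply m

/-- Morphisms of log schemes lift along a strict étale morphism as soon as the underlying morphisms
of schemes do. -/
noncomputable def etaleLift (φ : LogHom J K) (g : A ⟶ U) (hg : g ≫ p.base = φ.base) :
    LogHom J L where
  base := g
  comap {B W} h w := (φ.comap (h ≫ etId het W) (by
    rw [Category.assoc, etId_w, ← Category.assoc, w, Category.assoc, hg])).comp
      (etaleEquiv hp het W).symm.toMonoidHom
  res_comap r h w w' n := φ.res_comap r _ _ _ _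
  comap_res {B W W'} h s w w' n := by
    have : (etaleEquiv hp het W).symm (L.res s n) =
        K.res (etCompMap het s) ((etaleEquiv hp het W').symm n) := by
      refine etaleEquiv_symm_eq hp het ?_
      conv_rhs => rw [← comap_etaleEquiv_symm hp het n]
      exact (res_comap_res p _ _ _ _ _ _ (etCompMap_w het s) _).symm
    change φ.comap _ _ _ = φ.comap _ _ _
    have w₁ : (h ≫ etId het W) ≫ (etComp p.base het W).hom = B.hom ≫ φ.base := by
      rw [Category.assoc, etId_w, ← Category.assoc, w, Category.assoc, hg]
    have e : (h ≫ etId het W) ≫ (etCompMap het s).left = (h ≫ s.left) ≫ etId het W' := by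
      rw [Category.assoc, Category.assoc, etCompMap_w]
    have w₂ : ((h ≫ etId het W) ≫ (etCompMap het s).left) ≫ (etComp p.base het W').hom =
        B.hom ≫ φ.base := by rw [Category.assoc, et_w, w₁]
    exact (congrArg _ this).trans ((φ.comap_res _ (etCompMap het s) w₁ w₂ _).trans
      (φ.comap_congr e _ _ _))
  α_comap {B W} h w n := by
    refine (φ.α_comap _ _ _).trans ?_
    conv_rhs => rw [← comap_etaleEquiv_symm hp het n]
    rw [p.α_comap, Scheme.Hom.comp_appTop]
    rfl

variable (φ : LogHom J K) (g : A ⟶ U) (hg : g ≫ p.base = φ.base)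

lemma etaleLift_comap {B : A.Etale} {W : U.Etale} (h : B.left ⟶ W.left)
    (w : h ≫ W.hom = B.hom ≫ g) (w' : (h ≫ etId het W) ≫ (etComp p.base het W).hom =
      B.hom ≫ φ.base)
    (n : L.Sec W) : (etaleLift hp het φ g hg).comap h w n =
      φ.comap (h ≫ etId het W) w' ((etaleEquiv hp het W).symm n) := rfl

lemma etaleLift_comp : (etaleLift hp het φ g hg).comp p = φ := by
  refine LogHom.ext hg fun {B V} h w w' n => ?_
  have w₁ : h ≫ V.hom = (B.hom ≫ g) ≫ p.base := w.trans (Category.assoc _ _ _).symm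
  rw [comp_comap_eq _ _ h w _ (etPullLift_hom p.base V h (B.hom ≫ g) w₁) (etPullFst p.base V)
    (etPullFst_w p.base V) (etPullLift_fst _ _ _ _ _)]
  let r := etAdj het (etPullFst p.base V) (etPullFst_w p.base V)
  have : (etaleEquiv hp het (etPull p.base V)).symm
      (p.comap (etPullFst p.base V) (etPullFst_w p.base V) n) = K.res r n := by
    refine etaleEquiv_symm_eq hp het ?_
    have := res_comap_res p (𝟙 _) r (etPullFst p.base V) (etId het _) (etPullFst_w p.base V)
      (etId_w het _) ((Category.id_comp _).trans (etId_etAdj het _ _).symm) n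
    rw [LogStructure.res_id] at this
    exact this.symm
  have w₃ : (etPullLift p.base V h (B.hom ≫ g) w₁ ≫ etId het _) ≫
      (etComp p.base het (etPull p.base V)).hom = B.hom ≫ φ.base := by
    rw [Category.assoc, etId_w, ← Category.assoc, etPullLift_hom, Category.assoc, hg]
  have e : (etPullLift p.base V h (B.hom ≫ g) w₁ ≫ etId het _) ≫ r.left = h := by
    rw [Category.assoc, etId_etAdj, etPullLift_fst]
  have w₄ : ((etPullLift p.base V h (B.hom ≫ g) w₁ ≫ etId het _) ≫ r.left) ≫ V.hom =
      B.hom ≫ φ.base := by rw [e, w']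
  refine (etaleLift_comap hp het φ g hg _ _ w₃ _).trans ((congrArg _ this).trans ?_)
  exact (φ.comap_res _ r w₃ w₄ n).trans (φ.comap_congr e _ _ _)

include hp het in
/-- A morphism to the source of a strict étale morphism `p` is determined by the underlying
morphism of schemes and by its composite with `p`. -/
lemma ext_of_etale {ψ ψ' : LogHom J L} (hb : ψ.base = ψ'.base) (h : ψ.comp p = ψ'.comp p) :
    ψ = ψ' := by
  refine LogHom.ext hb fun {B W} k w w' m => ?_
  rw [← comap_etaleEquiv_symm hp het m]
  have w₁ : (k ≫ etId het W) ≫ (etComp p.base het W).hom = B.hom ≫ (ψ.comp p).base := by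
    rw [Category.assoc, etId_w, ← Category.assoc, w, Category.assoc]; rfl
  have w₂ : (k ≫ etId het W) ≫ (etComp p.base het W).hom = B.hom ≫ (ψ'.comp p).base := by
    rw [w₁, h]
  rw [← comp_comap_eq ψ p (k ≫ etId het W) w₁ k w _ (etId_w het W) rfl,
    ← comp_comap_eq ψ' p (k ≫ etId het W) w₂ k w' _ (etId_w het W) rfl]
  exact comap_eq_of_eq h _ _ _ _

lemma etaleLift_isStrict (hφ : φ.IsStrict) : (etaleLift hp het φ g hg).IsStrict where
  surj B m x := by
    obtain ⟨W, s, w, V, h, hw, n, c, hs, e⟩ := hφ.surj B m x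
    have w₁ : h ≫ V.hom = (W.hom ≫ g) ≫ p.base := by rw [hw, ← hg, Category.assoc]
    refine ⟨W, s, w, etPull p.base V, etPullLift p.base V h (W.hom ≫ g) w₁,
      etPullLift_hom _ _ _ _ _, p.comap (etPullFst p.base V) (etPullFst_w p.base V) n, c, hs, ?_⟩
    rw [e]
    refine congrArg _ ?_
    have w₂ : h ≫ V.hom = W.hom ≫ ((etaleLift hp het φ g hg).comp p).base :=
      w₁.trans (Category.assoc _ _ _)
    refine (comap_eq_of_eq (etaleLift_comp hp het φ g hg).symm h hw w₂ n).trans ?_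
    exact comp_comap_eq _ p h w₂ _ (etPullLift_hom _ _ _ _ _) _ (etPullFst_w _ _)
      (etPullLift_fst _ _ _ _ _) n
  inj B V h hw n n' c d e x := by
    have wV : (h ≫ etId het V) ≫ (etComp p.base het V).hom = B.hom ≫ φ.base := by
      rw [Category.assoc, etId_w, ← Category.assoc, hw, Category.assoc]
      exact congrArg _ hg
    obtain ⟨W, s, w, V', t, h', hw', a, b, hs, hc, hab, hφ⟩ :=
      hφ.inj B (etComp p.base het V) (h ≫ etId het V) wV _ _ c d e x
    have hcV : h' ≫ t.left = s.left ≫ h := hc.trans (Category.assoc _ _ _).symm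
    have hw'' : h' ≫ (etDesc het V t).hom = W.hom ≫ g := by
      have h1 : (h' ≫ t.left) ≫ V.hom = (s.left ≫ h) ≫ V.hom := congrArg (· ≫ V.hom) hcV
      have h2 : (s.left ≫ h) ≫ V.hom = W.hom ≫ g := by
        rw [Category.assoc, hw, ← Category.assoc, et_w]; rfl
      exact (Category.assoc _ _ _).symm.trans (h1.trans h2)
    let q : K.Sec V' →* L.Sec (etDesc het V t) := p.comap (etDescId het V t) (etDescId_w het V t)
    have key (y : K.Sec V') : (etaleLift hp het φ g hg).comap (V := etDesc het V t) h' hw''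
        (q y) = φ.comap h' hw' y := by
      have w₅ : h' ≫ V'.hom = W.hom ≫ ((etaleLift hp het φ g hg).comp p).base := by
        rw [etaleLift_comp]; exact hw'
      refine (comp_comap_eq (etaleLift hp het φ g hg) p h' w₅ (V := etDesc het V t) h' hw''
        (etDescId het V t) (etDescId_w het V t) (Category.comp_id _) y).symm.trans ?_
      exact comap_eq_of_eq (etaleLift_comp hp het φ g hg) _ _ _ _
    have key' (m : L.Sec V) : L.res (etDescHom het V t) m =
        q (K.res t ((etaleEquiv hp het V).symm m)) := by
      conv_lhs => rw [← comap_etaleEquiv_symm hp het m]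
      exact res_comap_res p _ _ _ _ _ _ (etDescHom_etId het V t) _
    refine ⟨W, s, w, etDesc het V t, etDescHom het V t, h', hw'', Units.map q a, Units.map q b,
      hs, hcV, ?_, ?_⟩
    · rw [key', key', Units.coe_map, Units.coe_map]
      exact (map_mul q _ _).symm.trans ((congrArg q hab).trans (map_mul q _ _))
    · have hφ' := hφ
      rw [← key, ← key] at hφ'
      exact hφ'

end LogHom

/-! ### Quotients of fs monoids by faces -/

section Face

variable {P : Type u} [CommMonoid P] (Q : Submonoid P)

/-- The congruence on `P` whose quotient is `P / Q`: the image of `P` in `P^gp / Q^gp`. -/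
def faceCon [IsCancelMul P] : Con P where
  r p p' := ∃ q ∈ Q, ∃ q' ∈ Q, q * p = q' * p'
  iseqv :=
    { refl p := ⟨1, Q.one_mem, 1, Q.one_mem, rfl⟩
      symm := fun ⟨q, hq, q', hq', e⟩ => ⟨q', hq', q, hq, e.symm⟩
      trans := fun {x y z} ⟨a, ha, b, hb, e⟩ ⟨c, hc, d, hd, e'⟩ =>
        ⟨c * a, Q.mul_mem hc ha, b * d, Q.mul_mem hb hd, by
          rw [mul_assoc, e, mul_left_comm, e', mul_assoc]⟩ }
  mul' := fun {w x y z} ⟨a, ha, b, hb, e⟩ ⟨c, hc, d, hd, e'⟩ =>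
    ⟨a * c, Q.mul_mem ha hc, b * d, Q.mul_mem hb hd, by
      rw [mul_mul_mul_comm, e, e', mul_mul_mul_comm]⟩

/-- The quotient of a cancellative monoid by a submonoid. -/
abbrev FaceQuotient [IsCancelMul P] : Type u := (faceCon Q).Quotient

variable [IsCancelMul P]

/-- The projection to the quotient. -/
def faceMk : P →* FaceQuotient Q := (faceCon Q).mk'

lemma faceMk_surjective : Function.Surjective (faceMk Q) := Con.mk'_surjective

lemma faceMk_eq_iff {p p' : P} :
    faceMk Q p = faceMk Q p' ↔ ∃ q ∈ Q, ∃ q' ∈ Q, q * p = q' * p' := (faceCon Q).eq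

variable {Q}

lemma faceMk_eq_one_iff (hQ : ∀ a b, a * b ∈ Q → a ∈ Q) {p : P} : faceMk Q p = 1 ↔ p ∈ Q := by
  rw [← map_one (faceMk Q), faceMk_eq_iff]
  constructor
  · rintro ⟨q, _, q', hq', e⟩
    exact hQ p q (by rw [mul_comm, e, mul_one]; exact hq')
  · exact fun hp => ⟨1, Q.one_mem, p, hp, by rw [one_mul, mul_one]⟩

lemma faceQuotient_sharp (hQ : ∀ a b, a * b ∈ Q → a ∈ Q) (a b : FaceQuotient Q) (h : a * b = 1) :
    a = 1 := by
  obtain ⟨a, rfl⟩ := faceMk_surjective Q a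
  obtain ⟨b, rfl⟩ := faceMk_surjective Q b
  rw [← map_mul, faceMk_eq_one_iff hQ] at h
  exact (faceMk_eq_one_iff hQ).2 (hQ _ _ h)

lemma faceQuotient_isFs (hP : IsFsMonoid P) : IsFsMonoid (FaceQuotient Q) where
  fg := by
    have := hP.fg
    exact Monoid.fg_of_surjective (faceMk Q) (faceMk_surjective Q)
  cancel := by
    have : IsLeftCancelMul (FaceQuotient Q) := ⟨fun a b c h => by
      obtain ⟨a, rfl⟩ := faceMk_surjective Q a
      obtain ⟨b, rfl⟩ := faceMk_surjective Q b
      obtain ⟨c, rfl⟩ := faceMk_surjective Q c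
      simp only [← map_mul, faceMk_eq_iff] at h ⊢
      obtain ⟨q, hq, q', hq', e⟩ := h
      exact ⟨q, hq, q', hq', mul_left_cancel (a := a) (by
        rw [mul_left_comm, e, mul_left_comm])⟩⟩
    exact CommMagma.IsLeftCancelMul.toIsCancelMul _
  saturated a b n hn := by
    rintro ⟨c, h⟩
    obtain ⟨a, rfl⟩ := faceMk_surjective Q a
    obtain ⟨b, rfl⟩ := faceMk_surjective Q b
    obtain ⟨c, rfl⟩ := faceMk_surjective Q c
    simp only [← map_mul, ← map_pow, faceMk_eq_iff] at h
    obtain ⟨q, hq, q', hq', e⟩ := h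
    obtain ⟨d, hd⟩ := hP.saturated (q * a) b n hn ⟨q' * q ^ (n - 1) * c, by
      rw [mul_pow, ← Nat.sub_add_cancel hn, pow_succ q, Nat.sub_add_cancel hn, mul_assoc, e]
      ac_rfl⟩
    exact ⟨faceMk Q d, by
      rw [← map_mul, faceMk_eq_iff]
      exact ⟨q, hq, 1, Q.one_mem, by rw [hd, one_mul]⟩⟩

end Face

/-! ### Homomorphisms from fs monoids -/

section Characters

variable {S : Type u} [CommMonoid S]

lemma IsFsMonoid.eq_of_pow_eq (hS : IsFsMonoid S) (hsharp : ∀ a b : S, a * b = 1 → a = 1)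
    {a b : S} {n : ℕ} (hn : 0 < n) (h : a ^ n = b ^ n) : a = b := by
  have := hS.cancel
  obtain ⟨c, rfl⟩ := hS.saturated a b n hn ⟨1, by rw [h, mul_one]⟩
  rw [mul_pow] at h
  have hc : c ^ n = 1 := mul_left_cancel (a := b ^ n) (h.trans (mul_one _).symm)
  have : c * c ^ (n - 1) = 1 := by rw [← pow_succ', Nat.sub_add_cancel hn, hc]
  rw [hsharp c _ this, mul_one]

open Algebra in
/-- A sharp fs monoid that is not trivial has a homomorphism to `ℤ` with an odd value: its group
completion is free of positive rank. -/
lemma IsFsMonoid.exists_odd (hS : IsFsMonoid S) (hsharp : ∀ a b : S, a * b = 1 → a = 1)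
    {t : S} (ht : t ≠ 1) : ∃ (χ : S →* Multiplicative ℤ) (s : S), Odd (χ s).toAdd := by
  have := hS.cancel
  have := hS.fg
  let G := GrothendieckGroup S
  have hinj : Function.Injective (GrothendieckGroup.of : S →* G) := by
    intro a b h
    obtain ⟨c, hc⟩ := (Localization.monoidOf (⊤ : Submonoid S)).eq_iff_exists.1 h
    exact mul_left_cancel hc
  have hfrac (g : G) : ∃ a b : S, g * GrothendieckGroup.of b = GrothendieckGroup.of a := by
    obtain ⟨⟨a, b⟩, h⟩ := (Localization.monoidOf (⊤ : Submonoid S)).surj g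
    exact ⟨a, b, h⟩
  have htf : IsMulTorsionFree G := by
    refine ⟨fun n hn g g' h => ?_⟩
    obtain ⟨a, b, hab⟩ := hfrac g
    obtain ⟨a', b', hab'⟩ := hfrac g'
    have key : a * b' = a' * b := by
      refine hS.eq_of_pow_eq hsharp (Nat.pos_of_ne_zero hn) (hinj ?_)
      rw [map_pow, map_pow, map_mul, map_mul, ← hab, ← hab', mul_pow, mul_pow, mul_pow, mul_pow]
      rw [show g ^ n = g' ^ n from h]
      ac_rfl
    have := congrArg (GrothendieckGroup.of : S →* G) key
    rw [map_mul, map_mul, ← hab, ← hab'] at this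
    refine mul_right_cancel (b := GrothendieckGroup.of b * GrothendieckGroup.of b') ?_
    rw [← mul_assoc, this]
    ac_rfl
  have : Group.FG G := Group.fg_iff_monoid_fg.2 inferInstance
  have : Module.Finite ℤ (Additive G) := Module.Finite.iff_addGroup_fg.2 inferInstance
  have : Module.Free ℤ (Additive G) := Module.free_of_finite_type_torsion_free'
  let B := Module.Free.chooseBasis ℤ (Additive G)
  have hne : Additive.ofMul (GrothendieckGroup.of t : G) ≠ 0 := fun h =>
    ht (hinj ((Additive.ofMul.injective h).trans (map_one _).symm))
  obtain ⟨i, -⟩ : ∃ i, B.repr (Additive.ofMul (GrothendieckGroup.of t : G)) i ≠ 0 := by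
    by_contra! hc
    exact hne (B.repr.injective (Finsupp.ext fun i => by rw [hc]; simp))
  let χ : G →* Multiplicative ℤ := (B.coord i).toAddMonoidHom.toMultiplicativeRight
  obtain ⟨a, b, hab⟩ := hfrac (B i).toMul
  have h1 : (χ (B i).toMul).toAdd = 1 := by
    change B.coord i (B i) = 1
    simp
  have h2 : 1 + (χ (GrothendieckGroup.of b)).toAdd = (χ (GrothendieckGroup.of a)).toAdd := by
    rw [← hab, map_mul, toAdd_mul, h1]
  by_cases hb : Odd (χ (GrothendieckGroup.of b)).toAdd
  · exact ⟨χ.comp GrothendieckGroup.of, b, hb⟩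
  · exact ⟨χ.comp GrothendieckGroup.of, a, by
      change Odd (χ (GrothendieckGroup.of a)).toAdd
      rw [← h2, add_comm]
      exact (Int.not_odd_iff_even.1 hb).add_one⟩

open Algebra in
/-- Homomorphisms to the divisible group of units of an algebraically closed field extend along
inclusions of cancellative monoids. -/
lemma exists_extend_units {P : Type u} [CommMonoid P] [IsCancelMul P] (Q : Submonoid P)
    (κ : Type u) [Field κ] [IsAlgClosed κ] (ε : Q →* κˣ) :
    ∃ θ : P →* κˣ, ∀ q : Q, θ q = ε q := by
  let i : GrothendieckGroup Q →* GrothendieckGroup P :=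
    GrothendieckGroup.lift (GrothendieckGroup.of.comp Q.subtype)
  have hi (q : Q) : i (GrothendieckGroup.of q) = GrothendieckGroup.of (q : P) := by
    exact (Localization.monoidOf (⊤ : Submonoid Q)).lift_eq _ _
  have hinj : Function.Injective i := by
    rw [injective_iff_map_eq_one]
    intro g hg
    obtain ⟨⟨a, b⟩, h⟩ := (Localization.monoidOf (⊤ : Submonoid Q)).surj g
    have h' : g * GrothendieckGroup.of (b : Q) = GrothendieckGroup.of a := h
    have := congrArg i h'
    rw [map_mul, hg, one_mul, hi, hi] at this
    obtain ⟨c, hc⟩ := (Localization.monoidOf (⊤ : Submonoid P)).eq_iff_exists.1 this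
    have hab : (b : Q) = a := Subtype.ext (mul_left_cancel hc)
    rw [hab] at h'
    exact mul_right_cancel (h'.trans (one_mul _).symm)
  have hroot {n : ℕ} (hn : n ≠ 0) : Function.Surjective fun a : κˣ => a ^ n := fun a => by
    obtain ⟨z, hz⟩ := IsAlgClosed.exists_pow_nat_eq (a : κ) (Nat.pos_of_ne_zero hn)
    have hz0 : z ≠ 0 := by
      rintro rfl
      rw [zero_pow hn] at hz
      exact a.ne_zero hz.symm
    exact ⟨Units.mk0 z hz0, Units.ext hz⟩
  let : RootableBy κˣ ℕ := rootableByOfPowLeftSurj _ _ hroot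
  let : RootableBy κˣ ℤ := Group.rootableByIntOfRootableByNat _
  let : DivisibleBy (Additive κˣ) ℤ :=
    { div a n := Additive.ofMul (RootableBy.root a.toMul n)
      div_zero a := RootableBy.root_zero (A := κˣ) (α := ℤ) _
      div_cancel {n} a h := RootableBy.root_cancel (A := κˣ) (α := ℤ) a.toMul h }
  let j : AddCommGrpCat.of (Additive (GrothendieckGroup Q)) ⟶
      AddCommGrpCat.of (Additive (GrothendieckGroup P)) := AddCommGrpCat.ofHom i.toAdditive
  have : Mono j := (AddCommGrpCat.mono_iff_injective _).2 hinj
  let e : AddCommGrpCat.of (Additive (GrothendieckGroup Q)) ⟶ AddCommGrpCat.of (Additive κˣ) :=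
    AddCommGrpCat.ofHom (GrothendieckGroup.lift ε).toAdditive
  have hinjective : Injective (AddCommGrpCat.of (Additive κˣ)) :=
    AddCommGrpCat.injective_of_divisible _
  let f := Injective.factorThru e j
  have hf : j ≫ f = e := Injective.comp_factorThru e j
  refine ⟨(AddMonoidHom.toMultiplicative f.hom).comp GrothendieckGroup.of, fun q => ?_⟩
  have := congrArg (fun t => t.hom (Additive.ofMul (GrothendieckGroup.of q))) hf
  change f.hom (Additive.ofMul (i (GrothendieckGroup.of q))) =
    Additive.ofMul (GrothendieckGroup.lift ε (GrothendieckGroup.of q)) at this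
  rw [hi] at this
  refine (congrArg Additive.toMul this).trans ?_
  exact (Localization.monoidOf (⊤ : Submonoid Q)).lift_eq (g := ε) (fun _ => Group.isUnit _) q

end Characters

/-! ### Log structures on the spectrum of an algebraically closed field -/

/-- A scheme as an étale scheme over itself. -/
def etTop (Y : Scheme.{u}) : Y.Etale := MorphismProperty.Over.mk (P := etProp) ⊤ (𝟙 Y)
  (etProp.id_mem _)

lemma etTop_hom_ext {Y : Scheme.{u}} {V : Y.Etale} (a b : V ⟶ etTop Y) : a = b :=
  et_ext (((Category.comp_id _).symm.trans (et_w a)).trans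
    ((Category.comp_id _).symm.trans (et_w b)).symm)

section GeometricPoint

variable (κ : Type u) [Field κ]

/-- The spectrum of a field. -/
noncomputable abbrev SpecField : Scheme.{u} := Spec (.of κ)

variable {κ}

section

variable [IsAlgClosed κ]

lemma exists_etTop_hom (V : (SpecField κ).Etale) (x : V.left) :
    ∃ (r : etTop _ ⟶ V) (w : (etTop (SpecField κ)).left), r.left w = x := by
  have : Etale V.hom := V.prop
  obtain ⟨l, hl, hx⟩ := Scheme.exists_fac_of_etale_of_isSepClosed V.hom (𝟙 (SpecField κ)) x
    (Subsingleton.elim (α := SpecField κ) _ _)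
  exact ⟨etHom l hl, (default : SpecField κ), hx⟩

namespace LogStructure

variable {J : LogStructure (SpecField κ)}

/-- Over an algebraically closed field, a section of a log structure over an étale scheme is
determined by its values at the rational points. -/
lemma sec_ext_of_points {V : (SpecField κ).Etale} {m m' : J.Sec V}
    (h : ∀ r : etTop _ ⟶ V, J.res r m = J.res r m') : m = m' :=
  sec_ext fun x => by
    obtain ⟨r, w, hw⟩ := exists_etTop_hom V x
    exact ⟨etTop _, r, w, hw, h r⟩

/-- Over an algebraically closed field, there are no conditions on the values of a section of a log
structure at the rational points. -/
lemma exists_sec_of_points {V : (SpecField κ).Etale} (n : (etTop _ ⟶ V) → J.Sec (etTop _)) :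
    ∃ m : J.Sec V, ∀ r, J.res r m = n r := by
  refine exists_glue (fun r : etTop _ ⟶ V => r) (exists_etTop_hom V) n fun r r' Z a b h => ?_
  refine sec_ext_of_points fun c => ?_
  have h1 : r = r' := by
    have := congrArg (c ≫ ·) h
    simp only [← Category.assoc] at this
    rwa [etTop_hom_ext (c ≫ a) (𝟙 _), etTop_hom_ext (c ≫ b) (𝟙 _), Category.id_comp,
      Category.id_comp] at this
  subst h1
  rw [etTop_hom_ext a b]

end LogStructure

/-- Over an algebraically closed field, a function on an étale scheme is determined by its values
at the rational points. -/
lemma fun_ext_of_points {V : (SpecField κ).Etale} {f g : Γ(V.left, ⊤)}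
    (h : ∀ r : etTop _ ⟶ V, r.left.appTop.hom f = r.left.appTop.hom g) : f = g := by
  have hs : Presieve.IsSheafFor (etSections (SpecField κ))
      (Presieve.ofArrows (fun _ : etTop _ ⟶ V => etTop _) fun r => r) := by
    rw [Presieve.isSheafFor_iff_generate]
    refine isSheaf_etSections _ _
      ((Scheme.ofArrows_mem_smallEtaleTopology_iff _).2 ?_)
    refine Set.eq_univ_of_forall fun x => Set.mem_iUnion.2 ?_
    obtain ⟨i, v, hv⟩ := exists_etTop_hom V x
    exact ⟨i, v, hv⟩
  refine hs.isSeparatedFor.ext ?_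
  rintro _ _ ⟨i⟩
  exact h i

end

variable {X : Scheme.{u}} {L : LogStructure X} {J : LogStructure (SpecField κ)}
  {x : SpecField κ ⟶ X}

variable (L J x) in
/-- The data of a morphism of log schemes from the spectrum of an algebraically closed field: the
values of sections at the geometric point. -/
structure PointVal where
  val : ∀ {W : X.Etale} (w : (etTop (SpecField κ)).left ⟶ W.left),
    w ≫ W.hom = (etTop (SpecField κ)).hom ≫ x → L.Sec W →* J.Sec (etTop (SpecField κ))
  val_res : ∀ {W W' : X.Etale} (r : W' ⟶ W) (w' : (etTop (SpecField κ)).left ⟶ W'.left)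
    (hw' : w' ≫ W'.hom = (etTop (SpecField κ)).hom ≫ x)
    (hw : (w' ≫ r.left) ≫ W.hom = (etTop (SpecField κ)).hom ≫ x) (m : L.Sec W),
    val w' hw' (L.res r m) = val (w' ≫ r.left) hw m
  α_val : ∀ {W : X.Etale} (w : (etTop (SpecField κ)).left ⟶ W.left)
    (hw : w ≫ W.hom = (etTop (SpecField κ)).hom ≫ x) (m : L.Sec W),
    J.α _ (val w hw m) = w.appTop.hom (L.α W m)

namespace PointVal

variable (v : PointVal L J x)

lemma val_congr {W : X.Etale} {w w' : (etTop (SpecField κ)).left ⟶ W.left} (e : w = w')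
    (hw : w ≫ W.hom = (etTop (SpecField κ)).hom ≫ x)
    (hw' : w' ≫ W.hom = (etTop (SpecField κ)).hom ≫ x) (m : L.Sec W) :
    v.val w hw m = v.val w' hw' m := by
  subst e; rfl

lemma w_aux {V : (SpecField κ).Etale} {W : X.Etale} {h : V.left ⟶ W.left}
    (w : h ≫ W.hom = V.hom ≫ x) (r : etTop _ ⟶ V) :
    (r.left ≫ h) ≫ W.hom = (etTop (SpecField κ)).hom ≫ x := by
  rw [Category.assoc, w, ← Category.assoc, et_w]

variable [IsAlgClosed κ]

/-- The section over `V` whose value at each rational point `r` of `V` is the value of `m` at the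
image of `r` in `W`. -/
noncomputable def comapFun {V : (SpecField κ).Etale} {W : X.Etale} (h : V.left ⟶ W.left)
    (w : h ≫ W.hom = V.hom ≫ x) (m : L.Sec W) : J.Sec V :=
  (LogStructure.exists_sec_of_points fun r => v.val (r.left ≫ h) (w_aux w r) m).choose

lemma res_comapFun {V : (SpecField κ).Etale} {W : X.Etale} (h : V.left ⟶ W.left)
    (w : h ≫ W.hom = V.hom ≫ x) (m : L.Sec W) (r : etTop _ ⟶ V) :
    J.res r (v.comapFun h w m) = v.val (r.left ≫ h) (w_aux w r) m :=
  (LogStructure.exists_sec_of_points fun r => v.val (r.left ≫ h) (w_aux w r) m).choose_spec r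

/-- The morphism of log schemes with the given values. -/
noncomputable def toLogHom : LogHom J L where
  base := x
  comap h w :=
    { toFun := v.comapFun h w
      map_one' := LogStructure.sec_ext_of_points fun r => by
        rw [res_comapFun, map_one, map_one]
      map_mul' m m' := LogStructure.sec_ext_of_points fun r => by
        rw [res_comapFun, map_mul, map_mul, res_comapFun, res_comapFun] }
  res_comap {V V' W} r h w w' n := LogStructure.sec_ext_of_points fun t => by
    refine (J.res_res _ _ _).trans ?_
    refine (v.res_comapFun h w n _).trans (Eq.trans ?_ (v.res_comapFun (r.left ≫ h) w' n t).symm)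
    exact v.val_congr (Category.assoc _ _ _) _ _ _
  comap_res {V W W'} h s w w' n := LogStructure.sec_ext_of_points fun t => by
    refine (v.res_comapFun h w _ _).trans (Eq.trans ?_ (v.res_comapFun (h ≫ s.left) w' n t).symm)
    exact (v.val_res s _ _ (by rw [Category.assoc, et_w, w_aux w t]) n).trans
      (v.val_congr (Category.assoc _ _ _) _ _ _)
  α_comap {V W} h w n := by
    refine fun_ext_of_points fun r => ?_
    refine (J.α_res r _).symm.trans ?_
    refine (congrArg (J.α _) (v.res_comapFun h w n r)).trans ((v.α_val _ _ _).trans ?_)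
    rw [Scheme.Hom.comp_appTop]
    rfl

lemma toLogHom_comap {W : X.Etale} (h : (etTop (SpecField κ)).left ⟶ W.left)
    (w : h ≫ W.hom = (etTop (SpecField κ)).hom ≫ x) (n : L.Sec W) :
    v.toLogHom.comap h w n = v.val h w n := by
  have := v.res_comapFun h w n (𝟙 _)
  rw [LogStructure.res_id] at this
  exact this.trans (v.val_congr (Category.id_comp _) _ _ _)

/-- Strictness can be checked on values at the geometric point. -/
lemma toLogHom_isStrict
    (hsurj : ∀ m : J.Sec (etTop _), ∃ (W : X.Etale) (w : (etTop (SpecField κ)).left ⟶ W.left)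
      (hw : w ≫ W.hom = (etTop (SpecField κ)).hom ≫ x) (n : L.Sec W) (c : (J.Sec (etTop _))ˣ),
      m = c * v.val w hw n)
    (hinj : ∀ (W : X.Etale) (w : (etTop (SpecField κ)).left ⟶ W.left)
      (hw : w ≫ W.hom = (etTop (SpecField κ)).hom ≫ x) (n n' : L.Sec W)
      (c d : (J.Sec (etTop _))ˣ), c * v.val w hw n = d * v.val w hw n' →
      ∃ (W' : X.Etale) (t : W' ⟶ W) (w' : (etTop (SpecField κ)).left ⟶ W'.left)
        (hw' : w' ≫ W'.hom = (etTop (SpecField κ)).hom ≫ x) (a b : (L.Sec W')ˣ),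
        w' ≫ t.left = w ∧ a * L.res t n = b * L.res t n' ∧
        v.val w' hw' b * c = v.val w' hw' a * d) : v.toLogHom.IsStrict where
  surj V m y := by
    obtain ⟨r, z, hz⟩ := exists_etTop_hom V y
    obtain ⟨W, w, hw, n, c, h⟩ := hsurj (J.res r m)
    exact ⟨etTop _, r, z, W, w, hw, n, c, hz, by rw [toLogHom_comap, h]⟩
  inj V W h hw n n' c d e y := by
    obtain ⟨r, z, hz⟩ := exists_etTop_hom V y
    have key (n : L.Sec W) : J.res r (v.toLogHom.comap h hw n) =
        v.val (r.left ≫ h) (w_aux hw r) n := v.res_comapFun h hw n r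
    obtain ⟨W', t, w', hw', a, b, ht, hab, hcd⟩ := hinj W (r.left ≫ h) (w_aux hw r) n n'
      (Units.map (J.res r) c) (Units.map (J.res r) d) (by
        rw [← key, ← key, Units.coe_map, Units.coe_map]
        exact (map_mul (J.res r) _ _).symm.trans
          ((congrArg (J.res r) e).trans (map_mul (J.res r) _ _)))
    refine ⟨etTop _, r, z, W', t, w', hw', a, b, hz, ht, hab, ?_⟩
    rw [toLogHom_comap, toLogHom_comap]
    exact hcd

end PointVal

end GeometricPoint

/-! ### Geometric points of log schemes -/

section ChartPoint

variable {κ : Type u} [Field κ] {X : Scheme.{u}}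

/-- Functions on the spectrum of a field are zero or invertible. -/
lemma eq_zero_or_isUnit_etTop (f : Γ((etTop (SpecField κ)).left, ⊤)) : f = 0 ∨ IsUnit f := by
  let e := (Scheme.ΓSpecIso (.of κ)).commRingCatIsoToRingEquiv
  by_cases h : e f = 0
  · exact .inl (e.injective (h.trans (map_zero e).symm))
  · exact .inr ((MulEquiv.isUnit_map e).1 (IsUnit.mk0 (G₀ := κ) _ h))

/-- A geometric point lifts to the étale neighbourhoods of its image. -/
lemma exists_lift_etTop [IsAlgClosed κ] {W' W : X.Etale} (r : W' ⟶ W)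
    (w : (etTop (SpecField κ)).left ⟶ W.left) (z : (etTop (SpecField κ)).left)
    (y : W'.left) (hy : r.left y = w z) :
    ∃ w' : (etTop (SpecField κ)).left ⟶ W'.left, w' ≫ r.left = w := by
  obtain ⟨l, hl, -⟩ := Scheme.exists_fac_of_etale_of_isSepClosed r.left
    (w : SpecField κ ⟶ W.left) y (hy.trans (congrArg w (Subsingleton.elim (α := SpecField κ) _ _)))
  exact ⟨l, hl⟩

/-- The étale neighbourhoods of a geometric point are cofiltered. -/
lemma exists_etale_bowtie {x : SpecField κ ⟶ X} {W₁ W₂ W V : X.Etale} (s₁ : W₁ ⟶ W)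
    (s₂ : W₂ ⟶ W) (t₁ : W₁ ⟶ V) (t₂ : W₂ ⟶ V)
    (w₁ : (etTop (SpecField κ)).left ⟶ W₁.left) (w₂ : (etTop (SpecField κ)).left ⟶ W₂.left)
    (hx : w₁ ≫ W₁.hom = (etTop (SpecField κ)).hom ≫ x)
    (hs : w₁ ≫ s₁.left = w₂ ≫ s₂.left) (ht : w₁ ≫ t₁.left = w₂ ≫ t₂.left) :
    ∃ (W₃ : X.Etale) (r₁ : W₃ ⟶ W₁) (r₂ : W₃ ⟶ W₂)
      (w₃ : (etTop (SpecField κ)).left ⟶ W₃.left), w₃ ≫ r₁.left = w₁ ∧ w₃ ≫ r₂.left = w₂ ∧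
      r₁ ≫ s₁ = r₂ ≫ s₂ ∧ r₁ ≫ t₁ = r₂ ≫ t₂ := by
  have hx₁ : (w₁ : SpecField κ ⟶ W₁.left) ≫ W₁.hom = x := hx.trans (Category.id_comp _)
  have hx₂ : (w₂ : SpecField κ ⟶ W₂.left) ≫ W₂.hom = x := by
    rw [← hx₁, ← et_w s₂, ← et_w s₁, ← Category.assoc, ← Category.assoc, hs]
  let F := Scheme.Etale.forget X ⋙ coyoneda.obj (op (Over.mk x))
  let e (A : X.Etale) (a : (etTop (SpecField κ)).left ⟶ A.left)
    (ha : (a : SpecField κ ⟶ A.left) ≫ A.hom = x) : F.Elements :=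
    Functor.elementsMk F A (Over.homMk a ha)
  let hom {A B : X.Etale} (r : A ⟶ B) (a : (etTop (SpecField κ)).left ⟶ A.left)
    (ha : (a : SpecField κ ⟶ A.left) ≫ A.hom = x) (b : (etTop (SpecField κ)).left ⟶ B.left)
    (hb : (b : SpecField κ ⟶ B.left) ≫ B.hom = x) (h : a ≫ r.left = b) : e A a ha ⟶ e B b hb :=
    ⟨r, Over.OverMorphism.ext h⟩
  have hw : (w₁ ≫ s₁.left : SpecField κ ⟶ W.left) ≫ W.hom = x :=
    (Category.assoc _ _ _).trans ((congrArg (w₁ ≫ ·) (et_w s₁)).trans hx₁)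
  have hv : (w₁ ≫ t₁.left : SpecField κ ⟶ V.left) ≫ V.hom = x :=
    (Category.assoc _ _ _).trans ((congrArg (w₁ ≫ ·) (et_w t₁)).trans hx₁)
  obtain ⟨c, a, b, h₁, h₂⟩ := IsCofiltered.bowtie
    (hom s₁ w₁ hx₁ _ hw rfl) (hom s₂ w₂ hx₂ _ hw hs.symm)
    (hom t₁ w₁ hx₁ _ hv rfl) (hom t₂ w₂ hx₂ _ hv ht.symm)
  exact ⟨c.1, a.1, b.1, c.2.left, congrArg (fun t => t.left) a.2, congrArg (fun t => t.left) b.2,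
    congrArg (fun t => t.1) h₁, congrArg (fun t => t.1) h₂⟩

variable (κ) (L : LogStructure X) (S : Type u) [CommMonoid S]

/-- A geometric point `x` with a chart by a monoid `P` near it, and a description of the log
structure pulled back to the point: `Q` being the face of the elements of `P` that do not vanish at
`x`, the quotient `ρ : P → S` of `P` by `Q`, and an extension `θ` to `P` of the homomorphism from
`Q` to the invertible functions at the point. -/
structure ChartPoint where
  x : SpecField κ ⟶ X
  U : X.Etale
  y : (etTop (SpecField κ)).left ⟶ U.left
  hy : y ≫ U.hom = (etTop (SpecField κ)).hom ≫ x
  P : Type u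
  [commMonoid : CommMonoid P]
  β : P →* L.Sec U
  isChart : L.IsChart U β
  ρ : P →* S
  ρ_surjective : Function.Surjective ρ
  ρ_eq_one_iff (p : P) : ρ p = 1 ↔ IsUnit (y.appTop.hom (L.α U (β p)))
  exists_of_ρ_eq (p p' : P) : ρ p = ρ p' → ∃ q q', ρ q = 1 ∧ ρ q' = 1 ∧ q * p = q' * p'
  θ : P →* Γ((etTop (SpecField κ)).left, ⊤)ˣ
  θ_eq (p : P) : ρ p = 1 → (θ p : Γ((etTop (SpecField κ)).left, ⊤)) = y.appTop.hom (L.α U (β p))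

attribute [instance] ChartPoint.commMonoid

/-- The denominator-free form of the comparison of `b * c` and `a * c'` in `pointVal_isStrict`. -/
lemma mul_eq_mul_of_fractions {R : Type*} [CommRing R] {a b c c' d d' p p' q q' : R}
    (hA : a * d = q) (hB : b * d' = q') (H : c * (d * p) = c' * (d' * p'))
    (K : q * p = q' * p') : d * d' * q * p * (b * c) = d * d' * q * p * (a * c') := by
  linear_combination d * q * p * c * hB + q * q' * H - c' * d' * q * K - c' * d' * q * p * hA

lemma ConstSec.α_units {S : Type u} [CommMonoid S] [TopologicalSpace S] [DiscreteTopology S]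
    (hS : ∀ a b : S, a * b = 1 → a = 1) {V : Scheme.{u}} (c : (ConstSec S V)ˣ) :
    ConstSec.α hS V c = ((c : ConstSec S V).2 : Γ(V, ⊤)) := by
  rw [show (c : ConstSec S V) = (1, (c : ConstSec S V).2) from
    Prod.ext (ConstSec.isUnit_fst hS c) rfl, ConstSec.α_one_mk]

lemma mem_basicOpen_of_isUnit_appTop {A V : Scheme.{u}} (w : A ⟶ V) {f : Γ(V, ⊤)}
    (hu : IsUnit (w.appTop.hom f)) (z : A) : w z ∈ V.basicOpen f := by
  have h : z ∈ w ⁻¹ᵁ V.basicOpen f := by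
    rw [show w ⁻¹ᵁ V.basicOpen f = _ from Scheme.preimage_basicOpen_top w f,
      show A.basicOpen (w.appTop f) = ⊤ from Scheme.basicOpen_of_isUnit _ hu]
    trivial
  exact h

lemma isUnit_appTop_basicOpen {V : Scheme.{u}} (f : Γ(V, ⊤)) :
    IsUnit ((V.basicOpen f).ι.appTop.hom f) := by
  have h := (RingedSpace.isUnit_res_basicOpen V.toRingedSpace f).map
    (V.presheaf.map (homOfLE (V.basicOpen f).ι_image_top.le).op).hom
  rw [Scheme.Opens.ι_appTop]
  have e : (V.presheaf.map (homOfLE (x := (V.basicOpen f).ι ''ᵁ ⊤) le_top).op).hom f =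
      (V.presheaf.map (homOfLE (V.basicOpen f).ι_image_top.le).op).hom
        ((V.presheaf.map (homOfLE (V.basicOpen_le f)).op).hom f) := by
    rw [← CommRingCat.comp_apply, ← Functor.map_comp]
    rfl
  exact e ▸ h

namespace ChartPoint

variable {κ L S} (C : ChartPoint κ L S)

/-- The section `m` over a neighbourhood `w` of the geometric point has the value `(s, c)` in the
constant log structure: locally `m = d * β p` with `d` invertible, `s` is the class of `p`, and `c`
is the product of the value of `d` at the point with `θ p`. -/
def HasVal {W : X.Etale} (w : (etTop (SpecField κ)).left ⟶ W.left) (m : L.Sec W) (s : S)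
    (c : Γ((etTop (SpecField κ)).left, ⊤)ˣ) : Prop :=
  ∃ (W' : X.Etale) (r : W' ⟶ W) (t : W' ⟶ C.U) (w' : (etTop (SpecField κ)).left ⟶ W'.left)
    (p : C.P) (d : (L.Sec W')ˣ), w' ≫ r.left = w ∧ w' ≫ t.left = C.y ∧
    L.res r m = d * L.res t (C.β p) ∧ C.ρ p = s ∧
    (c : Γ((etTop (SpecField κ)).left, ⊤)) = w'.appTop.hom (L.α W' d) * C.θ p

lemma appTop_α_res {W W' : X.Etale} (r : W' ⟶ W) {w : (etTop (SpecField κ)).left ⟶ W.left}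
    {w' : (etTop (SpecField κ)).left ⟶ W'.left} (h : w' ≫ r.left = w) (m : L.Sec W) :
    w'.appTop.hom (L.α W' (L.res r m)) = w.appTop.hom (L.α W m) := by
  refine (congrArg w'.appTop.hom (L.α_res r m)).trans ?_
  rw [← h, Scheme.Hom.comp_appTop]
  rfl

variable {C} {W : X.Etale} {w : (etTop (SpecField κ)).left ⟶ W.left}

lemma HasVal.one (hw : w ≫ W.hom = (etTop (SpecField κ)).hom ≫ C.x) : C.HasVal w 1 1 1 := by
  have hwy : w ≫ W.hom = C.y ≫ C.U.hom := hw.trans C.hy.symm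
  refine ⟨etOf W (pullback.fst W.hom C.U.hom)
      (MorphismProperty.pullback_fst (P := etProp) _ _ C.U.prop), etHom (pullback.fst _ _) rfl,
    etHom (pullback.snd _ _) pullback.condition.symm, pullback.lift w C.y hwy, 1, 1,
    pullback.lift_fst _ _ _, pullback.lift_snd _ _ _, ?_, map_one _, ?_⟩
  · simp only [map_one, Units.val_one, one_mul]
  · simp only [map_one, Units.val_one, one_mul]

lemma HasVal.res {W' : X.Etale} {r : W' ⟶ W} {w' : (etTop (SpecField κ)).left ⟶ W'.left}
    (hw' : w' ≫ r.left = w) {m : L.Sec W} {s : S} {c} (h : C.HasVal w m s c) :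
    C.HasVal w' (L.res r m) s c := by
  obtain ⟨W₁, r₁, t₁, w₁, p, d, h₁, h₂, h₃, h₄, h₅⟩ := h
  have hx : w₁ ≫ W₁.hom = (etTop (SpecField κ)).hom ≫ C.x := by
    rw [← et_w t₁, ← Category.assoc, h₂, C.hy]
  obtain ⟨W₃, a, b, w₃, ha, hb, e, -⟩ := exists_etale_bowtie r₁ r r₁ r w₁ w' hx
    (h₁.trans hw'.symm) (h₁.trans hw'.symm)
  refine ⟨W₃, b, a ≫ t₁, w₃, p, Units.map (L.res a) d, hb, ?_, ?_, h₄, ?_⟩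
  · rw [← h₂, ← ha, Category.assoc]; rfl
  · rw [LogStructure.res_res, ← e, ← LogStructure.res_res, h₃, map_mul, LogStructure.res_res]
    rfl
  · rw [h₅, ← appTop_α_res a ha]; rfl

lemma HasVal.mul {m m' : L.Sec W} {s s' : S} {c c'} (h : C.HasVal w m s c)
    (h' : C.HasVal w m' s' c') : C.HasVal w (m * m') (s * s') (c * c') := by
  obtain ⟨W₁, r₁, t₁, w₁, p, d, h₁, h₂, h₃, h₄, h₅⟩ := h
  obtain ⟨W₁', r₁', t₁', w₁', p', d', h₁', h₂', h₃', h₄', h₅'⟩ := h'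
  have hx : w₁ ≫ W₁.hom = (etTop (SpecField κ)).hom ≫ C.x := by
    rw [← et_w t₁, ← Category.assoc, h₂, C.hy]
  obtain ⟨W₃, a, b, w₃, ha, hb, e, e'⟩ := exists_etale_bowtie r₁ r₁' t₁ t₁' w₁ w₁' hx
    (h₁.trans h₁'.symm) (h₂.trans h₂'.symm)
  refine ⟨W₃, a ≫ r₁, a ≫ t₁, w₃, p * p', Units.map (L.res a) d * Units.map (L.res b) d',
    ?_, ?_, ?_, by rw [map_mul, h₄, h₄'], ?_⟩
  · rw [← h₁, ← ha, Category.assoc]; rfl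
  · rw [← h₂, ← ha, Category.assoc]; rfl
  · have k₁ : L.res (a ≫ r₁) m = L.res a d * L.res (a ≫ t₁) (C.β p) := by
      rw [← LogStructure.res_res, h₃, map_mul, LogStructure.res_res]
    have k₂ : L.res (a ≫ r₁) m' = L.res b d' * L.res (a ≫ t₁) (C.β p') := by
      rw [e, e', ← LogStructure.res_res, h₃', map_mul, LogStructure.res_res]
    rw [map_mul, k₁, k₂, map_mul, map_mul, Units.val_mul, Units.coe_map, Units.coe_map]
    exact mul_mul_mul_comm _ _ _ _
  · rw [Units.val_mul, h₅, h₅', map_mul, Units.val_mul, Units.val_mul, map_mul, map_mul,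
      Units.coe_map, Units.coe_map]
    rw [← appTop_α_res a ha, ← appTop_α_res b hb]
    exact mul_mul_mul_comm _ _ _ _

/-- Every section has a value, since it factors through the chart near the point. -/
lemma exists_hasVal [IsAlgClosed κ] (hw : w ≫ W.hom = (etTop (SpecField κ)).hom ≫ C.x)
    (m : L.Sec W) : ∃ s c, C.HasVal w m s c := by
  obtain ⟨W₁, r₁, t₁, w₁, p, d, h₁, h₂, -, -, -⟩ := HasVal.one hw
  let z : (etTop (SpecField κ)).left := (default : SpecField κ)
  obtain ⟨W₂, r₂, y₂, q, e, hy₂, he⟩ := C.isChart.surj W₁ t₁ (L.res r₁ m) (w₁ z)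
  obtain ⟨w₂, hw₂⟩ := exists_lift_etTop r₂ w₁ z y₂ hy₂
  refine ⟨C.ρ q, Units.map w₂.appTop.hom.toMonoidHom (Units.map (L.α W₂) e) * C.θ q, W₂,
    r₂ ≫ r₁, r₂ ≫ t₁, w₂, q, e, ?_, ?_, ?_, rfl, rfl⟩
  · rw [← h₁, ← hw₂, Category.assoc]; rfl
  · rw [← h₂, ← hw₂, Category.assoc]; rfl
  · rw [← LogStructure.res_res, he]

/-- The value does not depend on the presentation `d * β p`: the relations between two presentations
come from the face of the chart that does not vanish at the point, where `θ` is the value. -/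
lemma HasVal.unique [IsAlgClosed κ] {m : L.Sec W} {s s' : S} {c c'} (h : C.HasVal w m s c)
    (h' : C.HasVal w m s' c') : s = s' ∧ c = c' := by
  obtain ⟨W₁, r₁, t₁, w₁, p, d, h₁, h₂, h₃, h₄, h₅⟩ := h
  obtain ⟨W₁', r₁', t₁', w₁', p', d', h₁', h₂', h₃', h₄', h₅'⟩ := h'
  have hx : w₁ ≫ W₁.hom = (etTop (SpecField κ)).hom ≫ C.x := by
    rw [← et_w t₁, ← Category.assoc, h₂, C.hy]
  obtain ⟨W₃, a, b, w₃, ha, hb, e, e'⟩ := exists_etale_bowtie r₁ r₁' t₁ t₁' w₁ w₁' hx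
    (h₁.trans h₁'.symm) (h₂.trans h₂'.symm)
  have k₁ : L.res (a ≫ r₁) m = Units.map (L.res a) d * L.res (a ≫ t₁) (C.β p) := by
    rw [← LogStructure.res_res, h₃, map_mul, LogStructure.res_res]; rfl
  have k₂ : L.res (a ≫ r₁) m = Units.map (L.res b) d' * L.res (a ≫ t₁) (C.β p') := by
    rw [e, e', ← LogStructure.res_res, h₃', map_mul, LogStructure.res_res]; rfl
  let z : (etTop (SpecField κ)).left := (default : SpecField κ)
  obtain ⟨W₄, r₄, y₄, f, g, hy₄, hf, hg, hfg, hfg'⟩ :=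
    C.isChart.inj W₃ (a ≫ t₁) p p' _ _ (k₁.symm.trans k₂) (w₃ z)
  obtain ⟨w₄, hw₄⟩ := exists_lift_etTop r₄ w₃ z y₄ hy₄
  have hw₄y : w₄ ≫ (r₄ ≫ a ≫ t₁).left = C.y := by
    rw [← h₂, ← ha, ← hw₄, Category.assoc, Category.assoc]; rfl
  have hval (q : C.P) : w₄.appTop.hom (L.α W₄ (L.res (r₄ ≫ a ≫ t₁) (C.β q))) =
      C.y.appTop.hom (L.α C.U (C.β q)) := appTop_α_res _ hw₄y _
  have hf₁ : C.ρ f = 1 := (C.ρ_eq_one_iff f).2 (by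
    rw [← hval]; exact (hf.map _).map _)
  have hg₁ : C.ρ g = 1 := (C.ρ_eq_one_iff g).2 (by
    rw [← hval]; exact (hg.map _).map _)
  have hρ : C.ρ p = C.ρ p' := by
    have := congrArg C.ρ hfg
    rwa [map_mul, map_mul, hf₁, hg₁, one_mul, one_mul] at this
  refine ⟨h₄.symm.trans (hρ.trans h₄'), Units.ext ?_⟩
  have E₁ : C.θ f * C.θ p = C.θ g * C.θ p' := by rw [← map_mul, hfg, map_mul]
  have E₂ := congrArg (fun n => w₄.appTop.hom (L.α W₄ n)) hfg'
  simp only [map_mul, Units.coe_map] at E₂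
  rw [hval, hval, ← C.θ_eq f hf₁, ← C.θ_eq g hg₁] at E₂
  have E₃ : w₄.appTop.hom (L.α W₄ (L.res r₄ (L.res a d))) = w₁.appTop.hom (L.α W₁ d) := by
    rw [appTop_α_res r₄ hw₄, appTop_α_res a ha]
  have E₄ : w₄.appTop.hom (L.α W₄ (L.res r₄ (L.res b d'))) = w₁'.appTop.hom (L.α W₁' d') := by
    rw [appTop_α_res r₄ hw₄, appTop_α_res b hb]
  have E₅ : (C.θ g : Γ((etTop (SpecField κ)).left, ⊤)) * w₁.appTop.hom (L.α W₁ d) =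
      C.θ f * w₁'.appTop.hom (L.α W₁' d') := by
    rw [← E₃, ← E₄]; exact E₂
  have E₁' : (C.θ f : Γ((etTop (SpecField κ)).left, ⊤)) * C.θ p = C.θ g * C.θ p' :=
    congrArg Units.val E₁
  rw [h₅, h₅']
  refine (C.θ f).isUnit.mul_left_cancel ((C.θ g).isUnit.mul_left_cancel ?_)
  linear_combination (C.θ f * C.θ p : Γ((etTop (SpecField κ)).left, ⊤)) * E₅ +
    (C.θ f * w₁'.appTop.hom (L.α W₁' d') : Γ((etTop (SpecField κ)).left, ⊤)) * E₁'

lemma HasVal.α_eq [TopologicalSpace S] [DiscreteTopology S] (hS : ∀ a b : S, a * b = 1 → a = 1)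
    {m : L.Sec W} {s : S} {c : Γ((etTop (SpecField κ)).left, ⊤)ˣ} (h : C.HasVal w m s c) :
    ConstSec.α hS _ (ContinuousMap.const _ s, c) = w.appTop.hom (L.α W m) := by
  obtain ⟨W', r, t, w', p, d, h₁, h₂, h₃, h₄, h₅⟩ := h
  rw [ConstSec.α_apply, glueFn_const, ← appTop_α_res r h₁, h₃, map_mul, map_mul,
    appTop_α_res t h₂, h₅]
  by_cases hp : C.ρ p = 1
  · rw [← h₄, hp, ConstSec.ind_one, one_mul, C.θ_eq p hp]
  · rw [← h₄, ConstSec.ind_of_ne hp, zero_mul,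
      (eq_zero_or_isUnit_etTop _).resolve_right fun h => hp ((C.ρ_eq_one_iff p).2 h)]
    exact (mul_zero _).symm

variable (C)

lemma hasVal_β (p : C.P) : C.HasVal C.y (C.β p) (C.ρ p) (C.θ p) :=
  ⟨C.U, 𝟙 _, 𝟙 _, C.y, p, 1, Category.comp_id _, Category.comp_id _, by
    rw [Units.val_one, one_mul], rfl, by rw [Units.val_one, map_one, map_one, one_mul]⟩

variable [IsAlgClosed κ]

/-- After shrinking the neighbourhood, an element of the chart that does not vanish at the
geometric point is invertible. -/
lemma exists_isUnit {W : X.Etale} (t : W ⟶ C.U) (w : (etTop (SpecField κ)).left ⟶ W.left)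
    (hw : w ≫ t.left = C.y) {q : C.P} (hq : C.ρ q = 1) :
    ∃ (W' : X.Etale) (r : W' ⟶ W) (w' : (etTop (SpecField κ)).left ⟶ W'.left),
      w' ≫ r.left = w ∧ IsUnit (L.res (r ≫ t) (C.β q)) := by
  let z : (etTop (SpecField κ)).left := (default : SpecField κ)
  let f : Γ(W.left, ⊤) := L.α W (L.res t (C.β q))
  let D : W.left.Opens := W.left.basicOpen f
  have hz : w z ∈ D := by
    have hu : IsUnit (w.appTop.hom f) := by
      have := (C.ρ_eq_one_iff q).1 hq
      rwa [← appTop_α_res t hw] at this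
    exact mem_basicOpen_of_isUnit_appTop w hu z
  let W' : X.Etale := etOf W D.ι inferInstance
  let r : W' ⟶ W := etHom D.ι rfl
  obtain ⟨w', hw'⟩ := exists_lift_etTop r w z ⟨w z, hz⟩ rfl
  refine ⟨W', r, w', hw', L.isUnit_of_isUnit_α ?_⟩
  rw [← LogStructure.res_res]
  refine (L.α_res r _).symm ▸ isUnit_appTop_basicOpen f

variable [TopologicalSpace S] [DiscreteTopology S] (hS : ∀ a b : S, a * b = 1 → a = 1)

/-- The values of the sections of the log structure at a geometric point. -/
noncomputable def pointVal : PointVal L (constLog hS (SpecField κ)) C.x where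
  val {W} w hw :=
    { toFun m := ((ContinuousMap.const _ (exists_hasVal hw m).choose,
        (exists_hasVal hw m).choose_spec.choose) : ConstSec S (etTop (SpecField κ)).left)
      map_one' := by
        obtain ⟨h₁, h₂⟩ := (exists_hasVal hw 1).choose_spec.choose_spec.unique (HasVal.one hw)
        rw [h₂]
        exact congrArg (fun s => ((ContinuousMap.const _ s, 1) :
          ConstSec S (etTop (SpecField κ)).left)) h₁
      map_mul' m m' := by
        obtain ⟨h₁, h₂⟩ := (exists_hasVal hw (m * m')).choose_spec.choose_spec.unique
          ((exists_hasVal hw m).choose_spec.choose_spec.mul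
            (exists_hasVal hw m').choose_spec.choose_spec)
        rw [h₂]
        exact congrArg (fun s => ((ContinuousMap.const _ s, _) :
          ConstSec S (etTop (SpecField κ)).left)) h₁ }
  val_res {W W'} r w' hw' hw m := by
    obtain ⟨h₁, h₂⟩ := (exists_hasVal hw' (L.res r m)).choose_spec.choose_spec.unique
      ((exists_hasVal hw m).choose_spec.choose_spec.res rfl)
    refine Prod.ext ?_ h₂
    exact congrArg (fun s => ContinuousMap.const (etTop (SpecField κ)).left s) h₁
  α_val {W} w hw m := (exists_hasVal hw m).choose_spec.choose_spec.α_eq hS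

lemma pointVal_val (hw : w ≫ W.hom = (etTop (SpecField κ)).hom ≫ C.x) {m : L.Sec W} {s : S}
    {c : Γ((etTop (SpecField κ)).left, ⊤)ˣ} (h : C.HasVal w m s c) :
    (C.pointVal hS).val w hw m =
      ((ContinuousMap.const _ s, c) : ConstSec S (etTop (SpecField κ)).left) := by
  obtain ⟨h₁, h₂⟩ := (exists_hasVal hw m).choose_spec.choose_spec.unique h
  refine Prod.ext ?_ h₂
  exact congrArg (fun s => ContinuousMap.const (etTop (SpecField κ)).left s) h₁

/-- The constant log structure is the pullback of the log structure of `X` to the geometric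
point. -/
lemma pointVal_isStrict : (C.pointVal hS).toLogHom.IsStrict := by
  refine (C.pointVal hS).toLogHom_isStrict ?_ ?_
  · rintro ⟨g, u⟩
    obtain ⟨p, hp⟩ := C.ρ_surjective (g (default : SpecField κ))
    refine ⟨C.U, C.y, C.hy, C.β p, ConstSec.unitMk (u * (C.θ p)⁻¹), ?_⟩
    rw [C.pointVal_val hS C.hy (C.hasVal_β p)]
    refine Prod.ext (ContinuousMap.ext fun z => ?_) ?_
    · have hz : z = (default : SpecField κ) := Subsingleton.elim (α := SpecField κ) _ _
      subst hz
      exact hp.symm.trans (one_mul _).symm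
    · exact (inv_mul_cancel_right _ _).symm
  · intro W w hw n n' c d h
    obtain ⟨s₁, c₁, hn⟩ := exists_hasVal (C := C) hw n
    obtain ⟨s₂, c₂, hn'⟩ := exists_hasVal (C := C) hw n'
    rw [C.pointVal_val hS hw hn, C.pointVal_val hS hw hn'] at h
    obtain ⟨W₁, r₁, t₁, w₁, p, e, h₁, h₂, h₃, h₄, h₅⟩ := hn
    obtain ⟨W₁', r₁', t₁', w₁', p', e', h₁', h₂', h₃', h₄', h₅'⟩ := hn'
    let c' : (ConstSec S (etTop (SpecField κ)).left)ˣ := c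
    let d' : (ConstSec S (etTop (SpecField κ)).left)ˣ := d
    have hc := ConstSec.isUnit_fst hS c'
    have hd := ConstSec.isUnit_fst hS d'
    have hs : s₁ = s₂ := by
      let z : (etTop (SpecField κ)).left := (default : SpecField κ)
      have h1 : (c' : ConstSec S (etTop (SpecField κ)).left).1 z = 1 := by rw [hc]; rfl
      have h2 : (d' : ConstSec S (etTop (SpecField κ)).left).1 z = 1 := by rw [hd]; rfl
      have : (c' : ConstSec S (etTop (SpecField κ)).left).1 z * s₁ =
          (d' : ConstSec S (etTop (SpecField κ)).left).1 z * s₂ :=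
        congrArg (fun m : ConstSec S (etTop (SpecField κ)).left => m.1 z) h
      rwa [h1, h2, one_mul, one_mul] at this
    have H : (c' : ConstSec S (etTop (SpecField κ)).left).2 * c₁ =
        (d' : ConstSec S (etTop (SpecField κ)).left).2 * c₂ :=
      congrArg (fun m : ConstSec S (etTop (SpecField κ)).left => m.2) h
    obtain ⟨q, q', hq, hq', hqq⟩ := C.exists_of_ρ_eq p p' (h₄.trans (hs.trans h₄'.symm))
    have hx : w₁ ≫ W₁.hom = (etTop (SpecField κ)).hom ≫ C.x := by
      rw [← et_w t₁, ← Category.assoc, h₂, C.hy]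
    obtain ⟨W₂, a, b, w₂, ha, hb, k, k'⟩ := exists_etale_bowtie r₁ r₁' t₁ t₁' w₁ w₁' hx
      (h₁.trans h₁'.symm) (h₂.trans h₂'.symm)
    have hw₂ : w₂ ≫ (a ≫ t₁).left = C.y := by
      rw [← h₂, ← ha, Category.assoc]; rfl
    obtain ⟨W₃, r₃, w₃, hw₃, hu₃⟩ := C.exists_isUnit (a ≫ t₁) w₂ hw₂ hq
    have hw₃' : w₃ ≫ (r₃ ≫ a ≫ t₁).left = C.y := by
      rw [← hw₂, ← hw₃, Category.assoc]; rfl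
    obtain ⟨W₄, r₄, w₄, hw₄, hu₄⟩ := C.exists_isUnit (r₃ ≫ a ≫ t₁) w₃ hw₃' hq'
    let r := r₄ ≫ r₃
    have hr : w₄ ≫ r.left = w₂ := by
      rw [← hw₃, ← hw₄, Category.assoc]; rfl
    have hu : IsUnit (L.res (r ≫ a ≫ t₁) (C.β q)) := by
      have := hu₃.map (L.res r₄)
      rwa [LogStructure.res_res, ← Category.assoc] at this
    have hu' : IsUnit (L.res (r ≫ a ≫ t₁) (C.β q')) := by
      rwa [← Category.assoc] at hu₄
    have hy : w₄ ≫ (r ≫ a ≫ t₁).left = C.y := by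
      rw [← hw₂, ← hr, Category.assoc]; rfl
    have hwa : w₄ ≫ (r ≫ a).left = w₁ := by
      rw [← ha, ← hr, Category.assoc]; rfl
    have hwb : w₄ ≫ (r ≫ b).left = w₁' := by
      rw [← hb, ← hr, Category.assoc]; rfl
    have hwx : w₄ ≫ W₄.hom = (etTop (SpecField κ)).hom ≫ C.x := by
      rw [← et_w (r ≫ a ≫ t₁), ← Category.assoc, hy, C.hy]
    let A : (L.Sec W₄)ˣ := hu.unit * (Units.map (L.res (r ≫ a)) e)⁻¹
    let B : (L.Sec W₄)ˣ := hu'.unit * (Units.map (L.res (r ≫ b)) e')⁻¹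
    have hn₁ : L.res (r ≫ a ≫ r₁) n =
        (Units.map (L.res (r ≫ a)) e : (L.Sec W₄)ˣ) * L.res (r ≫ a ≫ t₁) (C.β p) := by
      rw [← Category.assoc, ← LogStructure.res_res, h₃, map_mul, LogStructure.res_res,
        Category.assoc]
      rfl
    have hn₂ : L.res (r ≫ a ≫ r₁) n' =
        (Units.map (L.res (r ≫ b)) e' : (L.Sec W₄)ˣ) * L.res (r ≫ a ≫ t₁) (C.β p') := by
      rw [k, k', ← Category.assoc, ← LogStructure.res_res, h₃', map_mul, LogStructure.res_res,
        Category.assoc]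
      rfl
    refine ⟨W₄, r ≫ a ≫ r₁, w₄, hwx, A, B, ?_, ?_, ?_⟩
    · rw [← h₁, ← ha, ← hr, Category.assoc, Category.assoc]; rfl
    · rw [hn₁, hn₂, ← mul_assoc, ← mul_assoc, ← Units.val_mul, ← Units.val_mul,
        inv_mul_cancel_right, inv_mul_cancel_right, IsUnit.unit_spec, IsUnit.unit_spec,
        ← map_mul, ← map_mul, ← map_mul, ← map_mul, hqq]
    · refine (constLog hS (SpecField κ)).eq_of_α_eq ?_ ?_
      · rw [map_mul, map_mul, (C.pointVal hS).α_val, (C.pointVal hS).α_val]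
        have hA : w₄.appTop.hom (L.α W₄ A) * w₁.appTop.hom (L.α W₁ e) = C.θ q := by
          rw [C.θ_eq q hq, ← appTop_α_res (r ≫ a) hwa (e : L.Sec W₁), ← appTop_α_res _ hy,
            ← map_mul, ← map_mul]
          exact congrArg (fun m => w₄.appTop.hom (L.α W₄ m))
            (congrArg Units.val (inv_mul_cancel_right hu.unit _))
        have hB : w₄.appTop.hom (L.α W₄ B) * w₁'.appTop.hom (L.α W₁' e') = C.θ q' := by
          rw [C.θ_eq q' hq', ← appTop_α_res (r ≫ b) hwb (e' : L.Sec W₁'), ← appTop_α_res _ hy,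
            ← map_mul, ← map_mul]
          exact congrArg (fun m => w₄.appTop.hom (L.α W₄ m))
            (congrArg Units.val (inv_mul_cancel_right hu'.unit _))
        have hαc : (constLog hS (SpecField κ)).α _ c =
            ((c' : ConstSec S (etTop (SpecField κ)).left).2 :
              Γ((etTop (SpecField κ)).left, ⊤)) := ConstSec.α_units hS c'
        have hαd : (constLog hS (SpecField κ)).α _ d =
            ((d' : ConstSec S (etTop (SpecField κ)).left).2 :
              Γ((etTop (SpecField κ)).left, ⊤)) := ConstSec.α_units hS d'
        rw [hαc, hαd]
        have K : (C.θ q * C.θ p : Γ((etTop (SpecField κ)).left, ⊤)) = C.θ q' * C.θ p' := by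
          rw [← Units.val_mul, ← Units.val_mul, ← map_mul, ← map_mul, hqq]
        have H' := congrArg Units.val H
        rw [Units.val_mul, Units.val_mul, h₅, h₅'] at H'
        have hM : IsUnit (w₁.appTop.hom (L.α W₁ e) * w₁'.appTop.hom (L.α W₁' e') * C.θ q *
            C.θ p) :=
          ((((e.isUnit.map _).map _).mul ((e'.isUnit.map _).map _)).mul (C.θ q).isUnit).mul
            (C.θ p).isUnit
        exact hM.mul_left_cancel (mul_eq_mul_of_fractions hA hB H' K)
      · rw [map_mul]
        exact ((A.isUnit.map _).map _).mul (d.isUnit.map _)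

end ChartPoint

end ChartPoint

/-! ### Points at which a log structure is not trivial -/

variable {X : Scheme.{u}} {L : LogStructure X}

lemma exists_notMem_basicOpen {V : Scheme.{u}} {f : Γ(V, ⊤)} (hf : ¬ IsUnit f) :
    ∃ x : V, x ∉ V.basicOpen f := by
  by_contra! h
  exact hf (RingedSpace.isUnit_of_isUnit_germ V.toRingedSpace ⊤ f fun x _ =>
    (Scheme.mem_basicOpen_top V f x).1 (h x))

lemma exists_specField_hom {V : Scheme.{u}} {v : V} {κ : Type u} [Field κ]
    (φ : V.residueField v →+* κ) : ∃ w : (etTop (SpecField κ)).left ⟶ V, ∀ z, w z = v :=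
  ⟨(Spec.map (CommRingCat.ofHom φ) ≫ V.fromSpecResidueField v : SpecField κ ⟶ V), fun z =>
    Scheme.fromSpecResidueField_apply v (Spec.map (CommRingCat.ofHom φ) z)⟩

lemma exists_geometricPoint (V : Scheme.{u}) (v : V) :
    ∃ (κ : Type u) (_ : Field κ) (_ : IsAlgClosed κ) (w : (etTop (SpecField κ)).left ⟶ V),
      ∀ z, w z = v :=
  ⟨AlgebraicClosure (V.residueField v), AlgebraicClosure.instField _, inferInstance,
    exists_specField_hom (algebraMap (V.residueField v) (AlgebraicClosure (V.residueField v)))⟩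

/-- The submonoid of the elements of a chart that do not vanish at a geometric point. -/
def invertibleAt {κ : Type u} [Field κ] {U : X.Etale} {P : Type u} [CommMonoid P]
    (β : P →* L.Sec U) (y : (etTop (SpecField κ)).left ⟶ U.left) : Submonoid P where
  carrier := {p | IsUnit (y.appTop.hom (L.α U (β p)))}
  one_mem' := by
    change IsUnit _
    rw [map_one, map_one, map_one]
    exact isUnit_one
  mul_mem' {a b} ha hb := by
    change IsUnit _
    rw [map_mul, map_mul, map_mul]
    exact IsUnit.mul ha hb

lemma mem_invertibleAt_of_mul {κ : Type u} [Field κ] {U : X.Etale} {P : Type u} [CommMonoid P]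
    {β : P →* L.Sec U} {y : (etTop (SpecField κ)).left ⟶ U.left} (a b : P)
    (h : a * b ∈ invertibleAt β y) : a ∈ invertibleAt β y := by
  have h' : IsUnit (y.appTop.hom (L.α U (β (a * b)))) := h
  rw [map_mul, map_mul, map_mul] at h'
  exact isUnit_of_mul_isUnit_left h'

/-- The values at a geometric point of the elements of a chart that do not vanish there extend to a
homomorphism on the whole chart, because the units of `κ` form a divisible group. -/
lemma exists_theta {κ : Type u} [Field κ] [IsAlgClosed κ] {U : X.Etale} {P : Type u}
    [CommMonoid P] [IsCancelMul P] (β : P →* L.Sec U) (y : (etTop (SpecField κ)).left ⟶ U.left) :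
    ∃ θ : P →* Γ((etTop (SpecField κ)).left, ⊤)ˣ, ∀ p ∈ invertibleAt β y,
      (θ p : Γ((etTop (SpecField κ)).left, ⊤)) = y.appTop.hom (L.α U (β p)) := by
  let ε : invertibleAt β y →* Γ((etTop (SpecField κ)).left, ⊤)ˣ :=
    IsUnit.liftRight ((y.appTop.hom.toMonoidHom.comp (L.α U)).comp
      (β.comp (invertibleAt β y).subtype)) fun p => p.2
  let e : Γ((etTop (SpecField κ)).left, ⊤)ˣ ≃* κˣ :=
    Units.mapEquiv (Scheme.ΓSpecIso (.of κ)).commRingCatIsoToRingEquiv.toMulEquiv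
  obtain ⟨θ, hθ⟩ := exists_extend_units (invertibleAt β y) κ (e.toMonoidHom.comp ε)
  refine ⟨e.symm.toMonoidHom.comp θ, fun p hp => ?_⟩
  have h1 : e.symm.toMonoidHom.comp θ p = ε ⟨p, hp⟩ :=
    e.symm_apply_eq.2 (hθ ⟨p, hp⟩)
  rw [h1]
  exact IsUnit.coe_liftRight _ (fun p => p.2) (⟨p, hp⟩ : invertibleAt β y)

/-- An fs log structure that is not trivial is not trivial at some geometric point. -/
lemma exists_chartPoint (hL : L.IsFs) (hn : ¬ L.IsTrivial) :
    ∃ (κ : Type u) (_ : Field κ) (_ : IsAlgClosed κ) (S : Type u) (_ : CommMonoid S)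
      (_ : ChartPoint κ L S) (s : S), IsFsMonoid S ∧ (∀ a b : S, a * b = 1 → a = 1) ∧ s ≠ 1 := by
  simp only [LogStructure.IsTrivial, not_forall] at hn
  obtain ⟨U₀, m, hm⟩ := hn
  obtain ⟨x₀, hx₀⟩ := exists_notMem_basicOpen fun h => hm (L.isUnit_of_isUnit_α h)
  obtain ⟨U, y₀, P, _, β, hy₀, hP, hβ⟩ := hL (U₀.hom x₀)
  -- near a point where the section `m` is not invertible, `m` is a unit times the chart element `p`
  obtain ⟨z, hz₁, hz₂⟩ := Scheme.Pullback.exists_preimage_pullback x₀ y₀ hy₀.symm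
  let W : X.Etale := etOf U₀ (pullback.fst U₀.hom U.hom)
      (MorphismProperty.pullback_fst (P := etProp) _ _ U.prop)
  let r : W ⟶ U₀ := etHom (pullback.fst _ _) rfl
  let t : W ⟶ U := etHom (pullback.snd _ _) pullback.condition.symm
  obtain ⟨W', s, w, p, c, hs, e⟩ := hβ.surj W t (L.res r m) z
  obtain ⟨κ, _, _, ξ, hξ⟩ := exists_geometricPoint W'.left w
  let y : (etTop (SpecField κ)).left ⟶ U.left := ξ ≫ (s ≫ t).left
  have := hP.cancel
  obtain ⟨θ, hθ⟩ := exists_theta β y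
  have hQ := mem_invertibleAt_of_mul (L := L) (β := β) (y := y)
  refine ⟨κ, inferInstance, inferInstance, FaceQuotient (invertibleAt β y), inferInstance,
    { x := (y : SpecField κ ⟶ U.left) ≫ U.hom
      U := U
      y := y
      hy := (Category.id_comp _).symm
      P := P
      β := β
      isChart := hβ
      ρ := faceMk _
      ρ_surjective := faceMk_surjective _
      ρ_eq_one_iff := fun p => faceMk_eq_one_iff hQ
      exists_of_ρ_eq := fun p p' h => by
        obtain ⟨q, hq, q', hq', e⟩ := (faceMk_eq_iff _).1 h
        exact ⟨q, q', (faceMk_eq_one_iff hQ).2 hq, (faceMk_eq_one_iff hQ).2 hq', e⟩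
      θ := θ
      θ_eq := fun p hp => hθ p ((faceMk_eq_one_iff hQ).1 hp) }, faceMk _ p,
    faceQuotient_isFs hP, faceQuotient_sharp hQ, fun h => hx₀ ?_⟩
  have h1 : IsUnit (y.appTop.hom (L.α U (β p))) := (faceMk_eq_one_iff hQ).1 h
  have h2 : IsUnit ((ξ ≫ (s ≫ r).left).appTop.hom (L.α U₀ m)) := by
    rw [← ChartPoint.appTop_α_res (w' := ξ) (s ≫ r) rfl, ← LogStructure.res_res, e, map_mul,
      map_mul, ChartPoint.appTop_α_res (w' := ξ) (s ≫ t) rfl]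
    exact ((c.isUnit.map _).map _).mul h1
  have h3 := mem_basicOpen_of_isUnit_appTop _ h2 (default : SpecField κ)
  have h4 : (ξ ≫ (s ≫ r).left) (default : SpecField κ) = x₀ := by
    rw [← hz₁, ← hs, ← hξ (default : SpecField κ)]
    rfl
  rwa [h4] at h3

/-! ### Agreement of sections of an étale sheaf on `Log` is an open condition -/

section Openness

variable {k : Type u} [Field k] {S : Type u} [CommMonoid S] [TopologicalSpace S]
  [DiscreteTopology S] (hS : ∀ a b : S, a * b = 1 → a = 1) (hfs : IsFsMonoid S)

/-- The log scheme over `k` with constant log structure. -/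
noncomputable def constSch (Y : Over (Spec (CommRingCat.of k))) : LogSch k :=
  ⟨Y, constLog hS Y.left, constLog_isFs hS hfs Y.left⟩

/-- The morphism of constant log schemes over `k` given by a morphism of schemes and a homomorphism
from the characteristic monoid to the invertible functions. -/
noncomputable def constMor {Y' Y : Over (Spec (CommRingCat.of k))} (f : Y' ⟶ Y)
    (τ : S →* Γ(Y'.left, ⊤)ˣ) : constSch hS hfs Y' ⟶ constSch hS hfs Y :=
  LogSch.Hom.mk (constHom hS f.left τ) (constHom_isStrict f.left τ) (Over.w f)

variable {hS hfs}

lemma constMor_comp {Y'' Y' Y : Over (Spec (CommRingCat.of k))} (f' : Y'' ⟶ Y')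
    (τ' : S →* Γ(Y''.left, ⊤)ˣ) (f : Y' ⟶ Y) (τ : S →* Γ(Y'.left, ⊤)ˣ) :
    constMor hS hfs f' τ' ≫ constMor hS hfs f τ =
      constMor hS hfs (f' ≫ f) (ConstSec.pullHom f'.left τ * τ') :=
  LogSch.Hom.ext (constHom_comp _ _ _ _)

lemma constMor_id (Y : Over (Spec (CommRingCat.of k))) :
    constMor hS hfs (𝟙 Y) 1 = 𝟙 (constSch hS hfs Y) :=
  LogSch.Hom.ext (constHom_id _)

/-- A strict morphism lifts along a strict étale morphism if the underlying morphism of schemes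
does. -/
lemma exists_lift_of_etale {A T U : LogSch k} (p : U ⟶ T) (hp : Etale p.hom.base) (φ : A ⟶ T)
    (g : A.toOver.left ⟶ U.toOver.left) (hg : g ≫ p.hom.base = φ.hom.base) :
    ∃ ψ : A ⟶ U, ψ.hom.base = g ∧ ψ ≫ p = φ :=
  ⟨LogSch.Hom.mk (LogHom.etaleLift p.strict hp φ.hom g hg)
      (LogHom.etaleLift_isStrict p.strict hp φ.hom g hg φ.strict) (by
        rw [← φ.w, ← hg, Category.assoc, p.w]; rfl), rfl,
    LogSch.Hom.ext (LogHom.etaleLift_comp p.strict hp φ.hom g hg)⟩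

lemma hom_ext_of_etale {A T U : LogSch k} (p : U ⟶ T) (hp : Etale p.hom.base) {φ ψ : A ⟶ U}
    (hb : φ.hom.base = ψ.hom.base) (h : φ ≫ p = ψ ≫ p) : φ = ψ :=
  LogSch.Hom.ext (LogHom.ext_of_etale p.strict hp hb (congrArg LogSch.Hom.hom h))

/-- The locus where two morphisms to a scheme étale over the base agree is open. -/
lemma exists_open_equalizer {V U T : Scheme.{u}} (f g : V ⟶ U) (p : U ⟶ T) [Etale p]
    (h : f ≫ p = g ≫ p) : ∃ (E : Scheme.{u}) (i : E ⟶ V), IsOpenImmersion i ∧ i ≫ f = i ≫ g ∧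
      ∀ (A : Scheme.{u}) (a : A ⟶ V), a ≫ f = a ≫ g → ∃ b : A ⟶ E, b ≫ i = a := by
  obtain ⟨d, hf, hg⟩ : ∃ d : V ⟶ pullback p p, d ≫ pullback.fst p p = f ∧
      d ≫ pullback.snd p p = g :=
    ⟨pullback.lift f g h, pullback.lift_fst _ _ _, pullback.lift_snd _ _ _⟩
  have hc := pullback.condition (f := d) (g := pullback.diagonal p)
  have h1 : pullback.fst d (pullback.diagonal p) ≫ f = pullback.snd d (pullback.diagonal p) := by
    simpa [hf] using congrArg (· ≫ pullback.fst p p) hc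
  have h2 : pullback.fst d (pullback.diagonal p) ≫ g = pullback.snd d (pullback.diagonal p) := by
    simpa [hg] using congrArg (· ≫ pullback.snd p p) hc
  refine ⟨pullback d (pullback.diagonal p), pullback.fst _ _, inferInstance, h1.trans h2.symm,
    fun A a ha => ⟨pullback.lift a (a ≫ f) ?_, pullback.lift_fst _ _ _⟩⟩
  apply pullback.hom_ext
  · simp [hf]
  · simp [hg, ha]

lemma map_comp_op_apply {C : Type*} [Category* C] (F : Cᵒᵖ ⥤ Type*) {A B D : C} (f : A ⟶ B)
    (g : B ⟶ D) (b : F.obj (op D)) : F.map (f ≫ g).op b = F.map f.op (F.map g.op b) := by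
  rw [op_comp, F.map_comp]
  rfl

variable {κ : Type u} [Field κ] [IsAlgClosed κ]

/-- If two sections over a constant log scheme of an étale sheaf on `Log` agree at a geometric
point, then they agree on an étale neighbourhood of this point. -/
lemma exists_nbhd_of_eq {F : (LogSch k)ᵒᵖ ⥤ Type (u + 1)} (hF : IsEtaleOverLog F)
    {K Y : Over (Spec (CommRingCat.of k))} (hK : K.left = SpecField κ) (pt : K ⟶ Y)
    (τ : S →* Γ(K.left, ⊤)ˣ) (b₁ b₂ : F.obj (op (constSch hS hfs Y)))
    (h : F.map (constMor hS hfs pt τ).op b₁ = F.map (constMor hS hfs pt τ).op b₂) :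
    ∃ (E : Over (Spec (CommRingCat.of k))) (e : E ⟶ Y), Etale e.left ∧ Nonempty E.left ∧
      F.map (constMor hS hfs e 1).op b₁ = F.map (constMor hS hfs e 1).op b₂ := by
  obtain ⟨U, p, a, hp, hatlas⟩ := hF.atlas (constSch hS hfs Y)
  obtain ⟨V₁, v₁, w₁, hv₁, hv₁s, hw₁, ha₁, -⟩ := hatlas _ (𝟙 _) b₁
  rw [Category.comp_id] at hw₁
  -- the geometric point lifts to `V₁`
  obtain ⟨r₁, hr₁⟩ : ∃ r₁ : constSch hS hfs K ⟶ V₁, r₁ ≫ v₁ = constMor hS hfs pt τ := by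
    obtain ⟨K, _, κK⟩ := K
    change K = SpecField κ at hK
    subst hK
    obtain ⟨z, hz⟩ := hv₁s.surj (pt.left (default : SpecField κ))
    obtain ⟨l, hl, -⟩ := Scheme.exists_fac_of_etale_of_isSepClosed v₁.hom.base
      (pt.left : SpecField κ ⟶ Y.left) z hz
    obtain ⟨ψ, -, hψ⟩ := exists_lift_of_etale v₁ hv₁ (constMor hS hfs pt τ) l hl
    exact ⟨ψ, hψ⟩
  -- étale locally, on `V`, the section `b₂` is also induced by a morphism to the atlas `U`; the
  -- point lifts to `V` with the same image in `U` under both morphisms, since `b₁` and `b₂` agree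
  -- there
  obtain ⟨V, v, w, hv, -, hw, ha, huniv⟩ := hatlas V₁ v₁ (F.map v₁.op b₂)
  obtain ⟨r, ⟨hr, hr'⟩, -⟩ := huniv _ r₁ (r₁ ≫ w₁) (by rw [Category.assoc, hw₁]) (by
    rw [map_comp_op_apply, ha₁, ← map_comp_op_apply, ← map_comp_op_apply, hr₁, h])
  -- the two morphisms to `U` agree on an open subscheme of `V` through which the point factors
  obtain ⟨E, i, hi, hie, hilift⟩ := exists_open_equalizer (v ≫ w₁).hom.base w.hom.base p.hom.base
    (congrArg (fun t => t.hom.base) (show (v ≫ w₁) ≫ p = w ≫ p by rw [Category.assoc, hw₁, hw]))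
  obtain ⟨j, hj⟩ := hilift _ r.hom.base (congrArg (fun t => t.hom.base)
    (show r ≫ v ≫ w₁ = r ≫ w by rw [← Category.assoc, hr, hr']))
  let E' : Over (Spec (CommRingCat.of k)) := Over.mk (i ≫ (v ≫ v₁).hom.base ≫ Y.hom)
  let e : E' ⟶ Y := Over.homMk (i ≫ (v ≫ v₁).hom.base) (Category.assoc _ _ _)
  have hvv : Etale (v ≫ v₁).hom.base := etProp.comp_mem _ _ hv hv₁
  obtain ⟨ψ, hψb, hψ⟩ := exists_lift_of_etale (v ≫ v₁) hvv (constMor hS hfs e 1) i rfl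
  have key : ψ ≫ v ≫ w₁ = ψ ≫ w := by
    refine hom_ext_of_etale p hp ?_ ?_
    · have h1 : ψ.hom.base ≫ (v ≫ w₁).hom.base = ψ.hom.base ≫ w.hom.base := by
        rw [hψb]; exact hie
      exact h1
    · rw [Category.assoc, Category.assoc, Category.assoc, hw₁, hw]
  refine ⟨E', e, etProp.comp_mem _ _ (inferInstanceAs (Etale i)) hvv, ?_, ?_⟩
  · obtain ⟨K, _, κK⟩ := K
    change K = SpecField κ at hK
    subst hK
    exact ⟨j (default : SpecField κ)⟩
  · have h1 := congrArg (fun t => F.map t.op a) key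
    simp only [map_comp_op_apply, ha₁, ha] at h1
    rw [← hψ]
    simpa only [map_comp_op_apply] using h1

end Openness

/-! ### Automorphisms that preserve a section of an étale sheaf on `Log` -/

section Automorphism

/-- The punctured affine line: an irreducible scheme with an invertible function `t` that takes the
values `1` and `-1`. -/
lemma exists_puncturedLine (κ : Type u) [Field κ] :
    ∃ (Y : Scheme.{u}) (_ : IrreducibleSpace Y) (π : Y ⟶ SpecField κ) (t : Γ(Y, ⊤)ˣ),
      (∃ i : SpecField κ ⟶ Y, i ≫ π = 𝟙 _ ∧ Units.map i.appTop.hom.toMonoidHom t = 1) ∧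
      ∃ i : SpecField κ ⟶ Y, i ≫ π = 𝟙 _ ∧ Units.map i.appTop.hom.toMonoidHom (-t) = 1 := by
  let R : CommRingCat.{u} := .of (LaurentPolynomial κ)
  let T : (LaurentPolynomial κ)ˣ := (LaurentPolynomial.isUnit_T 1).unit
  let φ : CommRingCat.of κ ⟶ R := CommRingCat.ofHom LaurentPolynomial.C
  let t : Γ(Spec R, ⊤)ˣ := Units.map (Scheme.ΓSpecIso R).inv.hom.toMonoidHom T
  let ev (a : κˣ) : R ⟶ CommRingCat.of κ :=
    CommRingCat.ofHom (LaurentPolynomial.eval₂ (RingHom.id κ) a)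
  have hev (a : κˣ) : Spec.map (ev a) ≫ Spec.map φ = 𝟙 _ := by
    rw [← Spec.map_comp, ← Spec.map_id]
    congr 1
    ext x
    exact LaurentPolynomial.eval₂_C _ _ x
  have hT (a : κˣ) : (Spec.map (ev a)).appTop.hom t = (Scheme.ΓSpecIso (.of κ)).inv.hom a := by
    have h := congrArg (fun f => f.hom (T : LaurentPolynomial κ))
      (Scheme.ΓSpecIso_inv_naturality (ev a))
    refine h.symm.trans ?_
    refine congrArg (Scheme.ΓSpecIso (.of κ)).inv.hom ?_
    refine (LaurentPolynomial.eval₂_T (RingHom.id κ) a 1).trans ?_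
    rw [zpow_one]
  refine ⟨Spec R, inferInstanceAs (IrreducibleSpace (Spec (.of (LaurentPolynomial κ)))),
    Spec.map φ, t, ⟨Spec.map (ev 1), hev 1, Units.ext ?_⟩, ⟨Spec.map (ev (-1)), hev _,
      Units.ext ?_⟩⟩
  · exact (hT 1).trans (map_one _)
  · change (Spec.map (ev (-1))).appTop.hom (-(t : Γ(Spec R, ⊤))) = 1
    rw [map_neg, hT, Units.val_neg, Units.val_one, map_neg, map_one, neg_neg]

variable {S : Type u} [CommMonoid S] (χ : S →* Multiplicative ℤ)

/-- The homomorphism `s ↦ u ^ χ(s)`. -/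
def powHom {V : Scheme.{u}} (u : Γ(V, ⊤)ˣ) : S →* Γ(V, ⊤)ˣ := (zpowersHom _ u).comp χ

lemma powHom_apply {V : Scheme.{u}} (u : Γ(V, ⊤)ˣ) (s : S) :
    powHom χ u s = u ^ (χ s).toAdd := rfl

lemma powHom_one {V : Scheme.{u}} : powHom χ (1 : Γ(V, ⊤)ˣ) = 1 :=
  MonoidHom.ext fun s => by rw [powHom_apply, one_zpow]; rfl

lemma powHom_mul {V : Scheme.{u}} (u v : Γ(V, ⊤)ˣ) :
    powHom χ u * powHom χ v = powHom χ (u * v) :=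
  MonoidHom.ext fun s => by
    rw [MonoidHom.mul_apply, powHom_apply, powHom_apply, powHom_apply, mul_zpow]

lemma pullHom_powHom {V W : Scheme.{u}} (f : W ⟶ V) (u : Γ(V, ⊤)ˣ) :
    ConstSec.pullHom f (powHom χ u) = powHom χ (Units.map f.appTop.hom.toMonoidHom u) :=
  MonoidHom.ext fun s => by
    exact map_zpow (Units.map f.appTop.hom.toMonoidHom) u (χ s).toAdd

lemma pullHom_one {V W : Scheme.{u}} (f : W ⟶ V) :
    ConstSec.pullHom (S := S) f 1 = 1 := MonoidHom.comp_one (Units.map _)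

variable [TopologicalSpace S] [DiscreteTopology S] {hS : ∀ a b : S, a * b = 1 → a = 1}
  {hfs : IsFsMonoid S} {k : Type u} [Field k]

lemma constMor_congr {Y' Y : Over (Spec (CommRingCat.of k))} {f f' : Y' ⟶ Y}
    {τ τ' : S →* Γ(Y'.left, ⊤)ˣ} (hf : f = f') (h : ∀ s, τ s = τ' s) :
    constMor hS hfs f τ = constMor hS hfs f' τ' := by
  rw [hf, MonoidHom.ext h]

variable (hS hfs) in
/-- The automorphism of a constant log scheme that multiplies the sections `s ∈ S` by `u ^ χ(s)`. -/
noncomputable def rotate {Y : Over (Spec (CommRingCat.of k))} (u : Γ(Y.left, ⊤)ˣ) :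
    constSch hS hfs Y ⟶ constSch hS hfs Y := constMor hS hfs (𝟙 Y) (powHom χ u)

lemma constMor_rotate {Y' Y : Over (Spec (CommRingCat.of k))} (f : Y' ⟶ Y) (u : Γ(Y.left, ⊤)ˣ) :
    constMor hS hfs f 1 ≫ rotate χ hS hfs u =
      rotate χ hS hfs (Units.map f.left.appTop.hom.toMonoidHom u) ≫ constMor hS hfs f 1 := by
  rw [rotate, rotate, constMor_comp, constMor_comp, pullHom_powHom, pullHom_one]
  exact constMor_congr ((Category.comp_id _).trans (Category.id_comp _).symm) fun s =>
    (mul_one _).trans (one_mul _).symm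

lemma rotate_one (Y : Over (Spec (CommRingCat.of k))) :
    rotate χ hS hfs (1 : Γ(Y.left, ⊤)ˣ) = 𝟙 _ := by
  rw [rotate, powHom_one, constMor_id]

lemma rotate_rotate {Y : Over (Spec (CommRingCat.of k))} (u v : Γ(Y.left, ⊤)ˣ) :
    rotate χ hS hfs u ≫ rotate χ hS hfs v = rotate χ hS hfs (v * u) := by
  rw [rotate, rotate, constMor_comp, pullHom_powHom, powHom_mul, Category.comp_id]
  refine constMor_congr rfl fun s => congrArg (fun w => powHom χ w s)
    (congrArg (· * u) (Units.ext ?_))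
  change (𝟙 Y.left : Y.left ⟶ Y.left).appTop.hom v = v
  rw [Scheme.Hom.id_appTop]
  rfl

lemma constMor_one_comp {Y'' Y' Y : Over (Spec (CommRingCat.of k))} (f' : Y'' ⟶ Y') (f : Y' ⟶ Y) :
    constMor hS hfs f' 1 ≫ constMor hS hfs f 1 = constMor hS hfs (f' ≫ f) 1 := by
  rw [constMor_comp, pullHom_one]
  exact constMor_congr rfl fun s => mul_one _

/-- If `χ` has an odd value, the automorphism that multiplies `s` by `(-1) ^ χ(s)` is not the
identity. -/
lemma rotate_neg_one_ne [CharZero k] {Y : Over (Spec (CommRingCat.of k))} [Nonempty Y.left]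
    {s : S} (hs : Odd (χ s).toAdd) : rotate χ hS hfs (-1 : Γ(Y.left, ⊤)ˣ) ≠ 𝟙 _ := by
  intro h
  have h1 : constHom hS (𝟙 Y.left) (powHom χ (-1)) = LogHom.id (constLog hS Y.left) :=
    congrArg LogSch.Hom.hom h
  let n : ConstSec S Y.left := (ContinuousMap.const _ s, 1)
  have w : 𝟙 Y.left ≫ (etTop Y.left).hom = (etTop Y.left).hom ≫ 𝟙 Y.left := rfl
  have h2 : ConstSec.tw (ConstSec.pullHom (𝟙 Y.left) (powHom χ (-1))) (ConstSec.pull (𝟙 Y.left) n) =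
      ConstSec.pull (𝟙 Y.left) n :=
    LogHom.comap_eq_of_eq h1 (W := etTop Y.left) (V := etTop Y.left) (𝟙 Y.left) w w n
  rw [ConstSec.pull_id, ConstSec.tw_const, pullHom_powHom, powHom_apply] at h2
  have h3 : (1 : Γ(Y.left, ⊤)ˣ) *
      (Units.map (Scheme.Hom.appTop (𝟙 Y.left)).hom.toMonoidHom (-1)) ^ (χ s).toAdd = 1 :=
    congrArg (fun m : ConstSec S Y.left => m.2) h2
  have h4 : Units.map (Scheme.Hom.appTop (𝟙 Y.left)).hom.toMonoidHom (-1 : Γ(Y.left, ⊤)ˣ) = -1 :=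
    Units.ext (by
      change (Scheme.Hom.appTop (𝟙 Y.left)).hom (-1) = -1
      rw [map_neg, map_one])
  rw [one_mul, h4, hs.neg_one_zpow] at h3
  have h5 : (-1 : Γ(Y.left, ⊤)) = 1 := congrArg Units.val h3
  let g : k →+* Γ(Y.left, ⊤) :=
    Y.hom.appTop.hom.comp (Scheme.ΓSpecIso (CommRingCat.of k)).inv.hom
  have : Nonempty (⊤ : Y.left.Opens) := ⟨⟨Classical.arbitrary _, trivial⟩⟩
  have : Nontrivial Γ(Y.left, ⊤) := inferInstance
  have h6 : (-1 : k) = 1 := g.injective (by rw [map_neg, map_one, h5])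
  exact (by norm_num : (-1 : k) ≠ 1) h6

/-- If the log structure of `X` is not trivial, some log scheme over `X` has a nontrivial involution
that is the identity on the underlying scheme and fixes the section of `F` induced by `s`, although
it need not be compatible with the morphism to `X`. -/
theorem exists_rotate_fixing [CharZero k] (X : LogSch k) {F : (LogSch k)ᵒᵖ ⥤ Type (u + 1)}
    (hF : IsEtaleOverLog F) (s : F.obj (op X)) (hX : ¬ X.log.IsTrivial) :
    ∃ (T : LogSch k) (q : T ⟶ T) (a : T ⟶ X), q.hom.base = 𝟙 _ ∧ q ≫ q = 𝟙 T ∧ q ≠ 𝟙 T ∧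
      F.map q.op (F.map a.op s) = F.map a.op s := by
  obtain ⟨κ, _, _, S, _, C, s₀, hfs, hS, hs₀⟩ := exists_chartPoint X.isFs hX
  let : TopologicalSpace S := ⊥
  have : DiscreteTopology S := ⟨rfl⟩
  obtain ⟨χ, s₁, hχ⟩ := hfs.exists_odd hS hs₀
  obtain ⟨Y, _, π, t, ⟨i₁, hi₁, ht₁⟩, ⟨i₂, hi₂, ht₂⟩⟩ := exists_puncturedLine κ
  let K : Over (Spec (CommRingCat.of k)) := Over.mk (C.x ≫ X.toOver.hom)
  let φ : constSch hS hfs K ⟶ X :=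
    LogSch.Hom.mk (C.pointVal hS).toLogHom (C.pointVal_isStrict hS) rfl
  let Y' : Over (Spec (CommRingCat.of k)) := Over.mk (π ≫ K.hom)
  let π' : Y' ⟶ K := Over.homMk π
  obtain ⟨b, hb⟩ : ∃ b : F.obj (op (constSch hS hfs Y')),
    b = F.map (constMor hS hfs π' 1 ≫ φ).op s := ⟨_, rfl⟩
  have key (i : SpecField κ ⟶ Y) (hi : i ≫ π = 𝟙 _) (u : Γ(Y, ⊤)ˣ)
      (hu : Units.map i.appTop.hom.toMonoidHom u = 1) :
      ∃ (E : Over (Spec (CommRingCat.of k))) (e : E ⟶ Y'), Etale e.left ∧ Nonempty E.left ∧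
        F.map (constMor hS hfs e 1).op b = F.map (constMor hS hfs e 1).op
          (F.map (rotate χ hS hfs (Y := Y') u).op b) := by
    let i' : K ⟶ Y' := Over.homMk i ((Category.assoc _ _ _).symm.trans
      ((congrArg (· ≫ K.hom) hi).trans (Category.id_comp _)))
    refine exists_nbhd_of_eq hF (κ := κ) rfl i' 1 _ _ ?_
    rw [← map_comp_op_apply, constMor_rotate]
    have hu' : Units.map i'.left.appTop.hom.toMonoidHom u = 1 := hu
    rw [hu', rotate_one, Category.id_comp]
  obtain ⟨E₁, e₁, he₁, ⟨x₁⟩, h₁⟩ := key i₁ hi₁ t ht₁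
  obtain ⟨E₂, e₂, he₂, ⟨x₂⟩, h₂⟩ := key i₂ hi₂ (-t) ht₂
  -- the two étale neighbourhoods meet, since the punctured line is irreducible
  obtain ⟨_, ⟨y₁, rfl⟩, y₂, hy⟩ : (Set.range e₁.left ∩ Set.range e₂.left).Nonempty :=
    nonempty_preirreducible_inter (X := Y) e₁.left.isOpenMap.isOpen_range
      e₂.left.isOpenMap.isOpen_range ⟨_, x₁, rfl⟩ ⟨_, x₂, rfl⟩
  obtain ⟨z, -, -⟩ := Scheme.Pullback.exists_preimage_pullback y₁ y₂ hy.symm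
  let e : pullback e₁.left e₂.left ⟶ Y := pullback.fst e₁.left e₂.left ≫ e₁.left
  let E : Over (Spec (CommRingCat.of k)) := Over.mk (e ≫ Y'.hom)
  let e' : E ⟶ Y' := Over.homMk e
  let p₁ : E ⟶ E₁ := Over.homMk (pullback.fst e₁.left e₂.left) (by
    change _ = (_ ≫ _) ≫ _
    rw [← Over.w e₁, Category.assoc])
  let p₂ : E ⟶ E₂ := Over.homMk (pullback.snd e₁.left e₂.left) (by
    change _ = (_ ≫ _) ≫ _
    rw [← Over.w e₂, pullback.condition, Category.assoc])
  have hp₁ : p₁ ≫ e₁ = e' := Over.OverMorphism.ext rfl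
  have hp₂ : p₂ ≫ e₂ = e' := Over.OverMorphism.ext pullback.condition.symm
  have H₁ := congrArg (F.map (constMor hS hfs p₁ 1).op) h₁
  have H₂ := congrArg (F.map (constMor hS hfs p₂ 1).op) h₂
  simp only [← map_comp_op_apply] at H₁ H₂
  rw [← Category.assoc, constMor_one_comp, hp₁, constMor_rotate] at H₁
  rw [← Category.assoc, constMor_one_comp, hp₂, constMor_rotate] at H₂
  have : Nonempty E.left := ⟨z⟩
  refine ⟨constSch hS hfs E, rotate χ hS hfs (-1), constMor hS hfs e' 1 ≫ constMor hS hfs π' 1 ≫ φ,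
    rfl, ?_, rotate_neg_one_ne χ hχ, ?_⟩
  · rw [rotate_rotate, neg_mul_neg, one_mul, rotate_one]
  · rw [map_comp_op_apply F (constMor hS hfs e' 1), ← hb]
    -- rotation by `-t` is rotation by `-1` followed by rotation by `t`, and rotations by `-t` and
    -- by `t` both fix the restriction of `b`
    let v : Γ(E.left, ⊤)ˣ := Units.map e.appTop.hom.toMonoidHom t
    have hv : Units.map e'.left.appTop.hom.toMonoidHom (-t) = v * -1 := Units.ext (by
      change e.appTop.hom (-(t : Γ(Y, ⊤))) = e.appTop.hom (t : Γ(Y, ⊤)) * -1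
      rw [map_neg, mul_neg_one])
    rw [hv, ← rotate_rotate, Category.assoc, map_comp_op_apply F (rotate χ hS hfs (-1))] at H₂
    have hv' : Units.map e'.left.appTop.hom.toMonoidHom t = v := rfl
    rw [hv'] at H₁
    rw [← H₁] at H₂
    exact H₂.symm

end Automorphism

/-! ### Points of the ordinary fixed locus outside the log fixed locus -/

section Ordinary

variable {k : Type u} [Field k] {X : LogSch k} {F : (LogSch k)ᵒᵖ ⥤ Type (u + 1)} {s : F.obj (op X)}

/-- In the image of the log fixed locus, the two isomorphisms carried by a point of the ordinary
fixed locus lie over the same isomorphism of log schemes. -/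
lemma pt_eq_of_iso_logFixedToOrdinary {n : ℕ} {σ : Equiv.Perm (Fin n)}
    {z : OrdinaryFixedLocus X F s σ} {z' : LogFixedLocus X F s σ}
    (α : (logFixedToOrdinary X F s σ).obj z' ≅ z) :
    Power.Hom.pt z.iso.hom.fst = Power.Hom.pt z.iso.hom.snd := by
  let a : z'.fst ⟶ z.fst := α.hom.fst
  let b : z'.snd ⟶ z.snd := α.hom.snd
  let b' : z'.snd.pt ⟶ z.snd.pt := Power.Hom.pt b
  have h₁ : Power.Hom.pt a ≫ Power.Hom.pt z.iso.hom.fst =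
      Power.Hom.pt z'.iso.hom.fst ≫ b' :=
    congrArg (fun t => Power.Hom.pt t.fst) α.hom.w
  have h₂ : Power.Hom.pt a ≫ Power.Hom.pt z.iso.hom.snd =
      Power.Hom.pt z'.iso.hom.snd ≫ b' :=
    congrArg (fun t => Power.Hom.pt t.snd) α.hom.w
  have h₃ : Power.Hom.pt α.inv.fst ≫ Power.Hom.pt a = 𝟙 _ :=
    congrArg (fun t => Power.Hom.pt t.fst) α.inv_hom_id
  have key {A B C D : Stack F} {a : A ⟶ B} {a' : B ⟶ A} {p p' : B ⟶ D} {u : A ⟶ C} {b : C ⟶ D}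
      (h : a' ≫ a = 𝟙 B) (h₁ : a ≫ p = u ≫ b) (h₂ : a ≫ p' = u ≫ b) : p = p' := by
    rw [← Category.id_comp p, ← Category.id_comp p', ← h, Category.assoc, Category.assoc, h₁, h₂]
  exact key h₃ (h₁.trans (congrArg (· ≫ b') (FixedLocus.pt_eq z'))) h₂

/-- An involution `q` of a log scheme `T` over the identity of the underlying scheme that preserves
the section of `F` induced by a morphism `a : T → X` gives a point of the ordinary fixed locus of
the transposition: the pair `(a, a)` over `F`, the second component being glued along `q`. -/
lemma not_isEquivalence_of_involution {T : LogSch k} (q : T ⟶ T) (a : T ⟶ X)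
    (hb : q.hom.base = 𝟙 _) (hq : q ≫ q = 𝟙 T) (hne : q ≠ 𝟙 T)
    (hs : F.map q.op (F.map a.op s) = F.map a.op s) :
    ¬ (logFixedToOrdinary X F s (Equiv.swap (0 : Fin 2) 1)).IsEquivalence := by
  intro hE
  let A : Stack F := ⟨T, F.map a.op s⟩
  let Q : A ≅ A := ⟨⟨q, hs⟩, ⟨q, hs⟩, Subtype.ext hq, Subtype.ext hq⟩
  let y : HatPower X F s (Fin 2) := ⟨A, fun _ => Over.mk a, ![Iso.refl _, Q]⟩
  let g : y ≅ (Power.perm _ (Equiv.swap (0 : Fin 2) 1)).obj y :=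
    Power.isoMk Q (fun _ => Iso.refl _) (by
      intro i
      have hQ : Q.hom ≫ Q.hom = 𝟙 A := Q.hom_inv_id
      fin_cases i
      · exact ((toFan X F s).map_id _ ▸ Category.id_comp _).trans (Category.id_comp _).symm
      · exact ((toFan X F s).map_id _ ▸ Category.id_comp _).trans hQ.symm)
  let z : OrdinaryFixedLocus X F s (Equiv.swap (0 : Fin 2) 1) :=
    ⟨y, y, CategoricalPullback.mkIso (Iso.refl _) g (by
      refine (Category.comp_id _).trans (Eq.trans ?_ (Category.id_comp _).symm)
      exact Over.OverMorphism.ext hb.symm)⟩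
  have h := pt_eq_of_iso_logFixedToOrdinary
    ((logFixedToOrdinary X F s (Equiv.swap (0 : Fin 2) 1)).objObjPreimageIso z)
  exact hne (congrArg Subtype.val h).symm

end Ordinary

end LogGeom

theorem mainTheorem6 (k : Type u) [Field k] [CharZero k] (X : LogGeom.LogSch k)
    (F : (LogGeom.LogSch k)ᵒᵖ ⥤ Type (u + 1)) (s : F.obj (op X))
    (hF : LogGeom.IsArtinFan X F s) :
    (∀ (n : ℕ) (σ : Equiv.Perm (Fin n))
      (e : LogGeom.Orbits σ ≃ Fin (Nat.card (LogGeom.Orbits σ))),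
      ∃ E : LogGeom.HatPower X F s (Fin (Nat.card (LogGeom.Orbits σ))) ≌
          LogGeom.LogFixedLocus X F s σ,
        Nonempty (E.functor ⋙ LogGeom.logFixedProj X F s σ ≅
          LogGeom.Power.reindex (LogGeom.toFan X F s) fun i => e (LogGeom.orbitOf σ i))) ∧
    (¬ X.log.IsTrivial →
      ¬ (LogGeom.logFixedToOrdinary X F s (Equiv.swap (0 : Fin 2) 1)).IsEquivalence) := by
  refine ⟨fun n σ e => LogGeom.exists_equivalence_logFixedLocus X F s σ e, fun hX => ?_⟩
  obtain ⟨T, q, a, hb, hq, hne, hs⟩ := LogGeom.exists_rotate_fixing X hF.etale s hX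
  exact LogGeom.not_isEquivalence_of_involution q a hb hq hne hs
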